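/- Let $p,q\in\mathbb{C}$ with $|p|<1$ and $0<|q|<1$, and put $(x;p)_\infty=\prod_{k\ge 0}(1-xp^k)$. For $x\neq 0$ let $E(x)=E(x;p)=(x;p)_\infty(p/x;p)_\infty$, for an integer $k\ge 0$ let $(x;q,p)_k=\prod_{j=0}^{k-1}E(xq^j;p)$, and write $(x_1,\dots,x_m;q,p)_k=(x_1;q,p)_k\cdots(x_m;q,p)_k$. Let $$_{10}\omega_9(a_1;a_4,\dots,a_{10};q,p)=\sum_{k=0}^{\infty}\frac{E(a_1q^{2k})}{E(a_1)}\,\frac{(a_1,a_4,\dots,a_{10};q,p)_k\,q^k}{(q,a_1q/a_4,\dots,a_1q/a_{10};q,p)_k},$$ considered only for terminating series, in which some $a_i$ ($i\ge 4$) equals $q^{-N}$ with $N$ a nonnegative integer; the terms with $k>N$ are then zero. Theorem. Let $n$ be a nonnegative integer and let $a,b,c,d,e,f$ be nonzero complex numbers with $bcd=a^2q$ and $ef=aq^{n+1}$. Then $$\sum_{k=0}^n\frac{E(aq^{3k})}{E(a)}\,\frac{(b,c,d;q^2,p)_k}{(aq/b,aq/c,aq/d;q,p)_k}\,\frac{(e,f,q^{-n};q,p)_k}{(aq^2/e,aq^2/f,aq^{n+2};q^2,p)_k}\,q^k$$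 $$=\frac{(aq,aq/bc;q,p)_n\,(aq^{1-n}/b,aq^{1-n}/c;q^2,p)_n}{(aq/b,aq/c;q,p)_n\,(aq^{1-n},aq^{1-n}/bc;q^2,p)_n}\;{_{10}\omega_9}\bigl(a^2/ef;\,b,c,d,a/e,a/f,q^{1-n},q^{-n};\,q^2,p\bigr),$$ provided that no denominator vanishes in the terms $0\le k\le n$ of the sum on the left, in the product on the right, and in the terms $0\le k\le\lfloor n/2\rfloor$ of the series on the right (which terminates at $k=\lfloor n/2\rfloor$). -/

import Mathlib

noncomputable section

/-- The infinite shifted factorial `(a;q)_∞ = ∏_{k ≥ 0} (1 - a q^k)`, for `|q| < 1`. -/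
def qPochInf (a q : ℂ) : ℂ := ∏' k : ℕ, (1 - a * q ^ k)

/-- The theta function `E(x;p) = (x;p)_∞ (p/x;p)_∞`, for `x ≠ 0` and `|p| < 1`. -/
def ellE (x p : ℂ) : ℂ := qPochInf x p * qPochInf (p / x) p

/-- The elliptic shifted factorial `(a;q,p)_n = ∏_{k=0}^{n-1} E(a q^k;p)`, for `n ≥ 0`. -/
def ellPoch (a q p : ℂ) (n : ℕ) : ℂ := ∏ k ∈ Finset.range n, ellE (a * q ^ k) p

/-- The condensed notation `(a₁,…,a_m;q,p)_n = (a₁;q,p)_n ⋯ (a_m;q,p)_n`. -/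
def ellPochs (as : List ℂ) (q p : ℂ) (n : ℕ) : ℂ := (as.map fun a => ellPoch a q p n).prod

/-- The factor `(q,a₁q/a₄,…,a₁q/a_{r+1};q,p)_k` in the denominator of the `k`-th term of
`_{r+1}ω_r(a₁;a₄,…,a_{r+1};q,p)`, where `as = [a₄,…,a_{r+1}]`. -/
def ellOmegaDen (a₁ : ℂ) (as : List ℂ) (q p : ℂ) (k : ℕ) : ℂ :=
  ellPochs (q :: as.map fun x => a₁ * q / x) q p k

/-- The very-well-poised elliptic hypergeometric series
`_{r+1}ω_r(a₁;a₄,…,a_{r+1};q,p)`, where `as = [a₄,…,a_{r+1}]`. It is used only for terminating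
series: some `a_i` with `i ≥ 4` is `q^{-N}`, so that the terms with `k > N` are zero. -/
def ellOmega (a₁ : ℂ) (as : List ℂ) (q p : ℂ) : ℂ :=
  ∑' k : ℕ, ellE (a₁ * q ^ (2 * k)) p / ellE a₁ p *
    (ellPochs (a₁ :: as) q p k * q ^ k / ellOmegaDen a₁ as q p k)

end

/-! Write every parameter as an exponential and put σ(z) = e^{-z/2} E(e^z; p). For p ≠ 0 this σ is
odd and satisfies the three-term relation, and for generic parameters the identity follows from
these two facts alone. Multiplicative parameters become additive ones (A for a, h for q, and so on),
and the exponential prefactors cancel in each term by the two balancing conditions.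

The dependence on e and f is removed first. Since ef is fixed, the quotient (e,f;q)_k / (aq²/e,
aq²/f; q²)_k is a function of the single variable (E - F)/2, and an elliptic partial fraction
expansion (`prod_sigmaPair_div_prod`) writes it as a sum over r ≤ k of the e, f factors of the r-th
term of the series on the right (`shiftProd_div_shiftProd_eq_sum`). After interchanging the sums,
the inner sum over k ≥ r no longer contains e or f. It is the same quadratic sum with a, b, c, d
replaced by aq^{3r}, bq^{2r}, cq^{2r}, dq^{2r} and n by n - r, and `sum_quadKernel` evaluates it in
closed form.

That quadratic summation is proved by inversion. Its kernel is lower triangular in (n, k), and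
partial fractions supply weights that annihilate every column but the last. Applied to the
conjectured closed forms, the same weights give, after a reordering of the indices, a Frenkel–Turaev
sum in base q² (`sum_jacksonTerm`), whose value is exactly the surviving last term. Induction on n
then determines the remaining closed form. The Frenkel–Turaev sum itself is an induction in which
both sides satisfy one contiguity relation, each time an instance of the three-term relation.

The three-term relation for σ comes from the Jacobi triple product: splitting a double theta series
by parity gives σ(x+y)σ(x-y) = c (f(x)g(y) - g(x)f(y)), and 2×2 determinants satisfy the Plücker
relation. Finally both sides are continuous where no denominator vanishes, and the nongeneric values
along suitable one-parameter deformations are countable, so the identity extends to all admissible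
parameters, including p = 0. -/

/-- Oddness and the three-term (Weierstrass–Riemann) relation, the two properties of the
sigma function that the algebra of elliptic hypergeometric series rests on. -/
structure IsSigmaLike (σ : ℂ → ℂ) : Prop where
  odd : ∀ z, σ (-z) = -σ z
  three_term : ∀ x y u v, σ (x + y) * σ (x - y) * (σ (u + v) * σ (u - v)) =
    σ (x + v) * σ (x - v) * (σ (u + y) * σ (u - y)) +
      σ (x + u) * σ (x - u) * (σ (y + v) * σ (y - v))

/-- The additive shifted factorial `∏_{j < k} σ (z + j h)`. -/
def shiftProd (σ : ℂ → ℂ) (z h : ℂ) (k : ℕ) : ℂ := ∏ j ∈ Finset.range k, σ (z + j * h)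

/-- No point of `z + ℤ h` is a zero of `σ`. -/
def AvoidsZeros (σ : ℂ → ℂ) (z h : ℂ) : Prop := ∀ j : ℤ, σ (z + j * h) ≠ 0

/-! ### Additive shifted factorials and genericity on cosets of ℤh. -/

section ShiftProd

variable {σ : ℂ → ℂ}

@[simp] lemma shiftProd_zero (z h : ℂ) : shiftProd σ z h 0 = 1 := by simp [shiftProd]

lemma shiftProd_succ (z h : ℂ) (k : ℕ) :
    shiftProd σ z h (k + 1) = shiftProd σ z h k * σ (z + k * h) := by
  simp [shiftProd, Finset.prod_range_succ]

lemma shiftProd_succ' (z h : ℂ) (k : ℕ) :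
    shiftProd σ z h (k + 1) = σ z * shiftProd σ (z + h) h k := by
  rw [shiftProd, Finset.prod_range_succ', mul_comm, shiftProd]
  congr 1
  · simp
  · refine Finset.prod_congr rfl fun j _ => ?_
    congr 1; push_cast; ring

lemma shiftProd_add (z h : ℂ) (r k : ℕ) :
    shiftProd σ z h (r + k) = shiftProd σ z h r * shiftProd σ (z + r * h) h k := by
  rw [shiftProd, Finset.prod_range_add, shiftProd, shiftProd]
  congr 1
  refine Finset.prod_congr rfl fun j _ => ?_
  congr 1; push_cast; ring

lemma shiftProd_two_mul (z h : ℂ) (k : ℕ) :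
    shiftProd σ z h (2 * k) = shiftProd σ z (2 * h) k * shiftProd σ (z + h) (2 * h) k := by
  induction k with
  | zero => simp
  | succ k ih =>
    rw [show 2 * (k + 1) = 2 * k + 1 + 1 by ring, shiftProd_succ, shiftProd_succ, ih,
      shiftProd_succ _ _ k, shiftProd_succ _ _ k]
    push_cast
    rw [show z + 2 * (k : ℂ) * h = z + k * (2 * h) by ring,
      show z + (2 * (k : ℂ) + 1) * h = z + h + k * (2 * h) by ring]
    ring

lemma shiftProd_rev (z h : ℂ) (k : ℕ) :
    shiftProd σ z h k = shiftProd σ (z + (k - 1) * h) (-h) k := by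
  rw [shiftProd, ← Finset.prod_range_reflect, shiftProd]
  refine Finset.prod_congr rfl fun j hj => ?_
  have : j + 1 ≤ k := Finset.mem_range.1 hj
  rw [show k - 1 - j = k - (j + 1) by omega, Nat.cast_sub this]
  congr 1; push_cast; ring

lemma IsSigmaLike.shiftProd_neg (hσ : IsSigmaLike σ) (z h : ℂ) (k : ℕ) :
    shiftProd σ (-z) (-h) k = (-1) ^ k * shiftProd σ z h k := by
  rw [shiftProd, shiftProd, ← Finset.card_range k, ← Finset.prod_const, Finset.card_range,
    ← Finset.prod_mul_distrib]
  refine Finset.prod_congr rfl fun j _ => ?_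
  rw [show -z + j * -h = -(z + j * h) by ring, hσ.odd]; ring

lemma IsSigmaLike.shiftProd_reflect (hσ : IsSigmaLike σ) (z h : ℂ) (k : ℕ) :
    shiftProd σ z h k = (-1) ^ k * shiftProd σ (-z - (k - 1) * h) h k := by
  rw [shiftProd_rev, show z + (k - 1) * h = -(-z - (k - 1) * h) by ring, hσ.shiftProd_neg]

lemma IsSigmaLike.map_zero (hσ : IsSigmaLike σ) : σ 0 = 0 := by
  have := hσ.odd 0
  rw [neg_zero] at this
  exact self_eq_neg.1 this

lemma AvoidsZeros.ne {z h w : ℂ} (hz : AvoidsZeros σ z h) (j : ℤ) (hw : w = z + j * h) :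
    σ w ≠ 0 := hw ▸ hz j

lemma AvoidsZeros.add {z h w : ℂ} (hz : AvoidsZeros σ z h) (j : ℤ) (hw : w = z + j * h) :
    AvoidsZeros σ w h := fun i => hz.ne (j + i) (by rw [hw]; push_cast; ring)

lemma AvoidsZeros.two {z h : ℂ} (hz : AvoidsZeros σ z h) : AvoidsZeros σ z (2 * h) :=
  fun i => hz.ne (2 * i) (by push_cast; ring)

lemma AvoidsZeros.neg (hσ : IsSigmaLike σ) {z h : ℂ} (hz : AvoidsZeros σ z h) :
    AvoidsZeros σ (-z) h := fun i => by
  have := hz (-i)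
  rw [show -z + i * h = -(z + (-i : ℤ) * h) by push_cast; ring, hσ.odd]
  exact neg_ne_zero.2 this

lemma AvoidsZeros.shiftProd_ne {z h w : ℂ} (hz : AvoidsZeros σ z h) (j : ℤ)
    (hw : w = z + j * h) (k : ℕ) : shiftProd σ w h k ≠ 0 :=
  Finset.prod_ne_zero_iff.2 fun i _ => hz.ne (j + i) (by rw [hw]; push_cast; ring)

lemma AvoidsZeros.shiftProd_two_ne {z h w : ℂ} (hz : AvoidsZeros σ z h) (j : ℤ)
    (hw : w = z + j * h) (k : ℕ) : shiftProd σ w (2 * h) k ≠ 0 :=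
  (hz.add j hw).two.shiftProd_ne 0 (by simp) k

end ShiftProd

/-! ### The Frenkel–Turaev summation. -/

section Jackson

variable {σ : ℂ → ℂ}

/-- The `k`-th term of the Frenkel–Turaev sum in additive notation; its fifth parameter is
`2 a + (N + 1) h - b - c - d`. -/
noncomputable def jacksonTerm (σ : ℂ → ℂ) (a b c d h : ℂ) (N k : ℕ) : ℂ :=
  σ (a + 2 * k * h) / σ a *
    (shiftProd σ a h k * shiftProd σ b h k * shiftProd σ c h k * shiftProd σ d h k *
      (shiftProd σ (2 * a + (N + 1) * h - b - c - d) h k * shiftProd σ (-N * h) h k)) /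
    (shiftProd σ h h k * shiftProd σ (a + h - b) h k * shiftProd σ (a + h - c) h k *
      shiftProd σ (a + h - d) h k *
      (shiftProd σ (b + c + d - a - N * h) h k * shiftProd σ (a + (N + 1) * h) h k))

/-- The k-independent multiplier in the contiguity relation between N and N + 1, shared by the terms
and by the product side. -/
noncomputable def jacksonFactor (σ : ℂ → ℂ) (a b c d h : ℂ) (N : ℕ) : ℂ :=
  σ (a + h) * σ (a + 2 * h) * σ b * σ c * σ d * σ (2 * a + (2 * N + 2) * h - b - c - d) *
      σ (a - b - c - d) /
    (σ (a + h - b) * σ (a + h - c) * σ (a + h - d) * σ (a + (N + 1) * h) * σ (a + (N + 2) * h) *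
      (σ (b + c + d - a - N * h) * σ (b + c + d - a - (N + 1) * h)))

/-- `ring` cannot cancel t * t⁻¹ without knowing t ≠ 0. Inserting the trivial factors that occur on
only one side makes both sides equal as formal monomials in atoms and inverses. -/
lemma eq_of_mul_mul_inv_eq {L R x y : ℂ} (hx : x ≠ 0) (hy : y ≠ 0)
    (h : L * (x * x⁻¹) = R * (y * y⁻¹)) : L = R := by
  rwa [mul_inv_cancel₀ hx, mul_inv_cancel₀ hy, mul_one, mul_one] at h

/-- Leaves a product that starts at z + 2h, as needed for the shift of a to a + 2h in the contiguity
relation. -/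
lemma shiftProd_succ_eq_div {z h : ℂ} {k : ℕ} (hz : σ (z + (k + 1) * h) ≠ 0) :
    shiftProd σ z h (k + 1) =
      σ z * σ (z + h) * shiftProd σ (z + 2 * h) h k / σ (z + (k + 1) * h) := by
  rw [eq_div_iff hz]
  have := shiftProd_succ (σ := σ) z h (k + 1)
  rw [shiftProd_succ', shiftProd_succ', show z + h + h = z + 2 * h by ring] at this
  push_cast at this
  rw [← this]; ring

lemma shiftProd_self_ne_zero {h : ℂ} (hh : ∀ j : ℤ, j ≠ 0 → σ (j * h) ≠ 0) (k : ℕ) :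
    shiftProd σ h h k ≠ 0 := Finset.prod_ne_zero_iff.2 fun i _ => by
  have := hh (i + 1) (by positivity)
  rwa [show h + i * h = ((i + 1 : ℤ) : ℂ) * h by push_cast; ring]

/-- The three terms share the common factor `C` below; what remains of them is a single instance of
the three-term relation. The fifth parameter depends on N, so the difference is not trivial. -/
lemma jacksonTerm_succ_sub (hσ : IsSigmaLike σ) {a b c d h : ℂ}
    (hh : ∀ j : ℤ, j ≠ 0 → σ (j * h) ≠ 0) (ha : AvoidsZeros σ a h)
    (hb : AvoidsZeros σ (a - b) h) (hc : AvoidsZeros σ (a - c) h) (hd : AvoidsZeros σ (a - d) h)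
    (he : AvoidsZeros σ (b + c + d - a) h) (N k : ℕ) :
    jacksonTerm σ a b c d h (N + 1) (k + 1) - jacksonTerm σ a b c d h N (k + 1) =
      jacksonFactor σ a b c d h N *
        jacksonTerm σ (a + 2 * h) (b + h) (c + h) (d + h) h N k := by
  -- `l` is the fifth parameter belonging to N + 1, so that belonging to N is `l - h`.
  obtain ⟨l, hl⟩ : ∃ l, l = 2 * a + (N + 2) * h - b - c - d := ⟨_, rfl⟩
  obtain ⟨e, he'⟩ : ∃ e, e = b + c + d - a := ⟨_, rfl⟩
  have key := hσ.three_term (a / 2 + h + k * h) (l - h - a / 2) (a / 2)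
    (a / 2 + (N + 1) * h)
  rw [show a / 2 + h + k * h + (l - h - a / 2) = l + k * h by ring,
    show a / 2 + h + k * h - (l - h - a / 2) = e + (k - N) * h by rw [he', hl]; ring,
    show a / 2 + (a / 2 + (N + 1) * h) = a + (N + 1) * h by ring,
    show a / 2 - (a / 2 + (N + 1) * h) = -(N + 1) * h by ring,
    show a / 2 + h + k * h + (a / 2 + (N + 1) * h) = a + (N + 1) * h + (k + 1) * h by ring,
    show a / 2 + h + k * h - (a / 2 + (N + 1) * h) = (k - N) * h by ring,
    show a / 2 + (l - h - a / 2) = l - h by ring,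
    show a / 2 - (l - h - a / 2) = e - (N + 1) * h by rw [he', hl]; ring,
    show a / 2 + h + k * h + a / 2 = a + (k + 1) * h by ring,
    show a / 2 + h + k * h - a / 2 = (k + 1) * h by ring,
    show l - h - a / 2 + (a / 2 + (N + 1) * h) = l + N * h by ring,
    show l - h - a / 2 - (a / 2 + (N + 1) * h) = a - b - c - d by rw [hl]; ring] at key
  have hPh := shiftProd_self_ne_zero hh k
  have hhk : σ ((k + 1) * h) ≠ 0 := by
    have := hh (k + 1) (by positivity)
    push_cast at this; exact this
  have nak : σ (a + (k + 1) * h) ≠ 0 := ha.ne (k + 1) (by push_cast; ring)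
  have naNk : σ (a + (N + 1) * h + (k + 1) * h) ≠ 0 := ha.ne (N + 1 + (k + 1)) (by push_cast; ring)
  have neNk : σ (e + (k - N) * h) ≠ 0 := he.ne (k - N) (by rw [he']; push_cast; ring)
  have na : σ a ≠ 0 := ha.ne 0 (by simp)
  have na2 : σ (a + 2 * h) ≠ 0 := ha.ne 2 (by simp)
  have nb : σ (a + h - b) ≠ 0 := hb.ne 1 (by push_cast; ring)
  have nc : σ (a + h - c) ≠ 0 := hc.ne 1 (by push_cast; ring)
  have nd : σ (a + h - d) ≠ 0 := hd.ne 1 (by push_cast; ring)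
  have ne0 : σ (e - N * h) ≠ 0 := he.ne (-N) (by rw [he']; push_cast; ring)
  have ne1 : σ (e - (N + 1) * h) ≠ 0 := he.ne (-(N + 1)) (by rw [he']; push_cast; ring)
  have nn1 : σ (a + (N + 1) * h) ≠ 0 := ha.ne (N + 1) (by push_cast; ring)
  have nn2 : σ (a + (N + 2) * h) ≠ 0 := ha.ne (N + 2) (by push_cast; ring)
  have nqb : shiftProd σ (a + 2 * h - b) h k ≠ 0 := hb.shiftProd_ne 2 (by push_cast; ring) k
  have nqc : shiftProd σ (a + 2 * h - c) h k ≠ 0 := hc.shiftProd_ne 2 (by push_cast; ring) k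
  have nqd : shiftProd σ (a + 2 * h - d) h k ≠ 0 := hd.shiftProd_ne 2 (by push_cast; ring) k
  have nqe : shiftProd σ (e - N * h + h) h k ≠ 0 :=
    he.shiftProd_ne (1 - N) (by rw [he']; push_cast; ring) k
  have nqn : shiftProd σ (a + (N + 3) * h) h k ≠ 0 := ha.shiftProd_ne (N + 3) (by push_cast; ring) k
  have e1 := shiftProd_succ_eq_div nak
  have e2 : shiftProd σ (a + (N + 1) * h) h (k + 1) = _ := shiftProd_succ_eq_div naNk
  rw [show a + (N + 1) * h + h = a + (N + 2) * h by ring,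
    show a + (N + 1) * h + 2 * h = a + (N + 3) * h by ring] at e2
  have e3 : shiftProd σ (e - (N + 1) * h) h (k + 1) = _ :=
    shiftProd_succ_eq_div (by
      rwa [show e - (N + 1) * h + (k + 1) * h = e + (k - N) * h by ring])
  rw [show e - (N + 1) * h + (k + 1) * h = e + (k - N) * h by ring,
    show e - (N + 1) * h + h = e - N * h by ring,
    show e - (N + 1) * h + 2 * h = e - N * h + h by ring] at e3
  have e4 : shiftProd σ h h (k + 1) = shiftProd σ h h k * σ ((k + 1) * h) := by
    rw [shiftProd_succ, show h + k * h = (k + 1) * h by ring]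
  have eb := shiftProd_succ' (σ := σ) (a + h - b) h k
  have ec := shiftProd_succ' (σ := σ) (a + h - c) h k
  have ed := shiftProd_succ' (σ := σ) (a + h - d) h k
  rw [show a + h - b + h = a + 2 * h - b by ring] at eb
  rw [show a + h - c + h = a + 2 * h - c by ring] at ec
  rw [show a + h - d + h = a + 2 * h - d by ring] at ed
  have el : shiftProd σ (l - h) h (k + 1) = σ (l - h) * shiftProd σ l h k := by
    rw [shiftProd_succ', sub_add_cancel]
  have en : shiftProd σ (-(N + 1) * h) h (k + 1) = σ (-(N + 1) * h) * shiftProd σ (-N * h) h k := by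
    rw [shiftProd_succ', show -((N : ℂ) + 1) * h + h = -N * h by ring]
  have en' : shiftProd σ (-N * h) h (k + 1) = shiftProd σ (-N * h) h k * σ ((k - N) * h) := by
    rw [shiftProd_succ, show -(N : ℂ) * h + k * h = (k - N) * h by ring]
  have en2 : shiftProd σ (a + (N + 2) * h) h (k + 1) =
      σ (a + (N + 2) * h) * shiftProd σ (a + (N + 3) * h) h k := by
    rw [shiftProd_succ', show a + ((N : ℂ) + 2) * h + h = a + (N + 3) * h by ring]
  obtain ⟨C, hC⟩ : ∃ C, C = σ (a + 2 * (k + 1) * h) * σ (a + h) * σ b * σ c * σ d *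
    (shiftProd σ (a + 2 * h) h k * shiftProd σ (b + h) h k * shiftProd σ (c + h) h k *
      shiftProd σ (d + h) h k * shiftProd σ l h k * shiftProd σ (-N * h) h k) /
    (σ (a + (k + 1) * h) * σ ((k + 1) * h) * shiftProd σ h h k * σ (a + h - b) * σ (a + h - c) *
      σ (a + h - d) * shiftProd σ (a + 2 * h - b) h k * shiftProd σ (a + 2 * h - c) h k *
      shiftProd σ (a + 2 * h - d) h k * σ (e - N * h) * σ (e - (N + 1) * h) *
      shiftProd σ (e - N * h + h) h k * σ (a + (N + 1) * h) * σ (a + (N + 2) * h) *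
      shiftProd σ (a + (N + 3) * h) h k) := ⟨_, rfl⟩
  have t1 : jacksonTerm σ a b c d h (N + 1) (k + 1) =
      C * (σ (l + k * h) * σ (e + (k - N) * h) * (σ (a + (N + 1) * h) * σ (-(N + 1) * h))) := by
    rw [jacksonTerm]
    push_cast
    rw [show 2 * a + ((N : ℂ) + 1 + 1) * h - b - c - d = l by rw [hl]; ring,
      show b + c + d - a - ((N : ℂ) + 1) * h = e - (N + 1) * h by rw [he'],
      show a + ((N : ℂ) + 1 + 1) * h = a + (N + 2) * h by ring, e1, shiftProd_succ' b,
      shiftProd_succ' c, shiftProd_succ' d, shiftProd_succ l, en, e4, eb, ec, ed, e3, en2, hC]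
    refine eq_of_mul_mul_inv_eq (nn1) (na) ?_
    simp only [div_eq_mul_inv, mul_inv, inv_inv]
    ring
  have t0 : jacksonTerm σ a b c d h N (k + 1) =
      C * (σ (a + (N + 1) * h + (k + 1) * h) * σ ((k - N) * h) *
        (σ (l - h) * σ (e - (N + 1) * h))) := by
    rw [jacksonTerm]
    push_cast
    rw [show 2 * a + ((N : ℂ) + 1) * h - b - c - d = l - h by rw [hl]; ring,
      show b + c + d - a - (N : ℂ) * h = e - N * h by rw [he'], e1, shiftProd_succ' b,
      shiftProd_succ' c, shiftProd_succ' d, el, en', e4, eb, ec, ed, shiftProd_succ' (e - N * h),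
      e2, hC]
    refine eq_of_mul_mul_inv_eq (ne1) (na) ?_
    simp only [div_eq_mul_inv, mul_inv, inv_inv]
    ring
  have t2 : jacksonFactor σ a b c d h N *
        jacksonTerm σ (a + 2 * h) (b + h) (c + h) (d + h) h N k =
      C * (σ (a + (k + 1) * h) * σ ((k + 1) * h) * (σ (l + N * h) * σ (a - b - c - d))) := by
    rw [jacksonTerm, jacksonFactor,
      show 2 * (a + 2 * h) + ((N : ℂ) + 1) * h - (b + h) - (c + h) - (d + h) = l by rw [hl]; ring,
      show b + h + (c + h) + (d + h) - (a + 2 * h) - (N : ℂ) * h = e - N * h + h by rw [he']; ring,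
      show 2 * a + (2 * (N : ℂ) + 2) * h - b - c - d = l + N * h by rw [hl]; ring, ← he',
      show a + 2 * h + h - (b + h) = a + 2 * h - b by ring,
      show a + 2 * h + h - (c + h) = a + 2 * h - c by ring,
      show a + 2 * h + h - (d + h) = a + 2 * h - d by ring,
      show a + 2 * h + (N + 1) * h = a + (N + 3) * h by ring,
      show a + 2 * h + 2 * k * h = a + 2 * (k + 1) * h by ring, hC]
    refine eq_of_mul_mul_inv_eq (mul_ne_zero nak hhk) (na2) ?_
    simp only [div_eq_mul_inv, mul_inv]
    ring
  rw [t1, t0, t2]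
  linear_combination C * key

/-- The product side of the Frenkel–Turaev sum. -/
noncomputable def jacksonProd (σ : ℂ → ℂ) (a b c d h : ℂ) (N : ℕ) : ℂ :=
  shiftProd σ (a + h) h N * shiftProd σ (a + h - b - c) h N * shiftProd σ (a + h - b - d) h N *
      shiftProd σ (a + h - c - d) h N /
    (shiftProd σ (a + h - b) h N * shiftProd σ (a + h - c) h N * shiftProd σ (a + h - d) h N *
      shiftProd σ (a + h - b - c - d) h N)

/-- The product side obeys the recursion of the terms. Once the factor `R` common to all three
products is removed, only the values at α = a + (N + 1)h remain, and they are related by the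
three-term relation. -/
lemma jacksonProd_succ (hσ : IsSigmaLike σ) {a b c d h : ℂ} (ha : AvoidsZeros σ a h)
    (hb : AvoidsZeros σ (a - b) h) (hc : AvoidsZeros σ (a - c) h) (hd : AvoidsZeros σ (a - d) h)
    (he : AvoidsZeros σ (b + c + d - a) h) (N : ℕ) :
    jacksonProd σ a b c d h (N + 1) = jacksonProd σ a b c d h N + jacksonFactor σ a b c d h N *
      jacksonProd σ (a + 2 * h) (b + h) (c + h) (d + h) h N := by
  obtain ⟨α, hα⟩ : ∃ α, α = a + (N + 1) * h := ⟨_, rfl⟩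
  have key := hσ.three_term (α - (b + c) / 2) ((b - c) / 2) ((b + c) / 2) (α - (b + c) / 2 - d)
  rw [show α - (b + c) / 2 + (b - c) / 2 = α - c by ring,
    show α - (b + c) / 2 - (b - c) / 2 = α - b by ring,
    show (b + c) / 2 + (α - (b + c) / 2 - d) = α - d by ring,
    show (b + c) / 2 - (α - (b + c) / 2 - d) = -(α - b - c - d) by ring,
    show α - (b + c) / 2 + (α - (b + c) / 2 - d) = 2 * α - b - c - d by ring,
    show α - (b + c) / 2 - (α - (b + c) / 2 - d) = d by ring,
    show (b + c) / 2 + (b - c) / 2 = b by ring, show (b + c) / 2 - (b - c) / 2 = c by ring,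
    show α - (b + c) / 2 + (b + c) / 2 = α by ring,
    show α - (b + c) / 2 - (b + c) / 2 = α - b - c by ring,
    show (b - c) / 2 + (α - (b + c) / 2 - d) = α - c - d by ring,
    show (b - c) / 2 - (α - (b + c) / 2 - d) = -(α - b - d) by ring, hσ.odd, hσ.odd] at key
  have he' : AvoidsZeros σ (a - b - c - d) h := (he.neg hσ).add 0 (by push_cast; ring)
  have na1 : σ (a + h) ≠ 0 := ha.ne 1 (by simp)
  have na2 : σ (a + 2 * h) ≠ 0 := ha.ne 2 (by simp)
  have nb : σ (a + h - b) ≠ 0 := hb.ne 1 (by push_cast; ring)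
  have nc : σ (a + h - c) ≠ 0 := hc.ne 1 (by push_cast; ring)
  have nd : σ (a + h - d) ≠ 0 := hd.ne 1 (by push_cast; ring)
  have nα : σ α ≠ 0 := ha.ne (N + 1) (by rw [hα]; push_cast; ring)
  have nαh : σ (α + h) ≠ 0 := ha.ne (N + 2) (by rw [hα]; push_cast; ring)
  have nαb : σ (α - b) ≠ 0 := hb.ne (N + 1) (by rw [hα]; push_cast; ring)
  have nαc : σ (α - c) ≠ 0 := hc.ne (N + 1) (by rw [hα]; push_cast; ring)
  have nαd : σ (α - d) ≠ 0 := hd.ne (N + 1) (by rw [hα]; push_cast; ring)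
  have nαe : σ (α - b - c - d) ≠ 0 := he'.ne (N + 1) (by rw [hα]; push_cast; ring)
  have nαe' : σ (α - h - b - c - d) ≠ 0 := he'.ne N (by rw [hα]; push_cast; ring)
  have ne0 : σ (a - b - c - d) ≠ 0 := he'.ne 0 (by simp)
  have nqb : shiftProd σ (a + h - b) h N ≠ 0 := hb.shiftProd_ne 1 (by push_cast; ring) N
  have nqc : shiftProd σ (a + h - c) h N ≠ 0 := hc.shiftProd_ne 1 (by push_cast; ring) N
  have nqd : shiftProd σ (a + h - d) h N ≠ 0 := hd.shiftProd_ne 1 (by push_cast; ring) N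
  have nqe : shiftProd σ (a + h - b - c - d) h N ≠ 0 := he'.shiftProd_ne 1 (by push_cast; ring) N
  have shift : ∀ z, σ z ≠ 0 → shiftProd σ (z + h) h N = shiftProd σ z h N * σ (z + N * h) / σ z :=
    fun z hz => by rw [← shiftProd_succ, shiftProd_succ', mul_div_cancel_left₀ _ hz]
  have s1 := shift (a + h) na1
  have s2 := shift (a + h + h) (by rwa [show a + h + h = a + 2 * h by ring])
  have sb := shift _ nb
  have sc := shift _ nc
  have sd := shift _ nd
  have se := shift _ ne0
  rw [show a + h + N * h = α by rw [hα]; ring] at s1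
  rw [show a + h + h + N * h = α + h by rw [hα]; ring, s1,
    show a + h + h = a + 2 * h by ring] at s2
  rw [show a + h - b + N * h = α - b by rw [hα]; ring] at sb
  rw [show a + h - c + N * h = α - c by rw [hα]; ring] at sc
  rw [show a + h - d + N * h = α - d by rw [hα]; ring] at sd
  have se' : shiftProd σ (a - b - c - d) h N =
      shiftProd σ (a + h - b - c - d) h N * σ (a - b - c - d) / σ (α - h - b - c - d) := by
    rw [show a - b - c - d + h = a + h - b - c - d by ring,
      show a - b - c - d + N * h = α - h - b - c - d by rw [hα]; ring] at se
    rw [se]; field_simp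
  simp only [jacksonProd, jacksonFactor, shiftProd_succ]
  rw [show a + h + N * h = α by rw [hα]; ring,
    show a + h - b - c + N * h = α - b - c by rw [hα]; ring,
    show a + h - b - d + N * h = α - b - d by rw [hα]; ring,
    show a + h - c - d + N * h = α - c - d by rw [hα]; ring,
    show a + h - b - c - d + N * h = α - b - c - d by rw [hα]; ring,
    show a + h - b + N * h = α - b by rw [hα]; ring,
    show a + h - c + N * h = α - c by rw [hα]; ring,
    show a + h - d + N * h = α - d by rw [hα]; ring,
    show 2 * a + (2 * (N : ℂ) + 2) * h - b - c - d = 2 * α - b - c - d by rw [hα]; ring,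
    show a + ((N : ℂ) + 2) * h = α + h by rw [hα]; ring, ← hα,
    show b + c + d - a - (N : ℂ) * h = -(α - h - b - c - d) by rw [hα]; ring,
    show b + c + d - a - ((N : ℂ) + 1) * h = -(α - b - c - d) by rw [hα]; ring,
    show a + 2 * h + h - (b + h) - (c + h) = a + h - b - c by ring,
    show a + 2 * h + h - (b + h) - (d + h) = a + h - b - d by ring,
    show a + 2 * h + h - (c + h) - (d + h) = a + h - c - d by ring,
    show a + h - b - c - (d + h) = a - b - c - d by ring,
    show a + 2 * h + h - (b + h) = a + h - b + h by ring,
    show a + 2 * h + h - (c + h) = a + h - c + h by ring,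
    show a + 2 * h + h - (d + h) = a + h - d + h by ring, sb, sc, sd, se', s2, hσ.odd, hσ.odd]
  obtain ⟨R, hR⟩ : ∃ R, R = shiftProd σ (a + h) h N * shiftProd σ (a + h - b - c) h N *
      shiftProd σ (a + h - b - d) h N * shiftProd σ (a + h - c - d) h N /
    (shiftProd σ (a + h - b) h N * shiftProd σ (a + h - c) h N * shiftProd σ (a + h - d) h N *
      shiftProd σ (a + h - b - c - d) h N) := ⟨_, rfl⟩
  trans R * (σ α * σ (α - b - c) * σ (α - b - d) * σ (α - c - d) /
    (σ (α - b) * σ (α - c) * σ (α - d) * σ (α - b - c - d)))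
  · rw [hR]
    simp only [div_eq_mul_inv, mul_inv]
    ring
  trans R + R * (σ b * σ c * σ d * σ (2 * α - b - c - d) /
    (σ (α - b) * σ (α - c) * σ (α - d) * σ (α - b - c - d)))
  · rw [← mul_one_add, one_add_div (by simp [nαb, nαc, nαd, nαe])]
    congr 2
    linear_combination key
  · rw [← hR]
    congr 1
    rw [hR]
    refine eq_of_mul_mul_inv_eq (mul_ne_zero (mul_ne_zero (mul_ne_zero na1 na2)
      (mul_ne_zero nα nαh)) (mul_ne_zero (mul_ne_zero nb nc) (mul_ne_zero (mul_ne_zero nd nαe')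
      ne0))) one_ne_zero ?_
    simp only [div_eq_mul_inv, mul_inv, inv_inv, neg_mul_neg]
    ring

/-- The Frenkel–Turaev sum. -/
theorem sum_jacksonTerm (hσ : IsSigmaLike σ) {h : ℂ}
    (hh : ∀ j : ℤ, j ≠ 0 → σ (j * h) ≠ 0) (N : ℕ) : ∀ {a b c d : ℂ}, AvoidsZeros σ a h →
    AvoidsZeros σ (a - b) h → AvoidsZeros σ (a - c) h → AvoidsZeros σ (a - d) h →
    AvoidsZeros σ (b + c + d - a) h →
    ∑ k ∈ Finset.range (N + 1), jacksonTerm σ a b c d h N k = jacksonProd σ a b c d h N := by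
  induction N with
  | zero =>
    intro a b c d ha _ _ _ _
    have : σ a ≠ 0 := ha.ne 0 (by simp)
    simp [jacksonTerm, jacksonProd, this]
  | succ N ih =>
    intro a b c d ha hb hc hd he
    -- The N-term of index N + 1 contains σ(0), so the sum for N may be extended to the range of the
    -- sum for N + 1.
    have h0 : jacksonTerm σ a b c d h N (N + 1) = 0 := by
      rw [jacksonTerm, shiftProd_succ (-N * h)]
      simp [hσ.map_zero]
    have hz : ∀ M, jacksonTerm σ a b c d h M 0 = 1 := fun M => by
      simp [jacksonTerm, ha.ne 0 (show a = _ by simp)]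
    rw [jacksonProd_succ hσ ha hb hc hd he, ← ih ha hb hc hd he,
      ← ih (ha.add 2 (by simp)) (hb.add 1 (by push_cast; ring)) (hc.add 1 (by push_cast; ring))
        (hd.add 1 (by push_cast; ring)) (he.add 1 (by push_cast; ring)),
      Finset.sum_range_succ', hz (N + 1), ← hz N, Finset.mul_sum,
      ← add_zero (∑ k ∈ Finset.range (N + 1), jacksonTerm σ a b c d h N k), ← h0,
      ← Finset.sum_range_succ, Finset.sum_range_succ' _ (N + 1), add_right_comm,
      ← Finset.sum_add_distrib]
    congr 1
    refine Finset.sum_congr rfl fun k _ => ?_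
    rw [← jacksonTerm_succ_sub hσ hh ha hb hc hd he]
    ring

end Jackson

/-! ### Elliptic partial fractions. -/

section PartialFractions

variable {σ : ℂ → ℂ}

/-- The product `σ(x + y) σ(x - y)`. -/
def sigmaPair (σ : ℂ → ℂ) (x y : ℂ) : ℂ := σ (x + y) * σ (x - y)

lemma IsSigmaLike.sigmaPair_swap (hσ : IsSigmaLike σ) (x y : ℂ) :
    sigmaPair σ y x = -sigmaPair σ x y := by
  rw [sigmaPair, sigmaPair, show y - x = -(x - y) by ring, hσ.odd, add_comm]; ring

/-- The elliptic partial fraction expansion. -/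
theorem prod_sigmaPair_div_prod (hσ : IsSigmaLike σ) (x b : ℕ → ℂ) (k : ℕ)
    (hx : ∀ i ≤ k, ∀ j ≤ k, i ≠ j → sigmaPair σ (x i) (x j) ≠ 0) : ∀ y,
    (∀ i ≤ k, sigmaPair σ y (x i) ≠ 0) →
    (∏ j ∈ Finset.range k, sigmaPair σ y (b j)) / ∏ s ∈ Finset.range (k + 1), sigmaPair σ y (x s) =
      ∑ r ∈ Finset.range (k + 1), (∏ j ∈ Finset.range k, sigmaPair σ (x r) (b j)) /
        (∏ s ∈ (Finset.range (k + 1)).erase r, sigmaPair σ (x r) (x s)) / sigmaPair σ y (x r) := by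
  induction k with
  | zero => simp
  | succ k ih =>
    intro y hy
    have ih' := ih fun i hi j hj => hx i (by omega) j (by omega)
    -- Adjoining one zero b_k and one pole x_{k+1} to a simple fraction at x_r splits it into simple
    -- fractions at x_r and x_{k+1}; this is the three-term relation.
    have step : ∀ r ≤ k, ∀ c : ℂ, c / sigmaPair σ y (x r) * (sigmaPair σ y (b k) /
        sigmaPair σ y (x (k + 1))) = c * sigmaPair σ (x r) (b k) / sigmaPair σ (x r) (x (k + 1)) /
          sigmaPair σ y (x r) + c / sigmaPair σ (x (k + 1)) (x r) *
            (sigmaPair σ (x (k + 1)) (b k) / sigmaPair σ y (x (k + 1))) := by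
      intro r hr c
      have h1 := hy r (by omega)
      have h2 := hy (k + 1) le_rfl
      have h3 := hx r (by omega) (k + 1) le_rfl (by omega)
      have h4 : sigmaPair σ y (b k) * sigmaPair σ (x r) (x (k + 1)) =
          sigmaPair σ (x r) (b k) * sigmaPair σ y (x (k + 1)) -
            sigmaPair σ (x (k + 1)) (b k) * sigmaPair σ y (x r) := by
        have : sigmaPair σ y (b k) * sigmaPair σ (x r) (x (k + 1)) = _ :=
          hσ.three_term y (b k) (x r) (x (k + 1))
        rw [this, hσ.sigmaPair_swap (b k) (x (k + 1))]
        simp only [sigmaPair]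
        ring
      rw [hσ.sigmaPair_swap (x r) (x (k + 1))]
      field_simp
      linear_combination c * h4
    -- The contributions at the new pole x_{k+1} add up to the induction hypothesis evaluated at y =
    -- x_{k+1}, which is the required coefficient.
    rw [Finset.prod_range_succ, Finset.prod_range_succ _ (k + 1), mul_div_mul_comm,
      ih' y fun i hi => hy i (by omega), Finset.sum_mul, Finset.sum_range_succ _ (k + 1),
      Finset.sum_congr rfl fun r hr => step r (by have := Finset.mem_range.1 hr; omega) _,
      Finset.sum_add_distrib, ← Finset.sum_mul,
      ← ih' (x (k + 1)) fun i hi => hx (k + 1) le_rfl i (by omega) (by omega)]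
    congr 1
    · refine Finset.sum_congr rfl fun r hr => ?_
      have hr' := Finset.mem_range.1 hr
      rw [Finset.prod_range_succ _ k, Finset.range_add_one (n := k + 1),
        Finset.erase_insert_of_ne (by omega), Finset.prod_insert (by simp)]
      ring
    · rw [Finset.prod_range_succ (fun j => sigmaPair σ (x (k + 1)) (b j)) k,
        Finset.range_add_one (n := k + 1), Finset.erase_insert (by simp)]
      ring

/-- The expansion at y = x_{k+1}, with the left side moved over: an analogue of the vanishing sum of
residues, valid when there are two more nodes than zeros. -/
theorem sum_prod_sigmaPair_div_prod (hσ : IsSigmaLike σ) (x b : ℕ → ℂ) (k : ℕ)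
    (hx : ∀ i ≤ k + 1, ∀ j ≤ k + 1, i ≠ j → sigmaPair σ (x i) (x j) ≠ 0) :
    ∑ r ∈ Finset.range (k + 2), (∏ j ∈ Finset.range k, sigmaPair σ (x r) (b j)) /
        (∏ s ∈ (Finset.range (k + 2)).erase r, sigmaPair σ (x r) (x s)) = 0 := by
  have := prod_sigmaPair_div_prod hσ x b k (fun i hi j hj => hx i (by omega) j (by omega))
    (x (k + 1)) fun i hi => hx _ le_rfl i (by omega) (by omega)
  rw [Finset.sum_range_succ, Finset.range_add_one (n := k + 1), Finset.erase_insert (by simp),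
    this, ← Finset.sum_add_distrib]
  refine Finset.sum_eq_zero fun r hr => ?_
  have hr' := Finset.mem_range.1 hr
  rw [Finset.erase_insert_of_ne (by omega), Finset.prod_insert (by simp),
    hσ.sigmaPair_swap (x r) (x (k + 1)), div_neg, div_div, mul_comm (sigmaPair σ _ _)]
  ring

end PartialFractions

/-! ### Closed-form factors under reflection, and the interpolation nodes. -/

section QuadraticSum

variable {σ : ℂ → ℂ}

noncomputable def quadRatio (σ : ℂ → ℂ) (z h : ℂ) (m : ℕ) : ℂ :=
  shiftProd σ (z + (1 - m) * h) (2 * h) m / shiftProd σ (z + h) h m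

/-- The step factor is inverted by m ↦ -3 - m. Hence the recurrence is compatible with the
reflection m ↦ -1 - m, which exchanges the steps m → m + 2 and -3 - m → -1 - m. -/
lemma quadRatio_add_two {z h : ℂ} (hz : AvoidsZeros σ z h) (m : ℕ) :
    quadRatio σ z h (m + 2) =
      quadRatio σ z h m * (σ (z - (m + 1) * h) / σ (z + (m + 2) * h)) := by
  have h1 : σ (z + (m + 1) * h) ≠ 0 := hz.ne (m + 1) (by push_cast; ring)
  rw [quadRatio, quadRatio, shiftProd_succ', shiftProd_succ, shiftProd_succ (z + h),
    shiftProd_succ (z + h)]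
  push_cast
  rw [show z + (1 - ((m : ℂ) + 2)) * h + 2 * h + m * (2 * h) = z + (m + 1) * h by ring,
    show z + (1 - ((m : ℂ) + 2)) * h + 2 * h = z + (1 - m) * h by ring,
    show z + (1 - ((m : ℂ) + 2)) * h = z - (m + 1) * h by ring,
    show z + h + m * h = z + (m + 1) * h by ring,
    show z + h + ((m : ℂ) + 1) * h = z + (m + 2) * h by ring]
  refine eq_of_mul_mul_inv_eq one_ne_zero h1 ?_
  simp only [div_eq_mul_inv, mul_inv]
  ring

/-- The sequence `K, K - 2, K - 4, …`, with a negative `m` replaced by `-1 - m`. -/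
def zigzag (K i : ℕ) : ℕ := if 2 * i ≤ K then K - 2 * i else 2 * i - K - 1

/-- The values of the parity of K come first, in decreasing order; after the reflection the other
parity follows in increasing order. -/
lemma sum_zigzag (K : ℕ) (f : ℕ → ℂ) :
    ∑ i ∈ Finset.range (K + 1), f (zigzag K i) = ∑ m ∈ Finset.range (K + 1), f m := by
  refine Finset.sum_nbij' (zigzag K)
    (fun m => if (K - m) % 2 = 0 then (K - m) / 2 else (m + K + 1) / 2) ?_ ?_ ?_ ?_
    fun _ _ => rfl
  all_goals
    intro i hi
    have := Finset.mem_range.1 hi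
    simp only [zigzag, Finset.mem_range]
    split_ifs <;> omega

/-- Along K, K - 2, K - 4, … the recurrence is a product in steps of 2h. By the reflection symmetry
the same formula persists past zero, so that one hypergeometric term covers both parities of m. -/
lemma quadRatio_zigzag {z h : ℂ} (hz : AvoidsZeros σ z h) (K : ℕ) (i : ℕ) :
    quadRatio σ z h (zigzag K i) = quadRatio σ z h K *
      (shiftProd σ (z + K * h) (-(2 * h)) i / shiftProd σ (z + (1 - K) * h) (2 * h) i) := by
  induction i with
  | zero => simp [zigzag]
  | succ i ih =>
    rw [shiftProd_succ, shiftProd_succ, mul_div_mul_comm, ← mul_assoc, ← ih,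
      show z + K * h + i * (-(2 * h)) = z + (K - 2 * i) * h by ring,
      show z + (1 - K) * h + i * (2 * h) = z + (1 - K + 2 * i) * h by ring]
    have n0 : σ z ≠ 0 := hz.ne 0 (by simp)
    have n1 : σ (z + h) ≠ 0 := hz.ne 1 (by simp)
    have q0 : quadRatio σ z h 0 = 1 := by simp [quadRatio]
    have q1 : quadRatio σ z h 1 = σ z / σ (z + h) := by simp [quadRatio, shiftProd]
    -- Before the reflection the recurrence is used downwards, after it upwards. At the turn the
    -- sequence passes from 0 to 1 (K even) or from 1 to 0 (K odd), and the initial values decide.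
    rcases le_or_gt (2 * i + 2) K with hK | hK
    · obtain ⟨m, rfl⟩ := Nat.exists_eq_add_of_le hK
      have e1 : zigzag (2 * i + 2 + m) i = m + 2 := by simp only [zigzag]; split_ifs <;> omega
      have e2 : zigzag (2 * i + 2 + m) (i + 1) = m := by simp only [zigzag]; split_ifs <;> omega
      rw [e1, e2, quadRatio_add_two hz]
      push_cast
      rw [show z + (2 * (i : ℂ) + 2 + m - 2 * i) * h = z + (m + 2) * h by ring,
        show z + (1 - (2 * (i : ℂ) + 2 + m) + 2 * i) * h = z - (m + 1) * h by ring]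
      have h1 : σ (z + (m + 2) * h) ≠ 0 := hz.ne (m + 2) (by push_cast; ring)
      have h2 : σ (z - (m + 1) * h) ≠ 0 := hz.ne (-(m + 1)) (by push_cast; ring)
      rw [mul_assoc, div_mul_div_comm, mul_comm (σ (z - _)), div_self (mul_ne_zero h1 h2), mul_one]
    · rcases lt_or_ge K (2 * i) with hK' | hK'
      · obtain ⟨m, hm⟩ := Nat.exists_eq_add_of_lt hK'
        have e1 : zigzag K i = m := by simp only [zigzag]; split_ifs <;> omega
        have e2 : zigzag K (i + 1) = m + 2 := by simp only [zigzag]; split_ifs <;> omega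
        have hm' : (2 * i : ℂ) = K + m + 1 := by exact_mod_cast hm
        rw [e1, e2, quadRatio_add_two hz, hm',
          show z + ((K : ℂ) - (K + m + 1)) * h = z - (m + 1) * h by ring,
          show z + (1 - (K : ℂ) + (K + m + 1)) * h = z + (m + 2) * h by ring]
      · obtain rfl | rfl : K = 2 * i ∨ K = 2 * i + 1 := by omega
        · have e1 : zigzag (2 * i) i = 0 := by simp [zigzag]
          have e2 : zigzag (2 * i) (i + 1) = 1 := by simp only [zigzag]; split_ifs <;> omega
          rw [e1, e2, q0, q1]
          push_cast
          rw [show z + (2 * (i : ℂ) - 2 * i) * h = z by ring,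
            show z + (1 - 2 * (i : ℂ) + 2 * i) * h = z + h by ring, one_mul]
        · have e1 : zigzag (2 * i + 1) i = 1 := by simp only [zigzag]; split_ifs <;> omega
          have e2 : zigzag (2 * i + 1) (i + 1) = 0 := by simp only [zigzag]; split_ifs <;> omega
          rw [e1, e2, q0, q1]
          push_cast
          rw [show z + (2 * (i : ℂ) + 1 - 2 * i) * h = z + h by ring,
            show z + (1 - (2 * (i : ℂ) + 1) + 2 * i) * h = z by ring]
          field_simp

/-- The interpolation nodes `(m + 1/2) h`. -/
noncomputable def halfNode (h : ℂ) (m : ℕ) : ℂ := (m + 1 / 2) * h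

lemma sigmaPair_halfNode (h : ℂ) (m s : ℕ) :
    sigmaPair σ (halfNode h m) (halfNode h s) = σ ((m + s + 1) * h) * σ ((m - s) * h) := by
  rw [sigmaPair, halfNode, halfNode]
  congr 2 <;> ring

lemma sigmaPair_halfNode_ne_zero {h : ℂ} (hh : ∀ j : ℤ, j ≠ 0 → σ (j * h) ≠ 0) {m s : ℕ}
    (hms : m ≠ s) : sigmaPair σ (halfNode h m) (halfNode h s) ≠ 0 := by
  rw [sigmaPair_halfNode]
  have h1 := hh (m + s + 1) (by positivity)
  have h2 := hh (m - s) (by omega)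
  push_cast at h1 h2
  exact mul_ne_zero h1 h2

/-- The factors σ((m + s + 1)h) run through consecutive multiples of h with one gap at s = m; the
factor σ((2m + 1)h) on the left fills that gap. -/
lemma prod_erase_sigmaPair_halfNode (hσ : IsSigmaLike σ) (h : ℂ) (m d : ℕ) :
    (∏ s ∈ (Finset.range (m + d + 1)).erase m, sigmaPair σ (halfNode h m) (halfNode h s)) *
      σ ((2 * m + 1) * h) = (-1) ^ d * shiftProd σ h h d * shiftProd σ h h (2 * m + d + 1) := by
  induction d with
  | zero =>
    rw [add_zero, Finset.range_add_one, Finset.erase_insert (by simp)]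
    simp only [sigmaPair_halfNode]
    rw [Finset.prod_mul_distrib, show 2 * m + 0 + 1 = m + m + 1 by ring, shiftProd_succ,
      shiftProd_add, shiftProd_rev h h m]
    have e1 : ∏ s ∈ Finset.range m, σ (((m : ℂ) + s + 1) * h) = shiftProd σ (h + m * h) h m :=
      Finset.prod_congr rfl fun s _ => by congr 1; ring
    have e2 : ∏ s ∈ Finset.range m, σ (((m : ℂ) - s) * h) =
        shiftProd σ (h + (m - 1) * h) (-h) m :=
      Finset.prod_congr rfl fun s _ => by congr 1; ring
    rw [e1, e2, show h + ((m + m : ℕ) : ℂ) * h = (2 * m + 1) * h by push_cast; ring, pow_zero,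
      shiftProd_zero]
    ring
  | succ d ih =>
    rw [show m + (d + 1) + 1 = m + d + 1 + 1 by ring, Finset.range_add_one,
      Finset.erase_insert_of_ne (by omega), Finset.prod_insert (by simp), mul_assoc, ih,
      sigmaPair_halfNode, ← add_assoc (2 * m) d 1, shiftProd_succ _ _ (2 * m + d + 1),
      shiftProd_succ _ _ d]
    push_cast
    rw [show ((m : ℂ) - (m + d + 1)) * h = -((d + 1) * h) by ring, hσ.odd,
      show h + (d : ℂ) * h = (d + 1) * h by ring,
      show h + (2 * (m : ℂ) + d + 1) * h = (m + (m + d + 1) + 1) * h by ring]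
    ring

/-- The points `A + (2 j + 3/2) h`. -/
noncomputable def poleNode (A h : ℂ) (j : ℕ) : ℂ := A + (2 * j + 3 / 2) * h

lemma sigmaPair_halfNode_poleNode (hσ : IsSigmaLike σ) (A h : ℂ) (m j : ℕ) :
    sigmaPair σ (halfNode h m) (poleNode A h j) =
      -(σ (A + (m + 2) * h + j * (2 * h)) * σ (A + (1 - m) * h + j * (2 * h))) := by
  rw [sigmaPair, halfNode, poleNode, ← mul_neg, ← hσ.odd]
  congr 2 <;> ring

lemma prod_sigmaPair_halfNode_poleNode (hσ : IsSigmaLike σ) (A h : ℂ) (m k : ℕ) :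
    ∏ j ∈ Finset.range k, sigmaPair σ (halfNode h m) (poleNode A h j) =
      (-1) ^ k * (shiftProd σ (A + (m + 2) * h) (2 * h) k *
        shiftProd σ (A + (1 - m) * h) (2 * h) k) := by
  rw [shiftProd, shiftProd, ← Finset.prod_mul_distrib, ← Finset.card_range k, ← Finset.prod_const,
    Finset.card_range, ← Finset.prod_mul_distrib]
  refine Finset.prod_congr rfl fun j _ => ?_
  rw [sigmaPair_halfNode_poleNode hσ]; ring

lemma prod_sigmaPair_halfNode_halfNode (hσ : IsSigmaLike σ) (h : ℂ) (m k : ℕ) :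
    ∏ j ∈ Finset.range k, sigmaPair σ (halfNode h m) (halfNode h j) =
      (-1) ^ k * (shiftProd σ ((m + 1) * h) h k * shiftProd σ (-m * h) h k) := by
  rw [shiftProd, shiftProd, ← Finset.prod_mul_distrib, ← Finset.card_range k, ← Finset.prod_const,
    Finset.card_range, ← Finset.prod_mul_distrib]
  refine Finset.prod_congr rfl fun j _ => ?_
  rw [sigmaPair_halfNode, show ((m : ℂ) - j) * h = -(-m * h + j * h) by ring, hσ.odd,
    show (m + j + 1) * h = (m + 1) * h + j * h by ring]
  ring

end QuadraticSum

/-! ### The quadratic summation by inversion. -/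

section QuadraticSum

variable {σ : ℂ → ℂ}

/-- The closed form of the quadratic summation. -/
noncomputable def quadProd (σ : ℂ → ℂ) (A B C D h : ℂ) (m : ℕ) : ℂ :=
  quadRatio σ (A - B) h m * quadRatio σ (A - C) h m * quadRatio σ (A - D) h m / quadRatio σ A h m

/-- The factor `(b,c,d;q²)_k / (aq/b,aq/c,aq/d;q)_k` in additive notation. -/
noncomputable def quadFactor (σ : ℂ → ℂ) (A B C D h : ℂ) (k : ℕ) : ℂ :=
  shiftProd σ B (2 * h) k * shiftProd σ C (2 * h) k * shiftProd σ D (2 * h) k /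
    (shiftProd σ (A + h - B) h k * shiftProd σ (A + h - C) h k * shiftProd σ (A + h - D) h k)

noncomputable def quadCoeff (σ : ℂ → ℂ) (A h : ℂ) (k : ℕ) : ℂ :=
  σ (A + 3 * k * h) / σ A * (shiftProd σ A h k / shiftProd σ (2 * h) (2 * h) k)

/-- As a function of n this is a product over j < k of `sigmaPair` at `halfNode h n`, with zeros at
`halfNode h j` and poles at `poleNode A h j`. Hence it vanishes for n < k, and partial fractions
apply to it. -/
noncomputable def quadKernel (σ : ℂ → ℂ) (A h : ℂ) (n k : ℕ) : ℂ :=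
  shiftProd σ ((n + 1) * h) h k * shiftProd σ (-n * h) h k /
    (shiftProd σ (A + (1 - n) * h) (2 * h) k * shiftProd σ (A + (n + 2) * h) (2 * h) k)

/-- The weights that invert `quadKernel`. -/
noncomputable def quadWeight (σ : ℂ → ℂ) (A h : ℂ) (L m : ℕ) : ℂ :=
  (∏ j ∈ Finset.range L, sigmaPair σ (halfNode h m) (poleNode A h j)) /
    ∏ s ∈ (Finset.range (L + 2)).erase m, sigmaPair σ (halfNode h m) (halfNode h s)

lemma int_mul_ne_zero_two {h : ℂ} (hh : ∀ j : ℤ, j ≠ 0 → σ (j * h) ≠ 0) :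
    ∀ j : ℤ, j ≠ 0 → σ (j * (2 * h)) ≠ 0 := fun j hj => by
  have := hh (2 * j) (by simpa using hj)
  rwa [show (j : ℂ) * (2 * h) = (2 * j : ℤ) * h by push_cast; ring]

lemma avoidsZeros_odd {h w : ℂ} (hh : ∀ j : ℤ, j ≠ 0 → σ (j * h) ≠ 0) (i : ℤ)
    (hw : w = (2 * i + 1) * h) : AvoidsZeros σ w (2 * h) := fun j => by
  have := hh (2 * (i + j) + 1) (by omega)
  rwa [hw, show (2 * (i : ℂ) + 1) * h + j * (2 * h) = (2 * (i + j) + 1 : ℤ) * h by push_cast; ring]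

lemma quadWeight_eq (hσ : IsSigmaLike σ) {A h : ℂ} (hh : ∀ j : ℤ, j ≠ 0 → σ (j * h) ≠ 0)
    {L m d : ℕ} (hd : m + d = L + 1) :
    quadWeight σ A h L m = (-1) ^ L * (shiftProd σ (A + (m + 2) * h) (2 * h) L *
      shiftProd σ (A + (1 - m) * h) (2 * h) L) * ((-1) ^ d * σ ((2 * m + 1) * h)) /
        (shiftProd σ h h d * shiftProd σ h h (2 * m + d + 1)) := by
  have h1 := hh (2 * m + 1) (by positivity)
  push_cast at h1
  have key := prod_erase_sigmaPair_halfNode hσ h m d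
  rw [quadWeight, show L + 2 = m + d + 1 by omega, eq_div_of_mul_eq h1 key,
    prod_sigmaPair_halfNode_poleNode hσ]
  rcases neg_one_pow_eq_or ℂ d with hs | hs <;> rw [hs] <;>
    simp only [div_eq_mul_inv, mul_inv, inv_inv, inv_neg, inv_one] <;> ring

/-- One formula serves both branches: under m ↦ -1 - m the two shifted factorials in each product
trade places, and the sign (-1)^d is absorbed by oddness of σ. -/
lemma quadWeight_zigzag (hσ : IsSigmaLike σ) {A h : ℂ} (hh : ∀ j : ℤ, j ≠ 0 → σ (j * h) ≠ 0)
    {L i t : ℕ} (hd : i + t = L + 1) :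
    quadWeight σ A h L (zigzag (L + 1) i) = (-1) ^ L *
      (shiftProd σ (A + (t - i + 2) * h) (2 * h) L *
        shiftProd σ (A + (1 - t + i) * h) (2 * h) L) * σ ((2 * t - 2 * i + 1) * h) /
        (shiftProd σ h h (2 * i) * shiftProd σ h h (2 * t + 1)) := by
  rcases le_or_gt i t with hit | hit
  · obtain ⟨m, rfl⟩ := Nat.exists_eq_add_of_le hit
    have e : zigzag (L + 1) i = m := by simp only [zigzag]; split_ifs <;> omega
    rw [e, quadWeight_eq hσ hh (show m + 2 * i = L + 1 by omega), pow_mul,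
      show 2 * m + 2 * i + 1 = 2 * (i + m) + 1 by ring]
    push_cast
    rw [show (i : ℂ) + m - i + 2 = m + 2 by ring, show 1 - ((i : ℂ) + m) + i = 1 - m by ring,
      show 2 * ((i : ℂ) + m) - 2 * i + 1 = 2 * m + 1 by ring]
    simp
  · obtain ⟨m, rfl⟩ := Nat.exists_eq_add_of_lt hit
    have e : zigzag (L + 1) (t + m + 1) = m := by simp only [zigzag]; split_ifs <;> omega
    rw [e, quadWeight_eq hσ hh (show m + (2 * t + 1) = L + 1 by omega), pow_succ, pow_mul,
      show 2 * m + (2 * t + 1) + 1 = 2 * (t + m + 1) by ring]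
    push_cast
    rw [show (t : ℂ) - (t + m + 1) + 2 = 1 - m by ring,
      show 1 - (t : ℂ) + (t + m + 1) = m + 2 by ring,
      show (2 * (t : ℂ) - 2 * (t + m + 1) + 1) * h = -((2 * m + 1) * h) by ring, hσ.odd]
    simp
    ring

/-- In the reordered index the weighted closed forms are, up to the value at i = 0, the terms of a
Frenkel–Turaev sum of step 2h. The condition `hBCD` makes its fifth parameter A + Lh, which is what
the weights supply. -/
lemma quadWeight_mul_quadProd_zigzag (hσ : IsSigmaLike σ) {A B C D h : ℂ}
    (hh : ∀ j : ℤ, j ≠ 0 → σ (j * h) ≠ 0) (hA : AvoidsZeros σ A h)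
    (hB : AvoidsZeros σ (A - B) h) (hC : AvoidsZeros σ (A - C) h) (hD : AvoidsZeros σ (A - D) h)
    (hBCD : B + C + D = 2 * A + h) {L i : ℕ} (hi : i ≤ L + 1) :
    quadWeight σ A h L (zigzag (L + 1) i) * quadProd σ A B C D h (zigzag (L + 1) i) =
      quadWeight σ A h L (L + 1) * quadProd σ A B C D h (L + 1) *
        jacksonTerm σ (-(2 * L + 3) * h) (B - A - (L + 1) * h) (C - A - (L + 1) * h)
          (D - A - (L + 1) * h) (2 * h) (L + 1) i := by
  obtain ⟨t, ht⟩ := Nat.exists_eq_add_of_le hi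
  have ht' : (t : ℂ) = L + 1 - i := by
    rw [eq_sub_iff_add_eq, add_comm]; exact_mod_cast ht.symm
  have hK := quadWeight_eq hσ (A := A) hh (show L + 1 + 0 = L + 1 from rfl)
  rw [quadWeight_zigzag hσ hh ht.symm, hK, quadProd, quadProd, quadRatio_zigzag hA,
    quadRatio_zigzag hB, quadRatio_zigzag hC, quadRatio_zigzag hD, jacksonTerm]
  obtain ⟨u0, hu0⟩ : ∃ u, u = shiftProd σ (A + (L + 1 : ℕ) * h) (-(2 * h)) i := ⟨_, rfl⟩
  obtain ⟨v0, hv0⟩ : ∃ v, v = shiftProd σ (A + (1 - (L + 1 : ℕ)) * h) (2 * h) i := ⟨_, rfl⟩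
  have nv0 : v0 ≠ 0 := hv0 ▸ hA.shiftProd_two_ne (-L) (by push_cast; ring) i
  have hu0' : u0 = shiftProd σ (A + (L - 2 * i + 3) * h) (2 * h) i := by
    rw [hu0, shiftProd_rev, neg_neg]; congr 1; push_cast; ring
  have nu0 : u0 ≠ 0 := hu0' ▸ hA.shiftProd_two_ne (L - 2 * i + 3) (by push_cast; ring) i
  obtain ⟨p3, hp3⟩ : ∃ p, p = shiftProd σ (A + L * h) (2 * h) i := ⟨_, rfl⟩
  obtain ⟨p5, hp5⟩ : ∃ p, p = shiftProd σ (A + (3 * L + 3 - 2 * i) * h) (2 * h) i := ⟨_, rfl⟩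
  have np5 : p5 ≠ 0 := hp5 ▸ hA.shiftProd_two_ne (3 * L + 3 - 2 * i) (by push_cast; ring) i
  -- `r1` and `r2` cut a product of L + i factors in two ways. `r3` removes the last 2i factors and
  -- reverses them.
  have r1 : shiftProd σ (A + (1 - t + i) * h) (2 * h) L =
      shiftProd σ (A + (1 - (L + 1 : ℕ)) * h) (2 * h) L * p3 / v0 := by
    rw [eq_div_iff nv0, hv0, hp3, mul_comm]
    have e1 := shiftProd_add (σ := σ) (A + (1 - (L + 1 : ℕ)) * h) (2 * h) i L
    have e2 := shiftProd_add (σ := σ) (A + (1 - (L + 1 : ℕ)) * h) (2 * h) L i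
    rw [add_comm L i, e1, show A + (1 - (L + 1 : ℕ)) * h + i * (2 * h) = A + (1 - t + i) * h by
        rw [ht']; push_cast; ring,
      show A + (1 - (L + 1 : ℕ)) * h + L * (2 * h) = A + L * h by push_cast; ring] at e2
    exact e2
  have r2 : shiftProd σ (A + (t - i + 2) * h) (2 * h) L =
      shiftProd σ (A + ((L + 1 : ℕ) + 2) * h) (2 * h) L * u0 / p5 := by
    rw [eq_div_iff np5, hu0', hp5]
    have e1 := shiftProd_add (σ := σ) (A + (L - 2 * i + 3) * h) (2 * h) i L
    have e2 := shiftProd_add (σ := σ) (A + (L - 2 * i + 3) * h) (2 * h) L i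
    rw [add_comm L i, e1, show A + (L - 2 * i + 3) * h + i * (2 * h) = A + ((L + 1 : ℕ) + 2) * h by
        push_cast; ring,
      show A + (L - 2 * i + 3) * h + L * (2 * h) = A + (3 * L + 3 - 2 * i) * h by ring] at e2
    rw [show A + (t - i + 2) * h = A + (L - 2 * i + 3) * h by rw [ht']; ring, ← e2]
    ring
  have r3 : shiftProd σ h h (2 * (L + 1) + 0 + 1) = shiftProd σ h h (2 * t + 1) *
      (shiftProd σ (-(2 * L + 3) * h) (2 * h) i *
        shiftProd σ (-(L + 1 : ℕ) * (2 * h)) (2 * h) i) := by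
    rw [show 2 * (L + 1) + 0 + 1 = 2 * t + 1 + 2 * i by omega, shiftProd_add,
      hσ.shiftProd_reflect (h + _), pow_mul,
      show -(h + ((2 * t + 1 : ℕ) : ℂ) * h) - (((2 * i : ℕ) : ℂ) - 1) * h = -(2 * L + 3) * h by
        push_cast; rw [ht']; ring, shiftProd_two_mul,
      show -(2 * (L : ℂ) + 3) * h + h = -(L + 1 : ℕ) * (2 * h) by push_cast; ring]
    simp
  have r4 := shiftProd_two_mul (σ := σ) h h i
  rw [show h + h = 2 * h by ring] at r4
  have r5 : shiftProd σ (B - A - (L + 1) * h + (C - A - (L + 1) * h) + (D - A - (L + 1) * h) -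
      -(2 * L + 3) * h - (L + 1 : ℕ) * (2 * h)) (2 * h) i = (-1) ^ i * p5 := by
    rw [hσ.shiftProd_reflect, hp5]
    congr 2
    push_cast
    linear_combination -hBCD
  have ru : ∀ z, shiftProd σ (z - A - (L + 1) * h) (2 * h) i =
      (-1) ^ i * shiftProd σ (A - z + (L + 1 : ℕ) * h) (-(2 * h)) i := fun z => by
    rw [← hσ.shiftProd_neg, neg_neg]; congr 1; push_cast; ring
  have rv : ∀ z, shiftProd σ (-(2 * L + 3) * h + 2 * h - (z - A - (L + 1) * h)) (2 * h) i =
      shiftProd σ (A - z + (1 - (L + 1 : ℕ)) * h) (2 * h) i := fun z => by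
    congr 1; push_cast; ring
  have na : AvoidsZeros σ (-(2 * L + 3) * h) (2 * h) :=
    avoidsZeros_odd hh (-(L + 2)) (by push_cast; ring)
  have n1 : shiftProd σ (-(2 * L + 3) * h) (2 * h) i ≠ 0 := na.shiftProd_ne 0 (by simp) i
  have n2 : shiftProd σ (-(L + 1 : ℕ) * (2 * h)) (2 * h) i ≠ 0 :=
    Finset.prod_ne_zero_iff.2 fun j hj => by
      have hj' := Finset.mem_range.1 hj
      have := int_mul_ne_zero_two hh (j - (L + 1 : ℕ)) (by omega)
      rwa [show -((L + 1 : ℕ) : ℂ) * (2 * h) + j * (2 * h) = ((j - (L + 1 : ℕ) : ℤ) : ℂ) * (2 * h) by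
        push_cast; ring]
  have n3 : σ ((2 * L + 3) * h) ≠ 0 := by
    have := hh (2 * L + 3) (by positivity)
    push_cast at this; exact this
  rw [r1, r2, r3, r4, r5, ru, ru, ru, rv, rv, rv, ← hu0, ← hv0,
    show 2 * (-(2 * (L : ℂ) + 3) * h) + (((L + 1 : ℕ) : ℂ) + 1) * (2 * h) - (B - A - (L + 1) * h) -
      (C - A - (L + 1) * h) - (D - A - (L + 1) * h) = A + L * h by
        push_cast; linear_combination -hBCD,
    ← hp3, show -(2 * (L : ℂ) + 3) * h + (((L + 1 : ℕ) : ℂ) + 1) * (2 * h) = h by push_cast; ring,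
    show -(2 * (L : ℂ) + 3) * h + 2 * i * (2 * h) = -((2 * t - 2 * i + 1) * h) by rw [ht']; ring,
    show -(2 * (L : ℂ) + 3) * h = -((2 * L + 3) * h) by ring, hσ.odd, hσ.odd,
    show (2 * ((L + 1 : ℕ) : ℂ) + 1) * h = (2 * L + 3) * h by push_cast; ring, shiftProd_zero]
  rw [show -(2 * (L : ℂ) + 3) * h = -((2 * L + 3) * h) by ring] at n1
  refine eq_of_mul_mul_inv_eq (mul_ne_zero n3 (mul_ne_zero n1 n2)) (mul_ne_zero nv0 nu0) ?_
  rcases neg_one_pow_eq_or ℂ i with hs | hs <;> rw [hs] <;>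
    simp only [div_eq_mul_inv, mul_inv, inv_inv, inv_neg, inv_one, pow_zero] <;> ring

/-- At these parameters the balancing condition turns the product side of the Frenkel–Turaev sum
into the factors B, C, D of the last term of the quadratic sum, so the inversion closes up. -/
lemma quadProd_mul_jacksonProd (hσ : IsSigmaLike σ) {A B C D h : ℂ}
    (hh : ∀ j : ℤ, j ≠ 0 → σ (j * h) ≠ 0) (hA : AvoidsZeros σ A h)
    (hB : AvoidsZeros σ (A - B) h) (hC : AvoidsZeros σ (A - C) h) (hD : AvoidsZeros σ (A - D) h)
    (hBCD : B + C + D = 2 * A + h) (K : ℕ) :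
    quadProd σ A B C D h K * jacksonProd σ (-(2 * K + 1) * h) (B - A - K * h) (C - A - K * h)
      (D - A - K * h) (2 * h) K =
    quadCoeff σ A h K * quadFactor σ A B C D h K * quadKernel σ A h K K := by
  have n0 : σ A ≠ 0 := hA.ne 0 (by simp)
  have n1 : σ (A + K * h) ≠ 0 := hA.ne K (by simp)
  have n3 : σ (A + 3 * K * h) ≠ 0 := hA.ne (3 * K) (by push_cast; ring)
  have n2h := shiftProd_self_ne_zero (int_mul_ne_zero_two hh) K
  have s1 : shiftProd σ (A + (K + 2) * h) (2 * h) K =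
      shiftProd σ (A + K * h) (2 * h) K * σ (A + 3 * K * h) / σ (A + K * h) := by
    rw [eq_div_iff n1, show A + 3 * K * h = A + K * h + K * (2 * h) by ring, ← shiftProd_succ,
      shiftProd_succ', show A + K * h + 2 * h = A + (K + 2) * h by ring, mul_comm]
  have s2 : shiftProd σ (A + h) h K = shiftProd σ A h K * σ (A + K * h) / σ A := by
    rw [← shiftProd_succ, shiftProd_succ', mul_div_cancel_left₀ _ n0]
  have s3 : shiftProd σ (-(2 * K + 1) * h + 2 * h) (2 * h) K =
      shiftProd σ ((K + 1) * h) h K * shiftProd σ (-K * h) h K / shiftProd σ (2 * h) (2 * h) K := by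
    rw [eq_div_iff n2h, hσ.shiftProd_reflect, hσ.shiftProd_reflect (-K * h),
      show -(-(2 * (K : ℂ) + 1) * h + 2 * h) - (K - 1) * (2 * h) = h by ring,
      show -(-(K : ℂ) * h) - (K - 1) * h = h by ring, mul_assoc,
      show (K + 1) * h = h + K * h by ring]
    have e1 := shiftProd_two_mul (σ := σ) h h K
    rw [two_mul, shiftProd_add, show h + h = 2 * h by ring] at e1
    rw [← e1]; ring
  have nAB : ∀ {z}, AvoidsZeros σ (A - z) h → shiftProd σ (A - z + (1 - K) * h) (2 * h) K ≠ 0 :=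
    fun hz => hz.shiftProd_two_ne (1 - K) (by push_cast; ring) K
  have rv : ∀ z, shiftProd σ (-(2 * K + 1) * h + 2 * h - (z - A - K * h)) (2 * h) K =
      shiftProd σ (A - z + (1 - K) * h) (2 * h) K := fun z => by
    congr 1; ring
  rw [quadProd, jacksonProd, quadCoeff, quadFactor, quadKernel, s1, s3, rv, rv, rv,
    show -(2 * (K : ℂ) + 1) * h + 2 * h - (B - A - K * h) - (C - A - K * h) - (D - A - K * h) =
      A + K * h by linear_combination -hBCD,
    show -(2 * (K : ℂ) + 1) * h + 2 * h - (B - A - K * h) - (C - A - K * h) = D by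
      linear_combination -hBCD,
    show -(2 * (K : ℂ) + 1) * h + 2 * h - (B - A - K * h) - (D - A - K * h) = C by
      linear_combination -hBCD,
    show -(2 * (K : ℂ) + 1) * h + 2 * h - (C - A - K * h) - (D - A - K * h) = B by
      linear_combination -hBCD]
  simp only [quadRatio]
  rw [s2, show A - B + h = A + h - B by ring, show A - C + h = A + h - C by ring,
    show A - D + h = A + h - D by ring]
  refine eq_of_mul_mul_inv_eq n3 (mul_ne_zero (nAB hB) (mul_ne_zero (nAB hC) (nAB hD))) ?_
  simp only [div_eq_mul_inv, mul_inv, inv_inv]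
  ring

lemma quadKernel_eq_zero (hσ : IsSigmaLike σ) {A h : ℂ} {n k : ℕ} (hnk : n < k) :
    quadKernel σ A h n k = 0 := by
  obtain ⟨d, rfl⟩ := Nat.exists_eq_add_of_lt hnk
  rw [quadKernel, show shiftProd σ (-n * h) h (n + d + 1) = 0 from
    Finset.prod_eq_zero (i := n) (Finset.mem_range.2 (by omega)) (by simp [hσ.map_zero])]
  simp

/-- The kernel cancels the first k zeros of the weight and puts zeros at half nodes in their place.
There are still L zeros against L + 2 nodes, so the sum over m vanishes by
`sum_prod_sigmaPair_div_prod`. -/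
lemma quadWeight_mul_quadKernel (hσ : IsSigmaLike σ) {A h : ℂ} (hA : AvoidsZeros σ A h)
    (L m k : ℕ) (hk : k ≤ L) :
    quadWeight σ A h L m * quadKernel σ A h m k =
      (∏ j ∈ Finset.range L, sigmaPair σ (halfNode h m)
        (if j < k then halfNode h j else poleNode A h j)) /
      ∏ s ∈ (Finset.range (L + 2)).erase m, sigmaPair σ (halfNode h m) (halfNode h s) := by
  have hne : ∏ j ∈ Finset.range k, sigmaPair σ (halfNode h m) (poleNode A h j) ≠ 0 := by
    rw [prod_sigmaPair_halfNode_poleNode hσ]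
    exact mul_ne_zero (by simp) (mul_ne_zero (hA.shiftProd_two_ne (m + 2) (by push_cast; ring) k)
      (hA.shiftProd_two_ne (1 - m) (by push_cast; ring) k))
  have hker : quadKernel σ A h m k =
      (∏ j ∈ Finset.range k, sigmaPair σ (halfNode h m) (halfNode h j)) /
        ∏ j ∈ Finset.range k, sigmaPair σ (halfNode h m) (poleNode A h j) := by
    rw [prod_sigmaPair_halfNode_poleNode hσ, prod_sigmaPair_halfNode_halfNode hσ,
      mul_div_mul_left _ _ (by simp), quadKernel, mul_comm (shiftProd σ (A + _) _ _)]
  obtain ⟨d, rfl⟩ := Nat.exists_eq_add_of_le hk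
  have e1 : ∏ j ∈ Finset.range k, sigmaPair σ (halfNode h m)
      (if j < k then halfNode h j else poleNode A h j) =
      ∏ j ∈ Finset.range k, sigmaPair σ (halfNode h m) (halfNode h j) :=
    Finset.prod_congr rfl fun j hj => by rw [if_pos (Finset.mem_range.1 hj)]
  have e2 : ∏ j ∈ Finset.range d, sigmaPair σ (halfNode h m)
      (if k + j < k then halfNode h (k + j) else poleNode A h (k + j)) =
      ∏ j ∈ Finset.range d, sigmaPair σ (halfNode h m) (poleNode A h (k + j)) :=
    Finset.prod_congr rfl fun j _ => by rw [if_neg (by omega)]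
  rw [hker, quadWeight, Finset.prod_range_add _ k d, Finset.prod_range_add _ k d, e1, e2]
  field_simp

lemma quadWeight_self_ne_zero (hσ : IsSigmaLike σ) {A h : ℂ}
    (hh : ∀ j : ℤ, j ≠ 0 → σ (j * h) ≠ 0) (hA : AvoidsZeros σ A h) (L m : ℕ) :
    quadWeight σ A h L m ≠ 0 := by
  rw [quadWeight, prod_sigmaPair_halfNode_poleNode hσ]
  refine div_ne_zero (mul_ne_zero (by simp) (mul_ne_zero
    (hA.shiftProd_two_ne (m + 2) (by push_cast; ring) L)
    (hA.shiftProd_two_ne (1 - m) (by push_cast; ring) L))) (Finset.prod_ne_zero_iff.2 ?_)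
  intro s hs
  exact sigmaPair_halfNode_ne_zero hh (Finset.ne_of_mem_erase hs).symm

/-- The elliptic quadratic summation. -/
theorem sum_quadKernel (hσ : IsSigmaLike σ) {A B C D h : ℂ}
    (hh : ∀ j : ℤ, j ≠ 0 → σ (j * h) ≠ 0) (hA : AvoidsZeros σ A h)
    (hB : AvoidsZeros σ (A - B) h) (hC : AvoidsZeros σ (A - C) h) (hD : AvoidsZeros σ (A - D) h)
    (hBCD : B + C + D = 2 * A + h) (n : ℕ) :
    ∑ k ∈ Finset.range (n + 1), quadCoeff σ A h k * quadFactor σ A B C D h k *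
      quadKernel σ A h n k = quadProd σ A B C D h n := by
  induction n using Nat.strong_induction_on with
  | _ n ih =>
    obtain _ | L := n
    · have : σ A ≠ 0 := hA.ne 0 (by simp)
      simp [quadCoeff, quadFactor, quadKernel, quadProd, quadRatio, this]
    have hext : ∀ m ≤ L + 1, ∑ k ∈ Finset.range (L + 2), quadCoeff σ A h k *
        quadFactor σ A B C D h k * quadKernel σ A h m k = ∑ k ∈ Finset.range (m + 1),
        quadCoeff σ A h k * quadFactor σ A B C D h k * quadKernel σ A h m k := fun m hm => by
      refine (Finset.sum_subset (Finset.range_mono (by omega)) fun k _ hk => ?_).symm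
      rw [quadKernel_eq_zero hσ (by simpa using hk), mul_zero]
    -- The weighted sum of the closed forms, by the Frenkel–Turaev sum.
    have h1 : ∑ m ∈ Finset.range (L + 2), quadWeight σ A h L m * quadProd σ A B C D h m =
        quadWeight σ A h L (L + 1) * (quadCoeff σ A h (L + 1) * quadFactor σ A B C D h (L + 1) *
          quadKernel σ A h (L + 1) (L + 1)) := by
      rw [← quadProd_mul_jacksonProd hσ hh hA hB hC hD hBCD, ← sum_zigzag (L + 1),
        Finset.sum_congr rfl fun i hi => quadWeight_mul_quadProd_zigzag hσ hh hA hB hC hD hBCD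
          (Nat.lt_succ_iff.1 (Finset.mem_range.1 hi)), ← Finset.mul_sum]
      push_cast
      rw [show 2 * ((L : ℂ) + 1) + 1 = 2 * L + 3 by ring, sum_jacksonTerm hσ
        (int_mul_ne_zero_two hh) _ (avoidsZeros_odd hh (-(L + 2)) (by push_cast; ring))
        (hB.add (-(L + 2)) (by push_cast; ring)).two (hC.add (-(L + 2)) (by push_cast; ring)).two
        (hD.add (-(L + 2)) (by push_cast; ring)).two
        ((hA.neg hσ).add (1 - L) (by push_cast; linear_combination hBCD)).two, mul_assoc]
    -- The weighted sum of the actual sums: columns k ≤ L are annihilated, and in column L + 1 only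
    -- m = L + 1 survives.
    have h2 : ∑ m ∈ Finset.range (L + 2), quadWeight σ A h L m * ∑ k ∈ Finset.range (L + 2),
        quadCoeff σ A h k * quadFactor σ A B C D h k * quadKernel σ A h m k =
        quadWeight σ A h L (L + 1) * (quadCoeff σ A h (L + 1) * quadFactor σ A B C D h (L + 1) *
          quadKernel σ A h (L + 1) (L + 1)) := by
      simp only [Finset.mul_sum]
      rw [Finset.sum_comm, Finset.sum_range_succ]
      have h3 : ∀ k ∈ Finset.range (L + 1), ∑ m ∈ Finset.range (L + 2), quadWeight σ A h L m *
          (quadCoeff σ A h k * quadFactor σ A B C D h k * quadKernel σ A h m k) = 0 := by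
        intro k hk
        have hk' : k ≤ L := Nat.lt_succ_iff.1 (Finset.mem_range.1 hk)
        have := sum_prod_sigmaPair_div_prod hσ (halfNode h)
          (fun j => if j < k then halfNode h j else poleNode A h j) L
            fun i _ j _ hij => sigmaPair_halfNode_ne_zero hh hij
        rw [← Finset.sum_congr rfl fun m _ => quadWeight_mul_quadKernel hσ hA L m k hk'] at this
        rw [← mul_zero (quadCoeff σ A h k * quadFactor σ A B C D h k), ← this, Finset.mul_sum]
        exact Finset.sum_congr rfl fun m _ => by ring
      rw [Finset.sum_eq_zero h3, zero_add, Finset.sum_range_succ, add_eq_right]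
      refine Finset.sum_eq_zero fun m hm => ?_
      rw [quadKernel_eq_zero hσ (Finset.mem_range.1 hm)]; simp
    -- The two weighted sums agree, and so do their entries with m ≤ L by induction. The weight at m
    -- = L + 1 is nonzero and can be cancelled.
    rw [← h2, Finset.sum_range_succ, Finset.sum_range_succ _ (L + 1),
      Finset.sum_congr rfl fun m hm => by
        rw [← ih m (Finset.mem_range.1 hm), ← hext m (Finset.mem_range.1 hm).le]] at h1
    rw [← hext _ le_rfl]
    exact (mul_left_cancel₀ (quadWeight_self_ne_zero hσ hh hA L _) (add_left_cancel h1)).symm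

end QuadraticSum

/-! ### The quadratic transformation in additive form. -/

section QuadraticTransformation

variable {σ : ℂ → ℂ}

lemma prod_range_erase {f : ℕ → ℂ} (r k : ℕ) :
    ∏ s ∈ (Finset.range (r + k + 1)).erase r, f s =
      (∏ s ∈ Finset.range r, f s) * ∏ s ∈ Finset.range k, f (r + 1 + s) := by
  induction k with
  | zero => rw [add_zero, Finset.range_add_one, Finset.erase_insert (by simp)]; simp
  | succ k ih =>
    rw [show r + (k + 1) + 1 = r + k + 1 + 1 by ring, Finset.range_add_one,
      Finset.erase_insert_of_ne (by omega), Finset.prod_insert (by simp), ih,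
      Finset.prod_range_succ _ k, show r + 1 + k = r + k + 1 by ring]
    ring

lemma quadRatio_add (z h : ℂ) (r N : ℕ) : quadRatio σ z h (r + N) =
    shiftProd σ (z + (1 - (r + N)) * h) (2 * h) r / shiftProd σ (z + h) h r *
      quadRatio σ (z + r * h) h N := by
  rw [quadRatio, quadRatio, shiftProd_add, shiftProd_add]
  push_cast
  rw [show z + (1 - ((r : ℂ) + N)) * h + r * (2 * h) = z + r * h + (1 - N) * h by ring,
    show z + h + r * h = z + r * h + h by ring, mul_div_mul_comm]

lemma shiftProd_add_of_eq (z h : ℂ) (r k : ℕ) {w : ℂ} (hw : w = z + r * h) :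
    shiftProd σ z h (r + k) = shiftProd σ z h r * shiftProd σ w h k := hw ▸ shiftProd_add z h r k

/-- The coefficients of the partial fraction expansion of
`(e,f;q)_k / (a/e,a/f;q²)_{k+1}`. -/
noncomputable def pfCoeff (σ : ℂ → ℂ) (A h : ℂ) (n k r : ℕ) : ℂ :=
  (∏ j ∈ Finset.range k, σ (A + (2 * r + j) * h) * σ ((2 * r - n - 1 - j) * h)) /
    ∏ s ∈ (Finset.range (k + 1)).erase r,
      σ (A + (2 * (r + s) - n - 1) * h) * σ (2 * (r - s) * h)

/-- Partial fractions in y = (E - F)/2, with nodes A - (E + F)/2 + 2sh and zeros at (E + F)/2 + jh.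
As E + F is fixed by `hEF`, the coefficients depend only on A, h and n. -/
lemma shiftProd_div_shiftProd_eq_sum (hσ : IsSigmaLike σ) {A E F h : ℂ}
    (hh : ∀ j : ℤ, j ≠ 0 → σ (j * h) ≠ 0) (hA : AvoidsZeros σ A h)
    (hE : AvoidsZeros σ (A - E) h) (hF : AvoidsZeros σ (A - F) h) {n : ℕ}
    (hEF : E + F = A + (n + 1) * h) (k : ℕ) :
    shiftProd σ E h k * shiftProd σ F h k /
      (shiftProd σ (A + 2 * h - E) (2 * h) k * shiftProd σ (A + 2 * h - F) (2 * h) k) =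
    ∑ r ∈ Finset.range (k + 1), shiftProd σ (A - E) (2 * h) r * shiftProd σ (A - F) (2 * h) r /
      (shiftProd σ (A + 2 * h - E) (2 * h) r * shiftProd σ (A + 2 * h - F) (2 * h) r) *
        pfCoeff σ A h n k r := by
  have hn : (n : ℂ) * h = E + F - A - h := by linear_combination -hEF
  have hxx : ∀ r s : ℕ, sigmaPair σ (A - (E + F) / 2 + 2 * r * h) (A - (E + F) / 2 + 2 * s * h) =
      σ (A + (2 * (r + s) - n - 1) * h) * σ (2 * (r - s) * h) := fun r s => by
    rw [sigmaPair]
    congr 2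
    · linear_combination -hEF
    · ring
  have hxb : ∀ r j : ℕ, sigmaPair σ (A - (E + F) / 2 + 2 * r * h) ((E + F) / 2 + j * h) =
      σ (A + (2 * r + j) * h) * σ ((2 * r - n - 1 - j) * h) := fun r s => by
    rw [sigmaPair]
    congr 2
    · ring
    · linear_combination -hEF
  have hyx : ∀ s : ℕ, sigmaPair σ ((E - F) / 2) (A - (E + F) / 2 + 2 * s * h) =
      -(σ (A - E + s * (2 * h)) * σ (A - F + s * (2 * h))) := fun s => by
    rw [sigmaPair, mul_comm (σ (A - E + _)), ← mul_neg, ← hσ.odd]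
    congr 2 <;> ring
  have hyb : ∀ s : ℕ, sigmaPair σ ((E - F) / 2) ((E + F) / 2 + s * h) =
      -(σ (E + s * h) * σ (F + s * h)) := fun s => by
    rw [sigmaPair, ← mul_neg, ← hσ.odd]
    congr 2 <;> ring
  have nE : ∀ s : ℕ, σ (A - E + s * (2 * h)) ≠ 0 := fun s =>
    hE.ne (2 * s) (by push_cast; ring)
  have nF : ∀ s : ℕ, σ (A - F + s * (2 * h)) ≠ 0 := fun s =>
    hF.ne (2 * s) (by push_cast; ring)
  have key := prod_sigmaPair_div_prod hσ (fun s => A - (E + F) / 2 + 2 * s * h)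
    (fun j => (E + F) / 2 + j * h) k
    (fun i _ j _ hij => by
      rw [hxx]
      have := int_mul_ne_zero_two hh (i - j) (by omega)
      refine mul_ne_zero (hA.ne (2 * (i + j) - n - 1) (by push_cast; ring)) ?_
      rwa [show 2 * ((i : ℂ) - j) * h = ((i - j : ℤ) : ℂ) * (2 * h) by push_cast; ring])
    ((E - F) / 2) (fun i _ => by
      rw [hyx]; exact neg_ne_zero.2 (mul_ne_zero (nE i) (nF i)))
  simp only [hxx, hyx, hyb, hxb] at key
  have hneg : ∀ (f g : ℕ → ℂ) (m : ℕ), ∏ j ∈ Finset.range m, -(f j * g j) =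
      (-1) ^ m * ((∏ j ∈ Finset.range m, f j) * ∏ j ∈ Finset.range m, g j) := fun f g m => by
    rw [Finset.prod_neg, Finset.card_range, Finset.prod_mul_distrib]
  -- The quotient telescopes. It turns the simple pole at node r into the e, f factors of the r-th
  -- term of the transformed series.
  have hshift : ∀ z, (∀ s : ℕ, σ (z + s * (2 * h)) ≠ 0) → ∀ r : ℕ,
      shiftProd σ z (2 * h) r / shiftProd σ (z + 2 * h) (2 * h) r =
        σ z / σ (z + r * (2 * h)) := fun z hz r => by
    have : shiftProd σ (z + 2 * h) (2 * h) r ≠ 0 := Finset.prod_ne_zero_iff.2 fun j _ => by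
      have := hz (j + 1)
      push_cast at this
      rwa [show z + 2 * h + j * (2 * h) = z + (j + 1) * (2 * h) by ring]
    rw [div_eq_div_iff this (hz r), ← shiftProd_succ, shiftProd_succ']
  have nE0 := nE 0
  have nF0 := nF 0
  simp only [Nat.cast_zero, zero_mul, add_zero] at nE0 nF0
  rw [hneg, hneg] at key
  change (-1) ^ k * (shiftProd σ E h k * shiftProd σ F h k) / ((-1) ^ (k + 1) *
    (shiftProd σ (A - E) (2 * h) (k + 1) * shiftProd σ (A - F) (2 * h) (k + 1))) =
    ∑ r ∈ Finset.range (k + 1), pfCoeff σ A h n k r / _ at key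
  rw [pow_succ, mul_assoc, mul_div_mul_left _ _ (by simp), shiftProd_succ', shiftProd_succ',
    show A - E + 2 * h = A + 2 * h - E by ring, show A - F + 2 * h = A + 2 * h - F by ring] at key
  have key2 : shiftProd σ E h k * shiftProd σ F h k /
      (shiftProd σ (A + 2 * h - E) (2 * h) k * shiftProd σ (A + 2 * h - F) (2 * h) k) =
      -(σ (A - E) * σ (A - F)) * (shiftProd σ E h k * shiftProd σ F h k / (-1 *
        (σ (A - E) * shiftProd σ (A + 2 * h - E) (2 * h) k *
          (σ (A - F) * shiftProd σ (A + 2 * h - F) (2 * h) k)))) := by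
    refine eq_of_mul_mul_inv_eq (mul_ne_zero nE0 nF0) one_ne_zero ?_
    simp only [div_eq_mul_inv, mul_inv, inv_neg, inv_one]
    ring
  rw [key2, key, Finset.mul_sum]
  refine Finset.sum_congr rfl fun r _ => ?_
  rw [mul_div_mul_comm, show A + 2 * h - E = A - E + 2 * h by ring,
    show A + 2 * h - F = A - F + 2 * h by ring, hshift _ nE, hshift _ nF]
  simp only [div_eq_mul_inv, mul_inv, inv_neg]
  ring

/-- The factors of the left-hand side of the quadratic transformation that depend on neither
`b, c, d` nor `e, f`. -/
noncomputable def transCoeff (σ : ℂ → ℂ) (A h : ℂ) (n k : ℕ) : ℂ :=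
  σ (A + 3 * k * h) / σ A * (shiftProd σ (-n * h) h k / shiftProd σ (A + (n + 2) * h) (2 * h) k)

lemma quadFactor_add {A B C D h : ℂ} (r k : ℕ) : quadFactor σ A B C D h (r + k) =
    quadFactor σ A B C D h r * quadFactor σ (A + 3 * r * h) (B + 2 * r * h) (C + 2 * r * h)
      (D + 2 * r * h) h k := by
  have h1 : ∀ x, shiftProd σ (A + h - x) h (r + k) = shiftProd σ (A + h - x) h r *
      shiftProd σ (A + 3 * r * h + h - (x + 2 * r * h)) h k := fun x =>
    shiftProd_add_of_eq _ _ _ _ (by ring)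
  have h2 : ∀ x, shiftProd σ x (2 * h) (r + k) = shiftProd σ x (2 * h) r *
      shiftProd σ (x + 2 * r * h) (2 * h) k := fun x =>
    shiftProd_add_of_eq _ _ _ _ (by ring)
  simp only [quadFactor, h1, h2, div_eq_mul_inv, mul_inv]
  ring

lemma pfCoeff_self (A h : ℂ) (n r : ℕ) : pfCoeff σ A h n r r =
    shiftProd σ (A + 2 * r * h) h r * shiftProd σ ((r - n) * h) h r /
      (shiftProd σ (A + (2 * r - n - 1) * h) (2 * h) r * shiftProd σ (2 * h) (2 * h) r) := by
  have h1 := prod_range_erase (f := fun s : ℕ =>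
    σ (A + (2 * (r + s) - n - 1) * h) * σ (2 * (r - s) * h)) r 0
  rw [add_zero, Finset.range_zero, Finset.prod_empty, mul_one] at h1
  rw [pfCoeff, h1, Finset.prod_mul_distrib, Finset.prod_mul_distrib, shiftProd_rev ((r - n) * h),
    shiftProd_rev (2 * h)]
  simp only [shiftProd]
  congr 2 <;> refine Finset.prod_congr rfl fun j _ => ?_ <;> congr 1 <;> ring

lemma pfCoeff_add (hσ : IsSigmaLike σ) (A h : ℂ) (r N k : ℕ) : pfCoeff σ A h (r + N) (r + k) r =
    pfCoeff σ A h (r + N) r r *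
      (shiftProd σ (A + 3 * r * h) h k * shiftProd σ ((N + 1) * h) h k /
        (shiftProd σ (A + 3 * r * h + (1 - N) * h) (2 * h) k * shiftProd σ (2 * h) (2 * h) k)) := by
  have h1 := prod_range_erase (f := fun s : ℕ =>
    σ (A + (2 * (r + s) - (r + N : ℕ) - 1) * h) * σ (2 * (r - s) * h)) r 0
  rw [add_zero, Finset.range_zero, Finset.prod_empty, mul_one] at h1
  have h2 : ∏ x ∈ Finset.range k, σ (A + (2 * r + (r + x : ℕ)) * h) *
      σ ((2 * r - (r + N : ℕ) - 1 - (r + x : ℕ)) * h) =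
      (-1) ^ k * (shiftProd σ (A + 3 * r * h) h k * shiftProd σ ((N + 1) * h) h k) := by
    rw [shiftProd, shiftProd, ← Finset.prod_mul_distrib, ← Finset.card_range k,
      ← Finset.prod_const, Finset.card_range, ← Finset.prod_mul_distrib]
    refine Finset.prod_congr rfl fun j _ => ?_
    push_cast
    rw [show (2 * (r : ℂ) - (r + N) - 1 - (r + j)) * h = -((N + 1) * h + j * h) by ring, hσ.odd,
      show A + (2 * (r : ℂ) + (r + j)) * h = A + 3 * r * h + j * h by ring]
    ring
  have h3 : ∏ x ∈ Finset.range k, σ (A + (2 * (r + (r + 1 + x : ℕ)) - (r + N : ℕ) - 1) * h) *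
      σ (2 * (r - (r + 1 + x : ℕ)) * h) = (-1) ^ k *
      (shiftProd σ (A + 3 * r * h + (1 - N) * h) (2 * h) k * shiftProd σ (2 * h) (2 * h) k) := by
    rw [shiftProd, shiftProd, ← Finset.prod_mul_distrib, ← Finset.card_range k,
      ← Finset.prod_const, Finset.card_range, ← Finset.prod_mul_distrib]
    refine Finset.prod_congr rfl fun j _ => ?_
    push_cast
    rw [show 2 * ((r : ℂ) - (r + 1 + j)) * h = -(2 * h + j * (2 * h)) by ring, hσ.odd,
      show A + (2 * ((r : ℂ) + (r + 1 + j)) - (r + N) - 1) * h =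
        A + 3 * r * h + (1 - N) * h + j * (2 * h) by ring]
    ring
  rw [pfCoeff, pfCoeff, prod_range_erase, h1, Finset.prod_range_add _ r k, h2, h3,
    mul_div_mul_comm, mul_div_mul_left _ _ (by simp)]

/-- With n = r + N and index r + k, the k-dependence is that of the quadratic summation of length N
at A + 3rh, B + 2rh, C + 2rh, D + 2rh. The shifted parameters are balanced again. -/
lemma transCoeff_add (hσ : IsSigmaLike σ) {A B C D h : ℂ} (hA : AvoidsZeros σ A h)
    (r N k : ℕ) :
    transCoeff σ A h (r + N) (r + k) * quadFactor σ A B C D h (r + k) *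
      pfCoeff σ A h (r + N) (r + k) r =
    transCoeff σ A h (r + N) r * quadFactor σ A B C D h r * pfCoeff σ A h (r + N) r r *
      (quadCoeff σ (A + 3 * r * h) h k * quadFactor σ (A + 3 * r * h) (B + 2 * r * h)
        (C + 2 * r * h) (D + 2 * r * h) h k * quadKernel σ (A + 3 * r * h) h N k) := by
  have n1 : σ (A + 3 * r * h) ≠ 0 := hA.ne (3 * r) (by push_cast; ring)
  rw [quadFactor_add, pfCoeff_add hσ, transCoeff, transCoeff, quadCoeff, quadKernel,
    shiftProd_add_of_eq (-(r + N : ℕ) * h) h r k (w := -N * h) (by push_cast; ring),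
    shiftProd_add_of_eq (A + _) (2 * h) r k (w := A + 3 * r * h + (N + 2) * h)
      (by push_cast; ring),
    show A + 3 * (r + k : ℕ) * h = A + 3 * r * h + 3 * k * h by push_cast; ring]
  refine eq_of_mul_mul_inv_eq n1 one_ne_zero ?_
  simp only [div_eq_mul_inv, mul_inv]
  ring

/-- The terms of the `₁₀ω₉` series, without the factors that depend on `e, f`. -/
noncomputable def omegaCoeff (σ : ℂ → ℂ) (A B C D h : ℂ) (n r : ℕ) : ℂ :=
  σ (A - (n + 1) * h + 2 * r * (2 * h)) / σ (A - (n + 1) * h) *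
    (shiftProd σ (A - (n + 1) * h) (2 * h) r * (shiftProd σ B (2 * h) r * shiftProd σ C (2 * h) r *
      shiftProd σ D (2 * h) r) *
        (shiftProd σ ((1 - n) * h) (2 * h) r * shiftProd σ (-n * h) (2 * h) r)) /
    (shiftProd σ (2 * h) (2 * h) r * (shiftProd σ (A + (1 - n) * h - B) (2 * h) r *
      shiftProd σ (A + (1 - n) * h - C) (2 * h) r * shiftProd σ (A + (1 - n) * h - D) (2 * h) r) *
        (shiftProd σ A (2 * h) r * shiftProd σ (A + h) (2 * h) r))

/-- The closed form of the r-th inner sum, times its prefactor, is the closed form for r = 0 times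
the e, f-free part of the r-th term on the right. -/
lemma transCoeff_mul_quadProd {A B C D h : ℂ} (hA : AvoidsZeros σ A h)
    (hB : AvoidsZeros σ (A - B) h) (hC : AvoidsZeros σ (A - C) h) (hD : AvoidsZeros σ (A - D) h)
    (r N : ℕ) :
    transCoeff σ A h (r + N) r * quadFactor σ A B C D h r * pfCoeff σ A h (r + N) r r *
      quadProd σ (A + 3 * r * h) (B + 2 * r * h) (C + 2 * r * h) (D + 2 * r * h) h N =
    quadProd σ A B C D h (r + N) * omegaCoeff σ A B C D h (r + N) r := by
  have ra : shiftProd σ (-(r + N : ℕ) * h) h r * shiftProd σ ((r - (r + N : ℕ)) * h) h r =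
      shiftProd σ ((1 - (r + N : ℕ)) * h) (2 * h) r * shiftProd σ (-(r + N : ℕ) * h) (2 * h) r := by
    rw [← shiftProd_add_of_eq _ _ _ _ (by ring), ← two_mul, shiftProd_two_mul, mul_comm]
    congr 2; ring
  obtain ⟨pA, hpA⟩ : ∃ p, p = shiftProd σ A (2 * h) r := ⟨_, rfl⟩
  obtain ⟨pA1, hpA1⟩ : ∃ p, p = shiftProd σ (A + h) (2 * h) r := ⟨_, rfl⟩
  obtain ⟨p1, hp1⟩ : ∃ p, p = shiftProd σ (A + 2 * r * h) h r := ⟨_, rfl⟩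
  obtain ⟨p2, hp2⟩ : ∃ p, p = shiftProd σ (A + 3 * r * h + h) h N := ⟨_, rfl⟩
  obtain ⟨n1, hn1⟩ : ∃ p, p = shiftProd σ (A + ((r + N : ℕ) + 1) * h) (2 * h) r := ⟨_, rfl⟩
  obtain ⟨n2, hn2⟩ : ∃ p, p = shiftProd σ (A + ((r + N : ℕ) + 2) * h) (2 * h) r := ⟨_, rfl⟩
  obtain ⟨q3, hq3⟩ : ∃ p, p = shiftProd σ (A + 3 * r * h + (1 - N) * h) (2 * h) N := ⟨_, rfl⟩
  obtain ⟨q2, hq2⟩ : ∃ p, p = shiftProd σ (A + (2 * r - (r + N : ℕ) - 1) * h) (2 * h) r := ⟨_, rfl⟩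
  obtain ⟨q4, hq4⟩ : ∃ p, p = shiftProd σ (A + (1 - (r + N : ℕ)) * h) (2 * h) (r + N) := ⟨_, rfl⟩
  have nA : σ A ≠ 0 := hA.ne 0 (by simp)
  have npA : pA ≠ 0 := hpA ▸ hA.shiftProd_two_ne 0 (by simp) r
  have npA1 : pA1 ≠ 0 := hpA1 ▸ hA.shiftProd_two_ne 1 (by simp) r
  have np1 : p1 ≠ 0 := hp1 ▸ hA.shiftProd_ne (2 * r) (by push_cast; ring) r
  have np2 : p2 ≠ 0 := hp2 ▸ hA.shiftProd_ne (3 * r + 1) (by push_cast; ring) N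
  have nn2 : n2 ≠ 0 := hn2 ▸ hA.shiftProd_two_ne (r + N + 2) (by push_cast; ring) r
  have nq2 : q2 ≠ 0 := hq2 ▸ hA.shiftProd_two_ne (2 * r - (r + N : ℕ) - 1) (by push_cast; ring) r
  have nq3 : q3 ≠ 0 := hq3 ▸ hA.shiftProd_two_ne (3 * r + 1 - N) (by push_cast; ring) N
  have nq4 : q4 ≠ 0 := hq4 ▸ hA.shiftProd_two_ne (1 - (r + N : ℕ)) (by push_cast; ring) (r + N)
  have nl : σ (A - ((r + N : ℕ) + 1) * h) ≠ 0 := hA.ne (-((r + N : ℕ) + 1)) (by push_cast; ring)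
  -- `rb` and `rc` come from factoring one long shifted factorial in two ways: 3r + N + 1 factors of
  -- step h from A, and 2r + N + 1 factors of step 2h from A - (n + 1)h, where n = r + N.
  have rb : σ (A + 3 * r * h) =
      σ A * shiftProd σ (A + h) h (r + N) * n1 * n2 / (p1 * p2 * pA * pA1) := by
    rw [eq_div_iff (by simp [npA, npA1, np1, np2])]
    have e1 : shiftProd σ A h (r + N + 1 + 2 * r) =
        σ A * shiftProd σ (A + h) h (r + N) * (n1 * n2) := by
      rw [shiftProd_add_of_eq A h (r + N + 1) (2 * r) (w := A + ((r + N : ℕ) + 1) * h)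
        (by push_cast; ring), shiftProd_two_mul, shiftProd_succ', hn1, hn2,
        show A + ((r + N : ℕ) + 1) * h + h = A + ((r + N : ℕ) + 2) * h by ring]
    have e2 : shiftProd σ A h (r + N + 1 + 2 * r) = pA * pA1 * p1 * (σ (A + 3 * r * h) * p2) := by
      rw [show r + N + 1 + 2 * r = 2 * r + r + (N + 1) by ring,
        shiftProd_add_of_eq A h (2 * r + r) (N + 1) (w := A + 3 * r * h) (by push_cast; ring),
        shiftProd_add_of_eq A h (2 * r) r (w := A + 2 * r * h) (by push_cast; ring),
        shiftProd_two_mul, shiftProd_succ', hpA, hpA1, hp1, hp2]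
    linear_combination e2.symm.trans e1
  have rc : n1 = σ (A - ((r + N : ℕ) + 1) * h + 2 * r * (2 * h)) *
      shiftProd σ (A - ((r + N : ℕ) + 1) * h) (2 * h) r * q2 * q3 /
        (q4 * σ (A - ((r + N : ℕ) + 1) * h)) := by
    rw [eq_div_iff (mul_ne_zero nq4 nl)]
    have e1 : shiftProd σ (A - ((r + N : ℕ) + 1) * h) (2 * h) (r + N + 1 + r) =
        σ (A - ((r + N : ℕ) + 1) * h) * q4 * n1 := by
      rw [shiftProd_add_of_eq _ (2 * h) (r + N + 1) r (w := A + ((r + N : ℕ) + 1) * h)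
        (by push_cast; ring), shiftProd_succ', hn1, hq4]
      congr 3; ring
    have e2 : shiftProd σ (A - ((r + N : ℕ) + 1) * h) (2 * h) (r + N + 1 + r) =
        shiftProd σ (A - ((r + N : ℕ) + 1) * h) (2 * h) r * q2 *
          (σ (A - ((r + N : ℕ) + 1) * h + 2 * r * (2 * h)) * q3) := by
      rw [show r + N + 1 + r = r + r + (N + 1) by ring, shiftProd_add_of_eq _ (2 * h) (r + r)
        (N + 1) (w := A - ((r + N : ℕ) + 1) * h + 2 * r * (2 * h)) (by push_cast; ring),
        shiftProd_add_of_eq _ (2 * h) r r (w := A + (2 * r - (r + N : ℕ) - 1) * h)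
        (by push_cast; ring), shiftProd_succ', hq2, hq3]
      congr 3; push_cast; ring
    linear_combination e1.symm.trans e2
  have hz : ∀ {z}, AvoidsZeros σ (A - z) h →
      quadRatio σ (A + 3 * r * h - (z + 2 * r * h)) h N / shiftProd σ (A + h - z) h r =
        quadRatio σ (A - z) h (r + N) /
          shiftProd σ (A + (1 - (r + N : ℕ)) * h - z) (2 * h) r := fun {z} hz => by
    have := hz.shiftProd_two_ne (w := A + (1 - (r + N : ℕ)) * h - z) (1 - (r + N : ℕ))
      (by push_cast; ring) r
    rw [quadRatio_add, eq_div_iff this]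
    push_cast
    rw [show A + 3 * r * h - (z + 2 * r * h) = A - z + r * h by ring,
      show A - z + h = A + h - z by ring,
      show A - z + (1 - ((r : ℂ) + N)) * h = A + (1 - ((r : ℂ) + N)) * h - z by ring]
    ring
  trans (transCoeff σ A h (r + N) r * pfCoeff σ A h (r + N) r r / quadRatio σ (A + 3 * r * h) h N) *
    (shiftProd σ B (2 * h) r * shiftProd σ C (2 * h) r * shiftProd σ D (2 * h) r) *
    ((quadRatio σ (A + 3 * r * h - (B + 2 * r * h)) h N / shiftProd σ (A + h - B) h r) *
      (quadRatio σ (A + 3 * r * h - (C + 2 * r * h)) h N / shiftProd σ (A + h - C) h r) *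
      (quadRatio σ (A + 3 * r * h - (D + 2 * r * h)) h N / shiftProd σ (A + h - D) h r))
  · rw [quadFactor, quadProd]
    simp only [div_eq_mul_inv, mul_inv]
    ring
  have hmid : transCoeff σ A h (r + N) r * pfCoeff σ A h (r + N) r r /
      quadRatio σ (A + 3 * r * h) h N = (1 / quadRatio σ A h (r + N)) *
      (σ (A - ((r + N : ℕ) + 1) * h + 2 * r * (2 * h)) / σ (A - ((r + N : ℕ) + 1) * h) *
      (shiftProd σ (A - ((r + N : ℕ) + 1) * h) (2 * h) r *
        (shiftProd σ ((1 - (r + N : ℕ)) * h) (2 * h) r *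
          shiftProd σ (-(r + N : ℕ) * h) (2 * h) r)) /
        (shiftProd σ (2 * h) (2 * h) r * (pA * pA1))) := by
    rw [transCoeff, pfCoeff_self, quadRatio, quadRatio, ← hp1, ← hp2, ← hq2, ← hq3, ← hq4, ← hn2,
      rb, rc, ← ra]
    refine eq_of_mul_mul_inv_eq one_ne_zero (mul_ne_zero (mul_ne_zero (mul_ne_zero nA np1)
      (mul_ne_zero np2 nn2)) (mul_ne_zero nq2 nq3)) ?_
    simp only [div_eq_mul_inv, mul_inv, inv_inv]
    ring
  rw [hmid, hz hB, hz hC, hz hD, quadProd, omegaCoeff, hpA, hpA1]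
  simp only [div_eq_mul_inv, mul_inv]
  ring

/-- The elliptic quadratic transformation in additive notation. -/
theorem sum_transCoeff (hσ : IsSigmaLike σ) {A B C D E F h : ℂ}
    (hh : ∀ j : ℤ, j ≠ 0 → σ (j * h) ≠ 0) (hA : AvoidsZeros σ A h)
    (hB : AvoidsZeros σ (A - B) h) (hC : AvoidsZeros σ (A - C) h) (hD : AvoidsZeros σ (A - D) h)
    (hE : AvoidsZeros σ (A - E) h) (hF : AvoidsZeros σ (A - F) h)
    (hBCD : B + C + D = 2 * A + h) {n : ℕ} (hEF : E + F = A + (n + 1) * h) :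
    ∑ k ∈ Finset.range (n + 1), transCoeff σ A h n k * quadFactor σ A B C D h k *
      (shiftProd σ E h k * shiftProd σ F h k /
        (shiftProd σ (A + 2 * h - E) (2 * h) k * shiftProd σ (A + 2 * h - F) (2 * h) k)) =
    quadProd σ A B C D h n * ∑ r ∈ Finset.range (n + 1), omegaCoeff σ A B C D h n r *
      (shiftProd σ (A - E) (2 * h) r * shiftProd σ (A - F) (2 * h) r /
        (shiftProd σ (A + 2 * h - E) (2 * h) r * shiftProd σ (A + 2 * h - F) (2 * h) r)) := by
  simp only [shiftProd_div_shiftProd_eq_sum hσ hh hA hE hF hEF, Finset.mul_sum]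
  -- Interchange of the sums over r ≤ k ≤ n; each inner sum over k is then a shifted quadratic
  -- summation.
  rw [Finset.sum_comm' (t' := Finset.range (n + 1)) (s' := fun r => Finset.Ico r (n + 1))
    (fun k r => by simp only [Finset.mem_range, Finset.mem_Ico]; omega)]
  refine Finset.sum_congr rfl fun r hr => ?_
  obtain ⟨N, rfl⟩ := Nat.exists_eq_add_of_le (Nat.lt_succ_iff.1 (Finset.mem_range.1 hr))
  rw [Finset.sum_Ico_eq_sum_range, show r + N + 1 - r = N + 1 by omega, ← mul_assoc,
    ← transCoeff_mul_quadProd hA hB hC hD, ← sum_quadKernel hσ hh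
      (hA.add (3 * r) (by push_cast; ring)) (hB.add r (by push_cast; ring))
      (hC.add r (by push_cast; ring)) (hD.add r (by push_cast; ring))
      (by linear_combination hBCD) N, Finset.mul_sum, Finset.sum_mul]
  refine Finset.sum_congr rfl fun k _ => ?_
  rw [← transCoeff_add hσ hA]
  ring

end QuadraticTransformation

/-! ### Jacobi triple product and the three-term relation for theta functions. -/

section Theta

open Filter Topology

lemma summable_norm_mul_pow {p : ℂ} (hp : ‖p‖ < 1) (x : ℂ) : Summable fun k : ℕ => ‖-(x * p ^ k)‖ := by
  simp only [norm_neg, norm_mul, norm_pow]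
  exact (summable_geometric_of_lt_one (norm_nonneg _) hp).mul_left _

lemma tendsto_qPochInf {p : ℂ} (hp : ‖p‖ < 1) (x : ℂ) :
    Tendsto (fun N => ∏ j ∈ Finset.range N, (1 - x * p ^ j)) atTop (𝓝 (qPochInf x p)) := by
  have := (multipliable_one_add_of_summable (summable_norm_mul_pow hp x)).hasProd.tendsto_prod_nat
  simpa only [← sub_eq_add_neg, qPochInf] using this

lemma qPochInf_ne_zero {p x : ℂ} (hp : ‖p‖ < 1) (hx : ∀ k : ℕ, x * p ^ k ≠ 1) :
    qPochInf x p ≠ 0 := by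
  have := tprod_one_add_ne_zero_of_summable (f := fun k : ℕ => -(x * p ^ k))
    (fun k => by rw [← sub_eq_add_neg]; exact sub_ne_zero.2 (hx k).symm)
    (summable_norm_mul_pow hp x)
  simpa only [← sub_eq_add_neg, qPochInf] using this

/-- The Gaussian binomial coefficients. -/
def gaussBinom (p : ℂ) : ℕ → ℕ → ℂ
  | _, 0 => 1
  | 0, _ + 1 => 0
  | M + 1, k + 1 => gaussBinom p M k + p ^ (k + 1) * gaussBinom p M (k + 1)

lemma gaussBinom_zero_right (p : ℂ) (M : ℕ) : gaussBinom p M 0 = 1 := by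
  cases M <;> rfl

lemma gaussBinom_eq_zero (p : ℂ) {M k : ℕ} (h : M < k) : gaussBinom p M k = 0 := by
  induction M generalizing k with
  | zero => obtain ⟨k, rfl⟩ := Nat.exists_eq_succ_of_ne_zero (by omega : k ≠ 0); rfl
  | succ M ih =>
    obtain ⟨k, rfl⟩ := Nat.exists_eq_succ_of_ne_zero (by omega : k ≠ 0)
    rw [gaussBinom, ih (by omega), ih (by omega)]; simp

/-- The q-factorial formula in cleared form, which avoids assuming that the factors 1 - p^j are
nonzero. -/
lemma gaussBinom_mul (p : ℂ) (k l : ℕ) : gaussBinom p (k + l) k *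
    ((∏ j ∈ Finset.range k, (1 - p * p ^ j)) * ∏ j ∈ Finset.range l, (1 - p * p ^ j)) =
      ∏ j ∈ Finset.range (k + l), (1 - p * p ^ j) := by
  induction h : k + l generalizing k l with
  | zero =>
    obtain ⟨rfl, rfl⟩ : k = 0 ∧ l = 0 := by omega
    simp [gaussBinom]
  | succ M ih =>
    obtain _ | k := k
    · obtain rfl : l = M + 1 := by omega
      simp [gaussBinom_zero_right]
    have e1 := ih k l (by omega)
    rw [gaussBinom, Finset.prod_range_succ _ k, Finset.prod_range_succ _ M]
    obtain _ | l := l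
    · rw [gaussBinom_eq_zero p (show M < k + 1 by omega)]
      obtain rfl : k = M := by omega
      simp only [Finset.range_zero, Finset.prod_empty, mul_one] at e1 ⊢
      linear_combination (1 - p * p ^ k) * e1
    · have e2 := ih (k + 1) l (by omega)
      rw [Finset.prod_range_succ _ k] at e2
      rw [Finset.prod_range_succ _ l] at e1 ⊢
      obtain rfl : M = k + l + 1 := by omega
      linear_combination (1 - p * p ^ k) * e1 + p ^ (k + 1) * (1 - p * p ^ l) * e2

/-- The finite q-binomial theorem. With p = r² the exponent k(k - 1)/2 of p becomes the integral
exponent k(k - 1) of r. -/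
lemma prod_one_sub_eq_sum {r : ℂ} (hr : r ≠ 0) (M : ℕ) : ∀ x : ℂ,
    ∏ j ∈ Finset.range M, (1 - x * (r ^ 2) ^ j) = ∑ k ∈ Finset.range (M + 1),
      (-1) ^ k * r ^ ((k : ℤ) * (k - 1)) * gaussBinom (r ^ 2) M k * x ^ k := by
  induction M with
  | zero => intro x; simp [gaussBinom]
  | succ M ih =>
    intro x
    have e : ∀ j : ℕ, 1 - x * (r ^ 2) ^ (j + 1) = 1 - x * r ^ 2 * (r ^ 2) ^ j := fun j => by ring
    have step : ∀ k : ℕ, (-1) ^ (k + 1) * r ^ (((k + 1 : ℕ) : ℤ) * ((k + 1 : ℕ) - 1)) *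
        gaussBinom (r ^ 2) (M + 1) (k + 1) * x ^ (k + 1) =
        (-1) ^ (k + 1) * r ^ (((k + 1 : ℕ) : ℤ) * ((k + 1 : ℕ) - 1)) *
          gaussBinom (r ^ 2) M (k + 1) * (x * r ^ 2) ^ (k + 1) -
        x * ((-1) ^ k * r ^ ((k : ℤ) * (k - 1)) * gaussBinom (r ^ 2) M k * (x * r ^ 2) ^ k) := by
      intro k
      have : r ^ (((k + 1 : ℕ) : ℤ) * ((k + 1 : ℕ) - 1)) =
          r ^ ((k : ℤ) * (k - 1)) * (r ^ 2) ^ k := by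
        rw [← pow_mul, ← zpow_natCast r (2 * k), ← zpow_add₀ hr]
        congr 1; push_cast; ring
      rw [gaussBinom, this]
      ring
    rw [Finset.prod_range_succ', Finset.prod_congr rfl fun j _ => e j, ih,
      Finset.sum_range_succ' _ (M + 1), Finset.sum_congr rfl fun k _ => step k,
      Finset.sum_sub_distrib, ← Finset.mul_sum, sub_add_eq_add_sub]
    have := Finset.sum_range_succ' (fun k : ℕ => (-1) ^ k * r ^ ((k : ℤ) * (k - 1)) *
      gaussBinom (r ^ 2) M k * (x * r ^ 2) ^ k) (M + 1)
    rw [Finset.sum_range_succ, gaussBinom_eq_zero _ (Nat.lt_succ_self M)] at this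
    simp only [gaussBinom_zero_right, Nat.cast_zero, pow_zero, mul_one, zero_mul, mul_zero,
      add_zero, zpow_zero] at this ⊢
    rw [← this]
    ring

/-- A finite triple product: the q-binomial theorem with 2N factors at x p^{-N}, whose first N
factors are reversed into those of p/x. -/
lemma prod_mul_prod_eq_sum {r x : ℂ} (hr : r ≠ 0) (hx : x ≠ 0) (N : ℕ) :
    (∏ j ∈ Finset.range N, (1 - x * (r ^ 2) ^ j)) *
      ∏ j ∈ Finset.range N, (1 - r ^ 2 / x * (r ^ 2) ^ j) =
    ∑ k ∈ Finset.range (2 * N + 1), (-1) ^ ((k : ℤ) - N) *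
      r ^ (((k : ℤ) - N) * ((k : ℤ) - N - 1)) * gaussBinom (r ^ 2) (2 * N) k *
        x ^ ((k : ℤ) - N) := by
  have h1 : ∏ j ∈ Finset.range N, (1 - r ^ 2 / x * (r ^ 2) ^ j) =
      (∏ j ∈ Finset.range N, (1 - x * ((r ^ 2) ^ N)⁻¹ * (r ^ 2) ^ j)) *
        ((-1) ^ N * x ^ (-N : ℤ) * r ^ ((N : ℤ) * (N + 1))) := by
    have h2 : (-1) ^ N * x ^ (-N : ℤ) * r ^ ((N : ℤ) * (N + 1)) =
        ∏ j ∈ Finset.range N, (-x⁻¹ * (r ^ 2) ^ (j + 1)) := by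
      induction N with
      | zero => simp
      | succ N ih =>
        rw [Finset.prod_range_succ, ← ih, show (-(N + 1 : ℕ) : ℤ) = -N + -1 by push_cast; ring,
          zpow_add₀ hx, show ((N + 1 : ℕ) : ℤ) * ((N + 1 : ℕ) + 1) = N * (N + 1) + (2 * (N + 1) : ℕ) by
            push_cast; ring, zpow_add₀ hr, zpow_natCast, pow_mul, zpow_neg_one]
        ring
    have h3 : ∏ j ∈ Finset.range N, (1 - x * ((r ^ 2) ^ N)⁻¹ * (r ^ 2) ^ j) =
        ∏ j ∈ Finset.range N, (1 - x * ((r ^ 2) ^ (j + 1))⁻¹) := by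
      rw [← Finset.prod_range_reflect]
      refine Finset.prod_congr rfl fun j hj => ?_
      obtain ⟨i, rfl⟩ : ∃ i, N = i + j + 1 :=
        ⟨N - 1 - j, by have := Finset.mem_range.1 hj; omega⟩
      rw [show i + j + 1 - 1 - j = i by omega]
      field_simp
      ring
    rw [h2, h3, ← Finset.prod_mul_distrib]
    refine Finset.prod_congr rfl fun j _ => ?_
    field_simp
    ring
  have h3 := prod_one_sub_eq_sum hr (2 * N) (x * ((r ^ 2) ^ N)⁻¹)
  rw [two_mul, Finset.prod_range_add, ← two_mul] at h3
  have h4 : ∏ j ∈ Finset.range N, (1 - x * ((r ^ 2) ^ N)⁻¹ * (r ^ 2) ^ (N + j)) =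
      ∏ j ∈ Finset.range N, (1 - x * (r ^ 2) ^ j) := by
    refine Finset.prod_congr rfl fun j _ => ?_
    rw [pow_add]; field_simp
  rw [h4] at h3
  rw [h1, ← mul_assoc, mul_comm (∏ j ∈ Finset.range N, (1 - x * (r ^ 2) ^ j)), h3, Finset.sum_mul]
  refine Finset.sum_congr rfl fun k _ => ?_
  have e1 : r ^ (((k : ℤ) - N) * ((k : ℤ) - N - 1)) =
      r ^ ((k : ℤ) * (k - 1)) * r ^ ((N : ℤ) * (N + 1)) * (((r ^ 2) ^ N)⁻¹) ^ k := by
    rw [← pow_mul, ← zpow_natCast r (2 * N), ← zpow_neg, ← zpow_natCast _ k, ← zpow_mul,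
      ← zpow_add₀ hr, ← zpow_add₀ hr]
    congr 1; push_cast; ring
  have e2 : ((-1 : ℂ)) ^ ((k : ℤ) - N) = (-1) ^ k * (-1) ^ N := by
    rw [zpow_sub₀ (by simp), zpow_natCast, zpow_natCast]
    rcases neg_one_pow_eq_or ℂ N with h | h <;> rw [h] <;> simp [div_neg]
  have e3 : x ^ ((k : ℤ) - N) = x ^ k * x ^ (-N : ℤ) := by
    rw [sub_eq_add_neg, zpow_add₀ hx, zpow_natCast]
  rw [e1, e2, e3, mul_pow]
  ring

/-- The theta series `∑ (-1)^n p^{n(n-1)/2} x^n`, with `p = r²`. -/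
noncomputable def thetaSeries (r x : ℂ) : ℂ := ∑' n : ℤ, (-1) ^ n * r ^ (n * (n - 1)) * x ^ n

/-- These are the terms of the Jacobi theta series with τ = log r / (πi) and z = log y / (2πi); Im τ
> 0 because |r| < 1. -/
lemma summable_zpow_sq_mul {r y : ℂ} (hr : r ≠ 0) (hr1 : ‖r‖ < 1) (hy : y ≠ 0) :
    Summable fun n : ℤ => ‖r ^ (n ^ 2) * y ^ n‖ := by
  have hI : (Real.pi : ℂ) * Complex.I ≠ 0 := by simp [Real.pi_ne_zero]
  have him : 0 < (Complex.log r / (Real.pi * Complex.I)).im := by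
    have : Complex.log r / (Real.pi * Complex.I) = -(Complex.I * Complex.log r) / Real.pi := by
      field_simp; rw [Complex.I_sq]; ring
    rw [this, Complex.div_ofReal_im, Complex.neg_im, Complex.I_mul_im, Complex.log_re]
    exact div_pos (neg_pos.2 (Real.log_neg (norm_pos_iff.2 hr) hr1)) Real.pi_pos
  have := ((summable_jacobiTheta₂_term_iff (Complex.log y / (2 * Real.pi * Complex.I)) _).2 him).norm
  refine this.congr fun n => ?_
  rw [jacobiTheta₂_term, Complex.exp_add, mul_comm, show 2 * (Real.pi : ℂ) * Complex.I * n *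
      (Complex.log y / (2 * Real.pi * Complex.I)) = n * Complex.log y by field_simp,
    show (Real.pi : ℂ) * Complex.I * n ^ 2 * (Complex.log r / (Real.pi * Complex.I)) =
      (n ^ 2 : ℤ) * Complex.log r by push_cast; field_simp,
    Complex.exp_int_mul, Complex.exp_int_mul, Complex.exp_log hr, Complex.exp_log hy]

lemma summable_thetaSeries {r x : ℂ} (hr : r ≠ 0) (hr1 : ‖r‖ < 1) (hx : x ≠ 0) :
    Summable fun n : ℤ => ‖(-1) ^ n * r ^ (n * (n - 1)) * x ^ n‖ := by
  refine (summable_zpow_sq_mul hr hr1 (div_ne_zero hx hr)).congr fun n => ?_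
  rw [show n * (n - 1) = n ^ 2 - n by ring, zpow_sub₀ hr, div_zpow, norm_mul, norm_mul, norm_mul]
  simp
  ring

/-- The Jacobi triple product identity. -/
theorem ellE_eq_thetaSeries {r x : ℂ} (hr : r ≠ 0) (hr1 : ‖r‖ < 1) (hx : x ≠ 0) :
    ellE x (r ^ 2) = (qPochInf (r ^ 2) (r ^ 2))⁻¹ * thetaSeries r x := by
  have hp : ‖r ^ 2‖ < 1 := by
    rw [norm_pow]; exact pow_lt_one₀ (norm_nonneg _) hr1 (by norm_num)
  have hfac : ∀ j : ℕ, 1 - r ^ 2 * (r ^ 2) ^ j ≠ 0 := fun j h => by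
    have h1 : ‖r ^ 2‖ ^ (j + 1) < 1 := pow_lt_one₀ (norm_nonneg _) hp (by simp)
    rw [← norm_pow, pow_succ', ← sub_eq_zero.1 h, norm_one] at h1
    exact lt_irrefl _ h1
  have hP : qPochInf (r ^ 2) (r ^ 2) ≠ 0 :=
    qPochInf_ne_zero hp fun k h => hfac k (sub_eq_zero.2 h.symm)
  set φ : ℕ → ℂ := fun M => ∏ j ∈ Finset.range M, (1 - r ^ 2 * (r ^ 2) ^ j) with hφ
  have hφ0 : ∀ M, φ M ≠ 0 := fun M => Finset.prod_ne_zero_iff.2 fun j _ => hfac j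
  have hφt : Tendsto φ atTop (𝓝 (qPochInf (r ^ 2) (r ^ 2))) := tendsto_qPochInf hp _
  obtain ⟨B, hB⟩ := hφt.norm.bddAbove_range
  obtain ⟨B', hB'⟩ := (hφt.inv₀ hP).norm.bddAbove_range
  have hB : ∀ M, ‖φ M‖ ≤ B := fun M => hB ⟨M, rfl⟩
  have hB' : ∀ M, ‖(φ M)⁻¹‖ ≤ B' := fun M => hB' ⟨M, rfl⟩
  have hB0 : 0 ≤ B := (norm_nonneg _).trans (hB 0)
  have hB'0 : 0 ≤ B' := (norm_nonneg _).trans (hB' 0)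
  have hg : ∀ k l, gaussBinom (r ^ 2) (k + l) k = φ (k + l) * ((φ k)⁻¹ * (φ l)⁻¹) := fun k l => by
    rw [← mul_inv, eq_mul_inv_iff_mul_eq₀ (mul_ne_zero (hφ0 k) (hφ0 l))]
    exact gaussBinom_mul _ k l
  have hgB : ∀ M k, ‖gaussBinom (r ^ 2) M k‖ ≤ B * (B' * B') := fun M k => by
    rcases lt_or_ge M k with h | h
    · rw [gaussBinom_eq_zero _ h, norm_zero]; positivity
    · obtain ⟨l, rfl⟩ := Nat.exists_eq_add_of_le h
      rw [hg, norm_mul, norm_mul]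
      gcongr
      · exact hB _
      · exact hB' _
      · exact hB' _
  -- The finite sums extended to ℤ by zero. The guard is needed because `toNat` sends a negative n +
  -- N to 0, where the Gaussian binomial is 1.
  set F : ℕ → ℤ → ℂ := fun N n => if 0 ≤ n + N then
    (-1) ^ n * r ^ (n * (n - 1)) * gaussBinom (r ^ 2) (2 * N) (n + N).toNat * x ^ n else 0 with hF
  have hsum : ∀ N, ∑' n, F N n = (∏ j ∈ Finset.range N, (1 - x * (r ^ 2) ^ j)) *
      ∏ j ∈ Finset.range N, (1 - r ^ 2 / x * (r ^ 2) ^ j) := fun N => by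
    rw [prod_mul_prod_eq_sum hr hx, tsum_eq_sum (s := Finset.Icc (-N : ℤ) N)]
    · refine Finset.sum_nbij' (fun n => (n + N).toNat) (fun k => (k : ℤ) - N) ?_ ?_ ?_ ?_ ?_
      · intro n hn; have := Finset.mem_Icc.1 hn; simp only [Finset.mem_range]; omega
      · intro k hk; have := Finset.mem_range.1 hk; simp only [Finset.mem_Icc]; omega
      · intro n hn; have := Finset.mem_Icc.1 hn; omega
      · intro k hk; omega
      · intro n hn
        have := Finset.mem_Icc.1 hn
        have h0 : 0 ≤ n + N := by omega
        simp only [hF, if_pos h0]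
        rw [show ((n + N).toNat : ℤ) - N = n by omega]
    · intro n hn
      rw [Finset.mem_Icc] at hn
      simp only [hF]
      split_ifs with h0
      · rw [gaussBinom_eq_zero _ (by omega)]; simp
      · rfl
  -- Dominated convergence: the Gaussian binomials are bounded uniformly, and each tends to
  -- 1/(p;p)_∞.
  have hlim : Tendsto (fun N => ∑' n, F N n) atTop
      (𝓝 (∑' n : ℤ, (qPochInf (r ^ 2) (r ^ 2))⁻¹ * ((-1) ^ n * r ^ (n * (n - 1)) * x ^ n))) := by
    refine tendsto_tsum_of_dominated_convergence
      (bound := fun n => B * (B' * B') * ‖(-1) ^ n * r ^ (n * (n - 1)) * x ^ n‖)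
      ((summable_thetaSeries hr hr1 hx).mul_left _) ?_ (Eventually.of_forall ?_)
    · intro n
      have h1 : Tendsto (fun N : ℕ => φ (2 * N) * ((φ (n + N).toNat)⁻¹ * (φ (N - n).toNat)⁻¹))
          atTop (𝓝 (qPochInf (r ^ 2) (r ^ 2) * ((qPochInf (r ^ 2) (r ^ 2))⁻¹ *
            (qPochInf (r ^ 2) (r ^ 2))⁻¹))) := by
        refine (hφt.comp ?_).mul (((hφt.inv₀ hP).comp (f := fun N : ℕ => (n + N).toNat) ?_).mul
          ((hφt.inv₀ hP).comp (f := fun N : ℕ => (N - n).toNat) ?_))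
        · exact tendsto_atTop.2 fun b => eventually_atTop.2 ⟨b, fun N hN => by omega⟩
        · exact tendsto_atTop.2 fun b => eventually_atTop.2
            ⟨b + n.natAbs, fun N hN => by omega⟩
        · exact tendsto_atTop.2 fun b => eventually_atTop.2
            ⟨b + n.natAbs, fun N hN => by omega⟩
      rw [mul_inv_cancel_left₀ hP] at h1
      refine (h1.mul_const ((-1) ^ n * r ^ (n * (n - 1)) * x ^ n)).congr' ?_
      filter_upwards [eventually_ge_atTop n.natAbs] with N hN
      have h0 : 0 ≤ n + N := by omega
      simp only [hF, if_pos h0]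
      rw [show 2 * N = (n + N).toNat + (N - n).toNat by omega, hg]
      ring
    · intro N n
      simp only [hF]
      split_ifs with h0
      · rw [show (-1) ^ n * r ^ (n * (n - 1)) * gaussBinom (r ^ 2) (2 * N) (n + N).toNat * x ^ n =
          gaussBinom (r ^ 2) (2 * N) (n + N).toNat * ((-1) ^ n * r ^ (n * (n - 1)) * x ^ n) by ring,
          norm_mul]
        gcongr
        exact hgB _ _
      · rw [norm_zero]; positivity
  simp only [hsum] at hlim
  rw [tsum_mul_left] at hlim
  exact tendsto_nhds_unique ((tendsto_qPochInf hp x).mul (tendsto_qPochInf hp (r ^ 2 / x))) hlim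

/-- The series `∑ p^{n²} x^{2n}`, with `p = r²`. -/
noncomputable def thetaEven (r x : ℂ) : ℂ := ∑' n : ℤ, r ^ (2 * n ^ 2) * x ^ (2 * n)

/-- The series `∑ p^{n²+n} x^{2n+1}`, with `p = r²`. -/
noncomputable def thetaOdd (r x : ℂ) : ℂ := ∑' n : ℤ, r ^ (2 * n ^ 2 + 2 * n) * x ^ (2 * n + 1)

lemma summable_thetaEven {r x : ℂ} (hr : r ≠ 0) (hr1 : ‖r‖ < 1) (hx : x ≠ 0) :
    Summable fun n : ℤ => ‖r ^ (2 * n ^ 2) * x ^ (2 * n)‖ := by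
  have hp : ‖r ^ 2‖ < 1 := by
    rw [norm_pow]; exact pow_lt_one₀ (norm_nonneg _) hr1 (by norm_num)
  refine (summable_zpow_sq_mul (pow_ne_zero 2 hr) hp (pow_ne_zero 2 hx)).congr fun n => ?_
  rw [zpow_mul, zpow_mul]
  norm_cast

lemma summable_thetaOdd {r x : ℂ} (hr : r ≠ 0) (hr1 : ‖r‖ < 1) (hx : x ≠ 0) :
    Summable fun n : ℤ => ‖r ^ (2 * n ^ 2 + 2 * n) * x ^ (2 * n + 1)‖ := by
  refine ((summable_thetaEven hr hr1 (mul_ne_zero hx hr)).mul_right ‖x‖).congr fun n => ?_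
  rw [← norm_mul, mul_zpow, zpow_add₀ hr, zpow_add₀ hx, zpow_one]
  congr 1; ring

/-- The bijection `ℤ² ⊔ ℤ² ≃ ℤ²` that separates the pairs `(m, n)` by the parity of `m + n`. -/
noncomputable def parityEquiv : (ℤ × ℤ) ⊕ (ℤ × ℤ) ≃ ℤ × ℤ :=
  Equiv.ofBijective (Sum.elim (fun z => (z.1 + z.2, z.1 - z.2))
    fun z => (z.1 + z.2 + 1, z.1 - z.2)) (by
    constructor
    · rintro (⟨a, b⟩ | ⟨a, b⟩) (⟨c, d⟩ | ⟨c, d⟩) h <;>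
        simp only [Sum.elim_inl, Sum.elim_inr, Prod.mk.injEq, Sum.inl.injEq, Sum.inr.injEq,
          reduceCtorEq] at h ⊢ <;> omega
    · rintro ⟨m, n⟩
      rcases Int.even_or_odd' (m + n) with ⟨i, hi | hi⟩
      · exact ⟨Sum.inl (i, m - i), by ext <;> simp only [Sum.elim_inl] <;> omega⟩
      · exact ⟨Sum.inr (i, m - i - 1), by ext <;> simp only [Sum.elim_inr] <;> omega⟩)

/-- The double series is split by the parity of m + n. Each half separates into a series in x times
a series in y, so the product is a 2×2 determinant. -/
lemma thetaSeries_mul {r x y : ℂ} (hr : r ≠ 0) (hr1 : ‖r‖ < 1) (hx : x ≠ 0) (hy : y ≠ 0) :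
    thetaSeries r (x * y) * thetaSeries r (x / y) =
      x * (thetaOdd r x * thetaEven r y - thetaEven r x * thetaOdd r y) := by
  have s1 := summable_thetaSeries hr hr1 (mul_ne_zero hx hy)
  have s2 := summable_thetaSeries hr hr1 (div_ne_zero hx hy)
  have ex := summable_thetaEven hr hr1 hx
  have ey := summable_thetaEven hr hr1 hy
  have ox := summable_thetaOdd hr hr1 hx
  have oy := summable_thetaOdd hr hr1 hy
  have shift : thetaOdd r x = ∑' n : ℤ, r ^ (2 * n ^ 2 - 2 * n) * x ^ (2 * n - 1) := by
    rw [thetaOdd, ← (Equiv.addRight (1 : ℤ)).tsum_eq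
      fun n : ℤ => r ^ (2 * n ^ 2 - 2 * n) * x ^ (2 * n - 1)]
    refine tsum_congr fun n => ?_
    simp only [Equiv.coe_addRight]
    congr 2 <;> ring
  have ox' : Summable fun n : ℤ => ‖r ^ (2 * n ^ 2 - 2 * n) * x ^ (2 * n - 1)‖ := by
    rw [← (Equiv.addRight (1 : ℤ)).summable_iff]
    refine ox.congr fun n => ?_
    simp only [Function.comp, Equiv.coe_addRight]
    congr 3 <;> ring
  rw [thetaSeries, thetaSeries, tsum_mul_tsum_of_summable_norm s1 s2, ← parityEquiv.tsum_eq]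
  have hinl : ∀ z : ℤ × ℤ, (-1) ^ (z.1 + z.2) * r ^ ((z.1 + z.2) * (z.1 + z.2 - 1)) *
      (x * y) ^ (z.1 + z.2) * ((-1) ^ (z.1 - z.2) * r ^ ((z.1 - z.2) * (z.1 - z.2 - 1)) *
        (x / y) ^ (z.1 - z.2)) = x * (r ^ (2 * z.1 ^ 2 - 2 * z.1) * x ^ (2 * z.1 - 1) *
          (r ^ (2 * z.2 ^ 2) * y ^ (2 * z.2))) := fun z => by
    have e1 : ((-1 : ℂ)) ^ (z.1 + z.2) * (-1) ^ (z.1 - z.2) = 1 := by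
      rw [← zpow_add₀ (by simp), show z.1 + z.2 + (z.1 - z.2) = 2 * z.1 by ring, zpow_mul]; simp
    have e2 : r ^ ((z.1 + z.2) * (z.1 + z.2 - 1)) * r ^ ((z.1 - z.2) * (z.1 - z.2 - 1)) =
        r ^ (2 * z.1 ^ 2 - 2 * z.1) * r ^ (2 * z.2 ^ 2) := by
      rw [← zpow_add₀ hr, ← zpow_add₀ hr]; congr 1; ring
    have e3 : x ^ (z.1 + z.2) * x ^ (z.1 - z.2) = x * x ^ (2 * z.1 - 1) := by
      rw [← zpow_add₀ hx, ← zpow_one_add₀ hx]; congr 1; ring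
    have e4 : y ^ (z.1 + z.2) / y ^ (z.1 - z.2) = y ^ (2 * z.2) := by
      rw [← zpow_sub₀ hy]; congr 1; ring
    rw [mul_zpow, div_zpow, ← e4]
    linear_combination (r ^ (2 * z.1 ^ 2 - 2 * z.1) * r ^ (2 * z.2 ^ 2) *
        (y ^ (z.1 + z.2) / y ^ (z.1 - z.2))) * e3 +
      (x ^ (z.1 + z.2) * x ^ (z.1 - z.2) * (y ^ (z.1 + z.2) / y ^ (z.1 - z.2))) * e2 +
      (r ^ ((z.1 + z.2) * (z.1 + z.2 - 1)) * r ^ ((z.1 - z.2) * (z.1 - z.2 - 1)) *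
        (x ^ (z.1 + z.2) * x ^ (z.1 - z.2) * (y ^ (z.1 + z.2) / y ^ (z.1 - z.2)))) * e1
  have hinr : ∀ z : ℤ × ℤ, (-1) ^ (z.1 + z.2 + 1) * r ^ ((z.1 + z.2 + 1) * (z.1 + z.2 + 1 - 1)) *
      (x * y) ^ (z.1 + z.2 + 1) * ((-1) ^ (z.1 - z.2) * r ^ ((z.1 - z.2) * (z.1 - z.2 - 1)) *
        (x / y) ^ (z.1 - z.2)) = -x * (r ^ (2 * z.1 ^ 2) * x ^ (2 * z.1) *
          (r ^ (2 * z.2 ^ 2 + 2 * z.2) * y ^ (2 * z.2 + 1))) := fun z => by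
    have e1 : ((-1 : ℂ)) ^ (z.1 + z.2 + 1) * (-1) ^ (z.1 - z.2) = -1 := by
      rw [← zpow_add₀ (by simp), show z.1 + z.2 + 1 + (z.1 - z.2) = 2 * z.1 + 1 by ring,
        zpow_add₀ (by simp), zpow_mul]; simp
    have e2 : r ^ ((z.1 + z.2 + 1) * (z.1 + z.2 + 1 - 1)) * r ^ ((z.1 - z.2) * (z.1 - z.2 - 1)) =
        r ^ (2 * z.1 ^ 2) * r ^ (2 * z.2 ^ 2 + 2 * z.2) := by
      rw [← zpow_add₀ hr, ← zpow_add₀ hr]; congr 1; ring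
    have e3 : x ^ (z.1 + z.2 + 1) * x ^ (z.1 - z.2) = x * x ^ (2 * z.1) := by
      rw [← zpow_add₀ hx, ← zpow_one_add₀ hx]; congr 1; ring
    have e4 : y ^ (z.1 + z.2 + 1) / y ^ (z.1 - z.2) = y ^ (2 * z.2 + 1) := by
      rw [← zpow_sub₀ hy]; congr 1; ring
    rw [mul_zpow, div_zpow, ← e4]
    linear_combination (-(r ^ (2 * z.1 ^ 2) * r ^ (2 * z.2 ^ 2 + 2 * z.2) *
        (y ^ (z.1 + z.2 + 1) / y ^ (z.1 - z.2)))) * e3 -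
      (x ^ (z.1 + z.2 + 1) * x ^ (z.1 - z.2) * (y ^ (z.1 + z.2 + 1) / y ^ (z.1 - z.2))) * e2 +
      (r ^ ((z.1 + z.2 + 1) * (z.1 + z.2 + 1 - 1)) * r ^ ((z.1 - z.2) * (z.1 - z.2 - 1)) *
        (x ^ (z.1 + z.2 + 1) * x ^ (z.1 - z.2) * (y ^ (z.1 + z.2 + 1) / y ^ (z.1 - z.2)))) * e1
  have t1 := (summable_mul_of_summable_norm ox' ey).mul_left x
  have t2 := (summable_mul_of_summable_norm ex oy).mul_left (-x)
  have key := (HasSum.sum (f := fun s => (fun z : ℤ × ℤ => (-1) ^ z.1 * r ^ (z.1 * (z.1 - 1)) *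
    (x * y) ^ z.1 * ((-1) ^ z.2 * r ^ (z.2 * (z.2 - 1)) * (x / y) ^ z.2)) (parityEquiv s))
    (t1.hasSum.congr_fun ?_) (t2.hasSum.congr_fun ?_)).tsum_eq
  · rw [key, tsum_mul_left, tsum_mul_left, ← tsum_mul_tsum_of_summable_norm ox' ey,
      ← tsum_mul_tsum_of_summable_norm ex oy, ← shift, thetaEven, thetaEven, thetaOdd, thetaOdd]
    ring
  exacts [fun z => hinl z, fun z => hinr z]

lemma qPochInf_eq_mul {p : ℂ} (hp : ‖p‖ < 1) (x : ℂ) :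
    qPochInf x p = (1 - x) * qPochInf (x * p) p := by
  refine tendsto_nhds_unique ((tendsto_qPochInf hp x).comp (tendsto_add_atTop_nat 1)) ?_
  refine ((tendsto_qPochInf hp (x * p)).const_mul (1 - x)).congr fun N => ?_
  rw [Function.comp_apply, Finset.prod_range_succ', mul_comm]
  congr 1
  · refine Finset.prod_congr rfl fun j _ => ?_
    ring
  · simp

lemma ellE_inv {p w : ℂ} (hp : ‖p‖ < 1) (hw : w ≠ 0) : ellE w⁻¹ p = -w⁻¹ * ellE w p := by
  rw [ellE, ellE, qPochInf_eq_mul hp w, qPochInf_eq_mul hp w⁻¹, div_inv_eq_mul, mul_comm p w,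
    div_eq_mul_inv, mul_comm p w⁻¹]
  field_simp
  ring

/-- The sigma function that corresponds to `ellE`. -/
noncomputable def ellSigma (p z : ℂ) : ℂ := Complex.exp (-z / 2) * ellE (Complex.exp z) p

theorem isSigmaLike_ellSigma {p : ℂ} (hp0 : p ≠ 0) (hp : ‖p‖ < 1) : IsSigmaLike (ellSigma p) := by
  obtain ⟨r, rfl⟩ : ∃ r : ℂ, p = r ^ 2 := by
    obtain ⟨r, hr⟩ := IsAlgClosed.exists_pow_nat_eq p (n := 2) (by norm_num)
    exact ⟨r, hr.symm⟩
  have hr : r ≠ 0 := fun h => hp0 (by simp [h])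
  have hr1 : ‖r‖ < 1 := by
    rw [norm_pow] at hp
    exact lt_of_not_ge fun h => absurd hp (not_lt.2 (one_le_pow₀ h))
  have hpair : ∀ x y, ellSigma (r ^ 2) (x + y) * ellSigma (r ^ 2) (x - y) =
      (qPochInf (r ^ 2) (r ^ 2))⁻¹ ^ 2 *
        (thetaOdd r (Complex.exp x) * thetaEven r (Complex.exp y) -
          thetaEven r (Complex.exp x) * thetaOdd r (Complex.exp y)) := fun x y => by
    have h1 := thetaSeries_mul hr hr1 (Complex.exp_ne_zero x) (Complex.exp_ne_zero y)
    have h2 : Complex.exp (-(x + y) / 2) * Complex.exp (-(x - y) / 2) * Complex.exp x = 1 := by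
      rw [← Complex.exp_add, ← Complex.exp_add, ← Complex.exp_zero]; congr 1; ring
    rw [ellSigma, ellSigma, Complex.exp_add, Complex.exp_sub,
      ellE_eq_thetaSeries hr hr1 (mul_ne_zero (Complex.exp_ne_zero _) (Complex.exp_ne_zero _)),
      ellE_eq_thetaSeries hr hr1 (div_ne_zero (Complex.exp_ne_zero _) (Complex.exp_ne_zero _))]
    linear_combination (Complex.exp (-(x + y) / 2) * Complex.exp (-(x - y) / 2) *
      (qPochInf (r ^ 2) (r ^ 2))⁻¹ ^ 2) * h1 + ((qPochInf (r ^ 2) (r ^ 2))⁻¹ ^ 2 *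
        (thetaOdd r (Complex.exp x) * thetaEven r (Complex.exp y) -
          thetaEven r (Complex.exp x) * thetaOdd r (Complex.exp y))) * h2
  refine ⟨fun z => ?_, fun x y u v => ?_⟩
  · have h2 : Complex.exp (-(-z) / 2) * (Complex.exp z)⁻¹ = Complex.exp (-z / 2) := by
      rw [← Complex.exp_neg, ← Complex.exp_add]; congr 1; ring
    rw [ellSigma, ellSigma, Complex.exp_neg, ellE_inv hp (Complex.exp_ne_zero z), ← h2]
    ring
  -- The Plücker relation for 2×2 determinants.
  · rw [hpair, hpair, hpair, hpair, hpair, hpair]; ring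

end Theta

/-! ### Dictionary between the multiplicative and the additive notation. -/

section Exponential

lemma ellE_one {p : ℂ} (hp : ‖p‖ < 1) : ellE 1 p = 0 := by
  rw [ellE, qPochInf_eq_mul hp 1]; simp

lemma ellE_ne_zero {p x : ℂ} (hp0 : p ≠ 0) (hp : ‖p‖ < 1) (hx0 : x ≠ 0)
    (hx : ∀ j : ℤ, x ≠ p ^ j) : ellE x p ≠ 0 := by
  refine mul_ne_zero (qPochInf_ne_zero hp fun k h => hx (-k) ?_)
    (qPochInf_ne_zero hp fun k h => hx (k + 1) ?_)
  · rw [zpow_neg, zpow_natCast]; exact eq_inv_of_mul_eq_one_left h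
  · rw [zpow_add_one₀ hp0, zpow_natCast]
    field_simp at h
    rw [← h, mul_comm]

lemma ellE_exp (p z : ℂ) : ellE (Complex.exp z) p = Complex.exp (z / 2) * ellSigma p z := by
  rw [ellSigma, ← mul_assoc, ← Complex.exp_add]
  ring_nf
  simp

lemma ellE_eq_exp_mul {p x z : ℂ} (hx : x = Complex.exp z) :
    ellE x p = Complex.exp (z / 2) * ellSigma p z := by rw [hx, ellE_exp]

lemma ellPoch_eq_exp_mul {p q x z h : ℂ} (hx : x = Complex.exp z) (hq : q = Complex.exp h)
    (k : ℕ) : ellPoch x q p k =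
      Complex.exp (k * z / 2 + k * (k - 1) * h / 4) * shiftProd (ellSigma p) z h k := by
  subst hx hq
  induction k with
  | zero => simp [ellPoch]
  | succ k ih =>
    rw [ellPoch, Finset.prod_range_succ, ← ellPoch, ih, shiftProd_succ, ← Complex.exp_nat_mul,
      ← Complex.exp_add, ellE_exp, mul_mul_mul_comm, ← Complex.exp_add]
    congr 2
    push_cast; ring

/-- The points `q^i p^j`. -/
def ellLattice (p q : ℂ) : Set ℂ := Set.range fun z : ℤ × ℤ => q ^ z.1 * p ^ z.2

lemma avoidsZeros_ellSigma {p z h : ℂ} (hp0 : p ≠ 0) (hp : ‖p‖ < 1)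
    (hz : Complex.exp z ∉ ellLattice p (Complex.exp h)) : AvoidsZeros (ellSigma p) z h := fun j => by
  refine mul_ne_zero (Complex.exp_ne_zero _) (ellE_ne_zero hp0 hp (Complex.exp_ne_zero _)
    fun i hi => hz ⟨(-j, i), ?_⟩)
  simp only
  rw [← hi, Complex.exp_add, Complex.exp_int_mul, zpow_neg, mul_comm (Complex.exp z),
    inv_mul_cancel_left₀ (zpow_ne_zero _ (Complex.exp_ne_zero _))]

lemma ellSigma_int_mul_ne_zero {p h : ℂ} (hp0 : p ≠ 0) (hp : ‖p‖ < 1)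
    (hpq : ∀ i j : ℤ, Complex.exp h ^ i = p ^ j → i = 0) (j : ℤ) (hj : j ≠ 0) :
    ellSigma p (j * h) ≠ 0 := by
  refine mul_ne_zero (Complex.exp_ne_zero _) (ellE_ne_zero hp0 hp (Complex.exp_ne_zero _)
    fun i hi => hj (hpq j i ?_))
  rw [← hi, Complex.exp_int_mul]

end Exponential

/-! ### Both sides of the theorem, and termination of the series. -/

section GenericTransformation

/-- The left-hand side of the quadratic transformation. -/
noncomputable def transLhs (q : ℂ) (n : ℕ) (p a b c d e f : ℂ) : ℂ :=
  ∑ k ∈ Finset.range (n + 1),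
    ellE (a * q ^ (3 * k)) p / ellE a p *
      (ellPochs [b, c, d] (q ^ 2) p k / ellPochs [a * q / b, a * q / c, a * q / d] q p k) *
      (ellPochs [e, f, q ^ (-(n : ℤ))] q p k /
        ellPochs [a * q ^ 2 / e, a * q ^ 2 / f, a * q ^ (n + 2)] (q ^ 2) p k) * q ^ k

/-- The product on the right-hand side of the quadratic transformation. -/
noncomputable def transPrefactor (q : ℂ) (n : ℕ) (p a b c : ℂ) : ℂ :=
  (ellPochs [a * q, a * q / (b * c)] q p n *
      ellPochs [a * q ^ (1 - (n : ℤ)) / b, a * q ^ (1 - (n : ℤ)) / c] (q ^ 2) p n) /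
    (ellPochs [a * q / b, a * q / c] q p n *
      ellPochs [a * q ^ (1 - (n : ℤ)), a * q ^ (1 - (n : ℤ)) / (b * c)] (q ^ 2) p n)

/-- The terms of the series on the right-hand side of the quadratic transformation. -/
noncomputable def transOmegaTerm (q : ℂ) (n : ℕ) (p a b c d e f : ℂ) (k : ℕ) : ℂ :=
  ellE (a ^ 2 / (e * f) * (q ^ 2) ^ (2 * k)) p / ellE (a ^ 2 / (e * f)) p *
    (ellPochs [a ^ 2 / (e * f), b, c, d, a / e, a / f, q ^ (1 - (n : ℤ)), q ^ (-(n : ℤ))]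
        (q ^ 2) p k * (q ^ 2) ^ k /
      ellOmegaDen (a ^ 2 / (e * f)) [b, c, d, a / e, a / f, q ^ (1 - (n : ℤ)), q ^ (-(n : ℤ))]
        (q ^ 2) p k)

lemma ellPoch_eq_zero {p q x : ℂ} (hp : ‖p‖ < 1) {m k : ℕ} (hmk : m < k) (hx : x * q ^ m = 1) :
    ellPoch x q p k = 0 :=
  Finset.prod_eq_zero (Finset.mem_range.2 hmk) (by rw [hx, ellE_one hp])

/-- In base q² the series is terminated by q^{-n} when n is even and by q^{1-n} when n is odd. -/
lemma ellPoch_mul_ellPoch_eq_zero {p q : ℂ} (hp : ‖p‖ < 1) (hq0 : q ≠ 0) {n k : ℕ}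
    (hk : n < 2 * k) :
    ellPoch (q ^ (1 - (n : ℤ))) (q ^ 2) p k * ellPoch (q ^ (-(n : ℤ))) (q ^ 2) p k = 0 := by
  obtain ⟨m, rfl | rfl⟩ := Nat.even_or_odd' n
  · rw [ellPoch_eq_zero hp (show m < k by omega) (x := q ^ (-((2 * m : ℕ) : ℤ))), mul_zero]
    rw [← pow_mul, ← zpow_natCast, ← zpow_add₀ hq0]; simp
  · rw [ellPoch_eq_zero hp (show m < k by omega) (x := q ^ (1 - ((2 * m + 1 : ℕ) : ℤ))), zero_mul]
    rw [← pow_mul, ← zpow_natCast, ← zpow_add₀ hq0]; simp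

lemma transOmegaTerm_eq_zero {p q : ℂ} (hp : ‖p‖ < 1) (hq0 : q ≠ 0) (a b c d e f : ℂ) {n k : ℕ}
    (hk : n < 2 * k) : transOmegaTerm q n p a b c d e f k = 0 := by
  have := ellPoch_mul_ellPoch_eq_zero hp hq0 hk
  rw [transOmegaTerm, show ellPochs [a ^ 2 / (e * f), b, c, d, a / e, a / f, q ^ (1 - (n : ℤ)),
    q ^ (-(n : ℤ))] (q ^ 2) p k = 0 from by
      simp only [ellPochs, List.map_cons, List.map_nil, List.prod_cons, List.prod_nil, mul_one, this,
        mul_zero]]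
  simp

/-- The free bound M serves both uses: n/2 avoids possibly vanishing denominators, and n matches the
range of the additive identity. -/
lemma ellOmega_eq_sum {p q : ℂ} (hp : ‖p‖ < 1) (hq0 : q ≠ 0) (a b c d e f : ℂ) (n M : ℕ)
    (hM : n / 2 ≤ M) :
    ellOmega (a ^ 2 / (e * f)) [b, c, d, a / e, a / f, q ^ (1 - (n : ℤ)), q ^ (-(n : ℤ))] (q ^ 2) p =
      ∑ k ∈ Finset.range (M + 1), transOmegaTerm q n p a b c d e f k :=
  tsum_eq_sum fun k hk => transOmegaTerm_eq_zero hp hq0 a b c d e f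
    (by have := mt Finset.mem_range.2 hk; omega)

/-- Reflection and balancing trade the factor in A - D for factors in A - B - C, the form in which
the theorem is stated. -/
lemma quadProd_eq {σ : ℂ → ℂ} (hσ : IsSigmaLike σ) {A B C D h : ℂ}
    (hD : AvoidsZeros σ (A - D) h) (hBC : AvoidsZeros σ (A - B - C) h)
    (hBCD : B + C + D = 2 * A + h) (n : ℕ) :
    quadProd σ A B C D h n =
      (shiftProd σ (A + h) h n * shiftProd σ (A + h - B - C) h n *
        (shiftProd σ (A + (1 - n) * h - B) (2 * h) n *
          shiftProd σ (A + (1 - n) * h - C) (2 * h) n)) /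
      (shiftProd σ (A + h - B) h n * shiftProd σ (A + h - C) h n *
        (shiftProd σ (A + (1 - n) * h) (2 * h) n *
          shiftProd σ (A + (1 - n) * h - B - C) (2 * h) n)) := by
  have key : shiftProd σ (A + h - B - C) h n / shiftProd σ (A + (1 - n) * h - B - C) (2 * h) n =
      quadRatio σ (A - D) h n := by
    rw [quadRatio, div_eq_div_iff (hBC.shiftProd_two_ne (1 - n) (by push_cast; ring) n)
      (hD.shiftProd_ne 1 (by push_cast; ring) n), hσ.shiftProd_reflect (A + h - B - C),
      hσ.shiftProd_reflect (A + (1 - n) * h - B - C), mul_assoc, mul_left_comm _ ((-1) ^ n)]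
    congr 1
    rw [show -(A + h - B - C) - ((n : ℂ) - 1) * h = A - D + (1 - n) * h by
        linear_combination hBCD,
      show -(A + (1 - (n : ℂ)) * h - B - C) - (n - 1) * (2 * h) = A - D + (1 - n) * h + h by
        linear_combination hBCD, ← shiftProd_two_mul, two_mul, shiftProd_add]
    congr 2; ring
  rw [quadProd, ← key, quadRatio, quadRatio, quadRatio,
    show A - B + (1 - n) * h = A + (1 - n) * h - B by ring,
    show A - C + (1 - n) * h = A + (1 - n) * h - C by ring,
    show A - B + h = A + h - B by ring, show A - C + h = A + h - C by ring]
  simp only [div_eq_mul_inv, mul_inv, inv_inv]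
  ring

end GenericTransformation

/-! ### The transformation for generic parameters. -/

section GenericTransformation

lemma exp_mul_eq {u s t : ℂ} (hu : u = 0) (hst : s = t) : Complex.exp u * s = t := by
  rw [hu, Complex.exp_zero, one_mul, hst]

/-- With `div_eq_exp_mul` this gathers all exponential prefactors of a term into one exponent, which
then has to vanish. -/
lemma mul_eq_exp_mul {x y u v s t : ℂ} (hx : x = Complex.exp u * s) (hy : y = Complex.exp v * t) :
    x * y = Complex.exp (u + v) * (s * t) := by
  rw [hx, hy, Complex.exp_add]; ring

lemma div_eq_exp_mul {x y u v s t : ℂ} (hx : x = Complex.exp u * s) (hy : y = Complex.exp v * t) :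
    x / y = Complex.exp (u - v) * (s / t) := by
  rw [hx, hy, Complex.exp_sub, mul_div_mul_comm]

lemma exp_pow_eq_exp_mul (h : ℂ) (m : ℕ) :
    Complex.exp h ^ m = Complex.exp (m * h) * 1 := by
  rw [mul_one, Complex.exp_nat_mul]

lemma ellPochs_triple (x y z q p : ℂ) (k : ℕ) :
    ellPochs [x, y, z] q p k = ellPoch x q p k * ellPoch y q p k * ellPoch z q p k := by
  simp [ellPochs, mul_assoc]

lemma ellPochs_pair (x y q p : ℂ) (k : ℕ) :
    ellPochs [x, y] q p k = ellPoch x q p k * ellPoch y q p k := by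
  simp [ellPochs]

lemma transLhs_exp (p : ℂ) {A B C D E F h : ℂ} {n : ℕ} (hBCD : B + C + D = 2 * A + h)
    (hEF : E + F = A + (n + 1) * h) :
    transLhs (Complex.exp h) n p (Complex.exp A) (Complex.exp B) (Complex.exp C) (Complex.exp D)
      (Complex.exp E) (Complex.exp F) =
    ∑ k ∈ Finset.range (n + 1), transCoeff (ellSigma p) A h n k *
      quadFactor (ellSigma p) A B C D h k *
      (shiftProd (ellSigma p) E h k * shiftProd (ellSigma p) F h k /
        (shiftProd (ellSigma p) (A + 2 * h - E) (2 * h) k *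
          shiftProd (ellSigma p) (A + 2 * h - F) (2 * h) k)) := by
  refine Finset.sum_congr rfl fun k _ => ?_
  have hq2 : Complex.exp h ^ 2 = Complex.exp (2 * h) := by rw [← Complex.exp_nat_mul]; norm_num
  have h1 : Complex.exp A * Complex.exp h ^ (3 * k) = Complex.exp (A + 3 * k * h) := by
    rw [← Complex.exp_nat_mul, ← Complex.exp_add]; push_cast; ring_nf
  have h2 : ∀ x, Complex.exp A * Complex.exp h / Complex.exp x = Complex.exp (A + h - x) := fun x => by
    rw [Complex.exp_sub, Complex.exp_add]
  have h3 : ∀ x, Complex.exp A * Complex.exp h ^ 2 / Complex.exp x = Complex.exp (A + 2 * h - x) :=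
    fun x => by rw [Complex.exp_sub, Complex.exp_add, hq2]
  have h4 : Complex.exp h ^ (-(n : ℤ)) = Complex.exp (-n * h) := by
    rw [← Complex.exp_int_mul]; push_cast; rfl
  have h5 : Complex.exp A * Complex.exp h ^ (n + 2) = Complex.exp (A + (n + 2) * h) := by
    rw [← Complex.exp_nat_mul, ← Complex.exp_add]; push_cast; ring_nf
  simp only [ellPochs_triple]
  rw [mul_eq_exp_mul (mul_eq_exp_mul (mul_eq_exp_mul
    (div_eq_exp_mul (ellE_eq_exp_mul h1) (ellE_exp p A))
    (div_eq_exp_mul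
      (mul_eq_exp_mul (mul_eq_exp_mul (ellPoch_eq_exp_mul rfl hq2 k) (ellPoch_eq_exp_mul rfl hq2 k))
        (ellPoch_eq_exp_mul rfl hq2 k))
      (mul_eq_exp_mul (mul_eq_exp_mul (ellPoch_eq_exp_mul (h2 B) rfl k)
        (ellPoch_eq_exp_mul (h2 C) rfl k)) (ellPoch_eq_exp_mul (h2 D) rfl k))))
    (div_eq_exp_mul
      (mul_eq_exp_mul (mul_eq_exp_mul (ellPoch_eq_exp_mul rfl rfl k) (ellPoch_eq_exp_mul rfl rfl k))
        (ellPoch_eq_exp_mul h4 rfl k))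
      (mul_eq_exp_mul (mul_eq_exp_mul (ellPoch_eq_exp_mul (h3 E) hq2 k)
        (ellPoch_eq_exp_mul (h3 F) hq2 k)) (ellPoch_eq_exp_mul h5 hq2 k))))
    (exp_pow_eq_exp_mul h k)]
  refine exp_mul_eq ?_ ?_
  · linear_combination (k : ℂ) * hBCD + (k : ℂ) * hEF
  · simp only [transCoeff, quadFactor, div_eq_mul_inv, mul_inv]
    ring

lemma transPrefactor_exp (p : ℂ) (A B C h : ℂ) (n : ℕ) :
    transPrefactor (Complex.exp h) n p (Complex.exp A) (Complex.exp B) (Complex.exp C) =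
    (shiftProd (ellSigma p) (A + h) h n * shiftProd (ellSigma p) (A + h - B - C) h n *
        (shiftProd (ellSigma p) (A + (1 - n) * h - B) (2 * h) n *
          shiftProd (ellSigma p) (A + (1 - n) * h - C) (2 * h) n)) /
      (shiftProd (ellSigma p) (A + h - B) h n * shiftProd (ellSigma p) (A + h - C) h n *
        (shiftProd (ellSigma p) (A + (1 - n) * h) (2 * h) n *
          shiftProd (ellSigma p) (A + (1 - n) * h - B - C) (2 * h) n)) := by
  have hq2 : Complex.exp h ^ 2 = Complex.exp (2 * h) := by rw [← Complex.exp_nat_mul]; norm_num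
  have h1 : Complex.exp A * Complex.exp h = Complex.exp (A + h) := (Complex.exp_add _ _).symm
  have h2 : ∀ x, Complex.exp A * Complex.exp h / Complex.exp x = Complex.exp (A + h - x) := fun x => by
    rw [Complex.exp_sub, Complex.exp_add]
  have h3 : Complex.exp A * Complex.exp h / (Complex.exp B * Complex.exp C) =
      Complex.exp (A + h - B - C) := by
    rw [Complex.exp_sub, Complex.exp_sub, Complex.exp_add, div_div]
  have h4 : Complex.exp A * Complex.exp h ^ (1 - (n : ℤ)) = Complex.exp (A + (1 - n) * h) := by
    rw [← Complex.exp_int_mul, ← Complex.exp_add]; push_cast; rfl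
  have h5 : ∀ x, Complex.exp A * Complex.exp h ^ (1 - (n : ℤ)) / Complex.exp x =
      Complex.exp (A + (1 - n) * h - x) := fun x => by rw [h4, ← Complex.exp_sub]
  have h6 : Complex.exp A * Complex.exp h ^ (1 - (n : ℤ)) / (Complex.exp B * Complex.exp C) =
      Complex.exp (A + (1 - n) * h - B - C) := by
    rw [← div_div, h5, ← Complex.exp_sub]
  simp only [transPrefactor, ellPochs_pair]
  rw [div_eq_exp_mul
    (mul_eq_exp_mul
      (mul_eq_exp_mul (ellPoch_eq_exp_mul h1 rfl n) (ellPoch_eq_exp_mul h3 rfl n))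
      (mul_eq_exp_mul (ellPoch_eq_exp_mul (h5 B) hq2 n) (ellPoch_eq_exp_mul (h5 C) hq2 n)))
    (mul_eq_exp_mul
      (mul_eq_exp_mul (ellPoch_eq_exp_mul (h2 B) rfl n) (ellPoch_eq_exp_mul (h2 C) rfl n))
      (mul_eq_exp_mul (ellPoch_eq_exp_mul h4 hq2 n) (ellPoch_eq_exp_mul h6 hq2 n)))]
  refine exp_mul_eq ?_ rfl
  ring

lemma transOmegaTerm_exp (p : ℂ) {A B C D E F h : ℂ} {n : ℕ} (hBCD : B + C + D = 2 * A + h)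
    (hEF : E + F = A + (n + 1) * h) (r : ℕ) :
    transOmegaTerm (Complex.exp h) n p (Complex.exp A) (Complex.exp B) (Complex.exp C)
      (Complex.exp D) (Complex.exp E) (Complex.exp F) r =
    omegaCoeff (ellSigma p) A B C D h n r *
      (shiftProd (ellSigma p) (A - E) (2 * h) r * shiftProd (ellSigma p) (A - F) (2 * h) r /
        (shiftProd (ellSigma p) (A + 2 * h - E) (2 * h) r *
          shiftProd (ellSigma p) (A + 2 * h - F) (2 * h) r)) := by
  have hq2 : Complex.exp h ^ 2 = Complex.exp (2 * h) := by rw [← Complex.exp_nat_mul]; norm_num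
  have h0 : Complex.exp A ^ 2 / (Complex.exp E * Complex.exp F) = Complex.exp (A - (n + 1) * h) := by
    rw [← Complex.exp_nat_mul, ← Complex.exp_add, ← Complex.exp_sub]
    congr 1
    push_cast
    linear_combination -hEF
  have h1 : Complex.exp (A - (n + 1) * h) * Complex.exp (2 * h) ^ (2 * r) =
      Complex.exp (A - (n + 1) * h + 2 * r * (2 * h)) := by
    rw [← Complex.exp_nat_mul, ← Complex.exp_add]; push_cast; rfl
  have h2 : ∀ x, Complex.exp (A - (n + 1) * h) * Complex.exp (2 * h) / Complex.exp x =
      Complex.exp (A + (1 - n) * h - x) := fun x => by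
    rw [← Complex.exp_add, ← Complex.exp_sub]; ring_nf
  have h3 : Complex.exp h ^ (-(n : ℤ)) = Complex.exp (-n * h) := by
    rw [← Complex.exp_int_mul]; push_cast; rfl
  have h4 : Complex.exp h ^ (1 - (n : ℤ)) = Complex.exp ((1 - n) * h) := by
    rw [← Complex.exp_int_mul]; push_cast; rfl
  have h5 : ∀ x, Complex.exp A / Complex.exp x = Complex.exp (A - x) :=
    fun x => (Complex.exp_sub _ _).symm
  have h6 : A + (1 - n) * h - (A - E) = A + 2 * h - F := by linear_combination hEF
  have h7 : A + (1 - n) * h - (A - F) = A + 2 * h - E := by linear_combination hEF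
  have h8 : A + (1 - n) * h - (1 - n) * h = A := by ring
  have h9 : A + (1 - n) * h - -n * h = A + h := by ring
  have hP : ∀ z, ellPoch (Complex.exp z) (Complex.exp (2 * h)) p r = Complex.exp
      (r * z / 2 + r * (r - 1) * (2 * h) / 4) * shiftProd (ellSigma p) z (2 * h) r :=
    fun z => ellPoch_eq_exp_mul rfl rfl r
  simp only [transOmegaTerm, ellOmegaDen, ellPochs, List.map_cons, List.map_nil, List.prod_cons,
    List.prod_nil, mul_one, hq2, h0, h1, h3, h4, h5, h2, h6, h7, h8, h9]
  rw [mul_eq_exp_mul (div_eq_exp_mul (ellE_exp p _) (ellE_exp p _))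
    (div_eq_exp_mul (mul_eq_exp_mul
      (mul_eq_exp_mul (hP _) (mul_eq_exp_mul (hP _) (mul_eq_exp_mul (hP _) (mul_eq_exp_mul (hP _)
        (mul_eq_exp_mul (hP _) (mul_eq_exp_mul (hP _) (mul_eq_exp_mul (hP _) (hP _))))))))
      (exp_pow_eq_exp_mul (2 * h) r))
      (mul_eq_exp_mul (hP _) (mul_eq_exp_mul (hP _) (mul_eq_exp_mul (hP _) (mul_eq_exp_mul (hP _)
        (mul_eq_exp_mul (hP _) (mul_eq_exp_mul (hP _) (mul_eq_exp_mul (hP _) (hP _)))))))))]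
  refine exp_mul_eq ?_ ?_
  · linear_combination (r : ℂ) * hBCD
  · simp only [omegaCoeff, div_eq_mul_inv, mul_inv]
    ring

/-- The quadratic transformation for generic parameters. -/
theorem transLhs_eq_of_generic {p q : ℂ} (hp0 : p ≠ 0) (hp : ‖p‖ < 1) (hq0 : q ≠ 0)
    (hpq : ∀ i j : ℤ, q ^ i = p ^ j → i = 0) {n : ℕ} {a b c d e f : ℂ} (ha0 : a ≠ 0)
    (hbcd : b * c * d = a ^ 2 * q) (hef : e * f = a * q ^ (n + 1))
    (ha : a ∉ ellLattice p q) (hb : a / b ∉ ellLattice p q) (hc : a / c ∉ ellLattice p q)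
    (hd : a / d ∉ ellLattice p q) (he : a / e ∉ ellLattice p q) (hf : a / f ∉ ellLattice p q) :
    transLhs q n p a b c d e f = transPrefactor q n p a b c *
      ∑ k ∈ Finset.range (n / 2 + 1), transOmegaTerm q n p a b c d e f k := by
  have hbcd0 : b * c * d ≠ 0 := hbcd ▸ mul_ne_zero (pow_ne_zero _ ha0) hq0
  have hef0 : e * f ≠ 0 := hef ▸ mul_ne_zero ha0 (pow_ne_zero _ hq0)
  have hbc0 := left_ne_zero_of_mul hbcd0
  obtain ⟨h, rfl⟩ : ∃ h, q = Complex.exp h := ⟨_, (Complex.exp_log hq0).symm⟩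
  obtain ⟨A, rfl⟩ : ∃ A, a = Complex.exp A := ⟨_, (Complex.exp_log ha0).symm⟩
  obtain ⟨B, rfl⟩ : ∃ B, b = Complex.exp B :=
    ⟨_, (Complex.exp_log (left_ne_zero_of_mul hbc0)).symm⟩
  obtain ⟨C, rfl⟩ : ∃ C, c = Complex.exp C :=
    ⟨_, (Complex.exp_log (right_ne_zero_of_mul hbc0)).symm⟩
  obtain ⟨E, rfl⟩ : ∃ E, e = Complex.exp E :=
    ⟨_, (Complex.exp_log (left_ne_zero_of_mul hef0)).symm⟩
  -- Logarithms are determined only modulo 2πi. Those of d and f are therefore defined by the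
  -- balancing conditions, so that these hold exactly in additive form.
  obtain ⟨D, hBCD, rfl⟩ : ∃ D, B + C + D = 2 * A + h ∧ d = Complex.exp D := by
    refine ⟨2 * A + h - (B + C), by ring, mul_left_cancel₀ hbc0 ?_⟩
    rw [hbcd, ← Complex.exp_add, ← Complex.exp_add, ← Complex.exp_nat_mul, ← Complex.exp_add]
    push_cast; ring_nf
  obtain ⟨F, hEF, rfl⟩ : ∃ F, E + F = A + (n + 1) * h ∧ f = Complex.exp F := by
    refine ⟨A + (n + 1) * h - E, by ring, mul_left_cancel₀ (left_ne_zero_of_mul hef0) ?_⟩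
    rw [hef, ← Complex.exp_add, ← Complex.exp_nat_mul, ← Complex.exp_add]
    push_cast; ring_nf
  simp only [← Complex.exp_sub] at hb hc hd he hf
  have hσ := isSigmaLike_ellSigma hp0 hp
  have hA' := avoidsZeros_ellSigma hp0 hp ha
  have hB' := avoidsZeros_ellSigma hp0 hp hb
  have hC' := avoidsZeros_ellSigma hp0 hp hc
  have hD' := avoidsZeros_ellSigma hp0 hp hd
  rw [← ellOmega_eq_sum hp hq0 _ _ _ _ _ _ n (n / 2) le_rfl,
    ellOmega_eq_sum hp hq0 _ _ _ _ _ _ n n (Nat.div_le_self _ _),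
    transLhs_exp p hBCD hEF, transPrefactor_exp]
  have hBC : AvoidsZeros (ellSigma p) (A - B - C) h :=
    (hD'.neg hσ).add (-1) (by push_cast; linear_combination -hBCD)
  rw [← quadProd_eq hσ hD' hBC hBCD]
  simp only [transOmegaTerm_exp p hBCD hEF]
  exact sum_transCoeff hσ (ellSigma_int_mul_ne_zero hp0 hp hpq) hA' hB' hC' hD'
    (avoidsZeros_ellSigma hp0 hp he) (avoidsZeros_ellSigma hp0 hp hf) hBCD hEF

end GenericTransformation

/-! ### Continuity in the parameters and the nome. -/

section Continuity

open Filter Topology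

/-- Joint continuity, from locally uniform convergence of the product dominated by a geometric
series; the nome 0 is included. -/
lemma continuousAt_qPochInf {y : ℂ × ℂ} (hy : ‖y.2‖ < 1) :
    ContinuousAt (fun y : ℂ × ℂ => qPochInf y.1 y.2) y := by
  obtain ⟨ρ, h1, h2⟩ := exists_between hy
  have hρ : 0 ≤ ρ := (norm_nonneg _).trans h1.le
  set K : Set (ℂ × ℂ) := {z | ‖z.1‖ < ‖y.1‖ + 1} ∩ {z | ‖z.2‖ < ρ}
  have hKo : IsOpen K := (isOpen_lt continuous_fst.norm continuous_const).inter
    (isOpen_lt continuous_snd.norm continuous_const)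
  have hyK : y ∈ K := ⟨lt_add_one ‖y.1‖, h1⟩
  have h := Summable.hasProdLocallyUniformlyOn_nat_one_add hKo
    (f := fun k z => -(z.1 * z.2 ^ k)) (u := fun k => (‖y.1‖ + 1) * ρ ^ k)
    ((summable_geometric_of_lt_one hρ h2).mul_left _)
    (Eventually.of_forall fun k z hz => by
      rw [norm_neg, norm_mul, norm_pow]
      have h1 : ‖z.1‖ ≤ ‖y.1‖ + 1 := le_of_lt hz.1
      have h2 : ‖z.2‖ ≤ ρ := le_of_lt hz.2
      gcongr)
    (fun k => by fun_prop)
  have h' := h.tendstoLocallyUniformlyOn_finsetRange.continuousOn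
    (Frequently.of_forall fun N => by fun_prop)
  simpa only [qPochInf, ← sub_eq_add_neg] using h'.continuousAt (hKo.mem_nhds hyK)

variable {x p : ℂ → ℂ} {s : ℂ}

lemma ContinuousAt.ellE (hx : ContinuousAt x s) (hp : ContinuousAt p s) (hx0 : x s ≠ 0)
    (hp1 : ‖p s‖ < 1) : ContinuousAt (fun t => ellE (x t) (p t)) s :=
  ((continuousAt_qPochInf (y := (x s, p s)) hp1).comp
      (f := fun t => (x t, p t)) (hx.prodMk hp)).mul
    ((continuousAt_qPochInf (y := (p s / x s, p s)) hp1).comp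
      (f := fun t => (p t / x t, p t)) ((hp.div hx hx0).prodMk hp))

lemma ContinuousAt.ellPoch {q : ℂ} (hq0 : q ≠ 0) (k : ℕ) (hx : ContinuousAt x s)
    (hp : ContinuousAt p s) (hx0 : x s ≠ 0) (hp1 : ‖p s‖ < 1) :
    ContinuousAt (fun t => ellPoch (x t) q (p t) k) s :=
  tendsto_finsetProd _ fun j _ => ContinuousAt.ellE (hx.mul_const _) hp
    (mul_ne_zero hx0 (pow_ne_zero j hq0)) hp1

lemma ContinuousAt.ellPochs {q : ℂ} (hq0 : q ≠ 0) (k : ℕ) (hp : ContinuousAt p s)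
    (hp1 : ‖p s‖ < 1) (l : List (ℂ → ℂ)) (hl : ∀ x ∈ l, ContinuousAt x s ∧ x s ≠ 0) :
    ContinuousAt (fun t => ellPochs (l.map (· t)) q (p t) k) s := by
  induction l with
  | nil => exact continuousAt_const
  | cons x l ih =>
    rw [List.forall_mem_cons] at hl
    exact (ContinuousAt.ellPoch hq0 k hl.1.1 hp hl.1.2 hp1).mul (ih hl.2)

lemma ellPoch_ne_zero_of_le {x q p : ℂ} {n k : ℕ} (h : ellPoch x q p n ≠ 0) (hk : k ≤ n) :
    ellPoch x q p k ≠ 0 :=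
  Finset.prod_ne_zero_iff.2 fun j hj => Finset.prod_ne_zero_iff.1 h j
    (Finset.mem_range.2 ((Finset.mem_range.1 hj).trans_le hk))

lemma ellPochs_ne_zero_of_le {l : List ℂ} {q p : ℂ} {n k : ℕ} (h : ellPochs l q p n ≠ 0)
    (hk : k ≤ n) : ellPochs l q p k ≠ 0 := by
  induction l with
  | nil => exact one_ne_zero
  | cons x l ih =>
    exact mul_ne_zero (ellPoch_ne_zero_of_le (left_ne_zero_of_mul h) hk)
      (ih (right_ne_zero_of_mul h))

end Continuity

/-! ### Removal of the genericity assumptions. -/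

section Specialization

open Filter Topology

/-- No denominator in the quadratic transformation vanishes. -/
structure TransNondegenerate (q : ℂ) (n : ℕ) (p a b c d e f : ℂ) : Prop where
  base : ellE a p ≠ 0
  poch : ellPochs [a * q / b, a * q / c, a * q / d] q p n ≠ 0
  poch_sq : ellPochs [a * q ^ 2 / e, a * q ^ 2 / f, a * q ^ (n + 2)] (q ^ 2) p n ≠ 0
  prefactor : ellPochs [a * q ^ (1 - (n : ℤ)), a * q ^ (1 - (n : ℤ)) / (b * c)] (q ^ 2) p n ≠ 0
  omega_base : ellE (a ^ 2 / (e * f)) p ≠ 0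
  omega : ellOmegaDen (a ^ 2 / (e * f))
    [b, c, d, a / e, a / f, q ^ (1 - (n : ℤ)), q ^ (-(n : ℤ))] (q ^ 2) p (n / 2) ≠ 0

lemma TransNondegenerate.poch_pair {q : ℂ} {n : ℕ} {p a b c d e f : ℂ}
    (h : TransNondegenerate q n p a b c d e f) : ellPochs [a * q / b, a * q / c] q p n ≠ 0 := by
  have := h.poch
  rw [ellPochs_triple] at this
  rw [ellPochs_pair]
  exact left_ne_zero_of_mul this

variable {q : ℂ} {n : ℕ} {p a b c d e f : ℂ → ℂ} {s : ℂ}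

lemma eventually_and_continuousAt_trans (hq0 : q ≠ 0) (hp : ContinuousAt p s) (hp1 : ‖p s‖ < 1)
    (ha : ContinuousAt a s) (hb : ContinuousAt b s) (hc : ContinuousAt c s) (hd : ContinuousAt d s)
    (he : ContinuousAt e s) (hf : ContinuousAt f s) (ha0 : a s ≠ 0) (hb0 : b s ≠ 0) (hc0 : c s ≠ 0)
    (hd0 : d s ≠ 0) (he0 : e s ≠ 0) (hf0 : f s ≠ 0)
    (h : TransNondegenerate q n (p s) (a s) (b s) (c s) (d s) (e s) (f s)) :
    (∀ᶠ t in 𝓝 s, TransNondegenerate q n (p t) (a t) (b t) (c t) (d t) (e t) (f t)) ∧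
    ContinuousAt (fun t => transLhs q n (p t) (a t) (b t) (c t) (d t) (e t) (f t)) s ∧
    ContinuousAt (fun t => transPrefactor q n (p t) (a t) (b t) (c t) *
      ∑ k ∈ Finset.range (n / 2 + 1),
        transOmegaTerm q n (p t) (a t) (b t) (c t) (d t) (e t) (f t) k) s := by
  have hq2 : q ^ 2 ≠ 0 := pow_ne_zero 2 hq0
  have hz : ∀ i : ℤ, q ^ i ≠ 0 := fun i => zpow_ne_zero i hq0
  have hn : ∀ i : ℕ, q ^ i ≠ 0 := fun i => pow_ne_zero i hq0
  have hef0 : e s * f s ≠ 0 := mul_ne_zero he0 hf0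
  have hbc0 : b s * c s ≠ 0 := mul_ne_zero hb0 hc0
  have hae0 : a s / e s ≠ 0 := div_ne_zero ha0 he0
  have haf0 : a s / f s ≠ 0 := div_ne_zero ha0 hf0
  have hω0 : a s ^ 2 / (e s * f s) ≠ 0 := div_ne_zero (pow_ne_zero 2 ha0) hef0
  have hω : ContinuousAt (fun t => a t ^ 2 / (e t * f t)) s := (ha.pow 2).div (he.mul hf) hef0
  have c0 : ContinuousAt (fun t => ellE (a t) (p t)) s := ContinuousAt.ellE ha hp ha0 hp1
  have c1 (k : ℕ) := ContinuousAt.ellPochs hq0 k hp hp1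
    [fun t => a t * q / b t, fun t => a t * q / c t, fun t => a t * q / d t] (by
      simp only [List.forall_mem_cons, List.not_mem_nil, false_imp_iff, implies_true, and_true]
      refine ⟨⟨?_, ?_⟩, ⟨?_, ?_⟩, ⟨?_, ?_⟩⟩ <;> first | fun_prop (disch := assumption) | simp [*])
  have c1' (k : ℕ) := ContinuousAt.ellPochs hq0 k hp hp1
    [fun t => a t * q / b t, fun t => a t * q / c t] (by
      simp only [List.forall_mem_cons, List.not_mem_nil, false_imp_iff, implies_true, and_true]
      refine ⟨⟨?_, ?_⟩, ⟨?_, ?_⟩⟩ <;> first | fun_prop (disch := assumption) | simp [*])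
  have c1n (k : ℕ) := ContinuousAt.ellPochs hq2 k hp hp1 [b, c, d] (by
      simp only [List.forall_mem_cons, List.not_mem_nil, false_imp_iff, implies_true, and_true]
      exact ⟨⟨hb, hb0⟩, ⟨hc, hc0⟩, ⟨hd, hd0⟩⟩)
  have c2 (k : ℕ) := ContinuousAt.ellPochs hq2 k hp hp1
    [fun t => a t * q ^ 2 / e t, fun t => a t * q ^ 2 / f t, fun t => a t * q ^ (n + 2)] (by
      simp only [List.forall_mem_cons, List.not_mem_nil, false_imp_iff, implies_true, and_true]
      refine ⟨⟨?_, ?_⟩, ⟨?_, ?_⟩, ⟨?_, ?_⟩⟩ <;> first | fun_prop (disch := assumption) | simp [*])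
  have c2n (k : ℕ) := ContinuousAt.ellPochs hq0 k hp hp1 [e, f, fun _ => q ^ (-(n : ℤ))] (by
      simp only [List.forall_mem_cons, List.not_mem_nil, false_imp_iff, implies_true, and_true]
      exact ⟨⟨he, he0⟩, ⟨hf, hf0⟩, ⟨continuousAt_const, hz _⟩⟩)
  have c3 := ContinuousAt.ellPochs hq2 n hp hp1
    [fun t => a t * q ^ (1 - (n : ℤ)), fun t => a t * q ^ (1 - (n : ℤ)) / (b t * c t)] (by
      simp only [List.forall_mem_cons, List.not_mem_nil, false_imp_iff, implies_true, and_true]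
      refine ⟨⟨?_, ?_⟩, ⟨?_, ?_⟩⟩ <;> first | fun_prop (disch := assumption) | simp [*])
  have c3n := ContinuousAt.ellPochs hq0 n hp hp1
    [fun t => a t * q, fun t => a t * q / (b t * c t)] (by
      simp only [List.forall_mem_cons, List.not_mem_nil, false_imp_iff, implies_true, and_true]
      refine ⟨⟨?_, ?_⟩, ⟨?_, ?_⟩⟩ <;> first | fun_prop (disch := assumption) | simp [*])
  have c3n' := ContinuousAt.ellPochs hq2 n hp hp1
    [fun t => a t * q ^ (1 - (n : ℤ)) / b t, fun t => a t * q ^ (1 - (n : ℤ)) / c t] (by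
      simp only [List.forall_mem_cons, List.not_mem_nil, false_imp_iff, implies_true, and_true]
      refine ⟨⟨?_, ?_⟩, ⟨?_, ?_⟩⟩ <;> first | fun_prop (disch := assumption) | simp [*])
  have c4 : ContinuousAt (fun t => ellE (a t ^ 2 / (e t * f t)) (p t)) s :=
    ContinuousAt.ellE hω hp hω0 hp1
  have c5 (k : ℕ) : ContinuousAt (fun t => ellOmegaDen (a t ^ 2 / (e t * f t))
      [b t, c t, d t, a t / e t, a t / f t, q ^ (1 - (n : ℤ)), q ^ (-(n : ℤ))] (q ^ 2) (p t) k) s := by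
    have hx (x : ℂ → ℂ) (hx : ContinuousAt x s ∧ x s ≠ 0) :
        ContinuousAt (fun t => a t ^ 2 / (e t * f t) * q ^ 2 / x t) s ∧
          a s ^ 2 / (e s * f s) * q ^ 2 / x s ≠ 0 :=
      ⟨(hω.mul_const _).div hx.1 hx.2, div_ne_zero (mul_ne_zero hω0 hq2) hx.2⟩
    have := ContinuousAt.ellPochs hq2 k hp hp1 [fun _ => q ^ 2, _, _, _, _, _, _, _] (by
      simp only [List.forall_mem_cons, List.not_mem_nil, false_imp_iff, implies_true, and_true]
      exact ⟨⟨continuousAt_const, hq2⟩, hx b ⟨hb, hb0⟩, hx c ⟨hc, hc0⟩, hx d ⟨hd, hd0⟩,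
        hx (fun t => a t / e t) ⟨ha.div he he0, hae0⟩,
        hx (fun t => a t / f t) ⟨ha.div hf hf0, haf0⟩,
        hx (fun _ => q ^ (1 - (n : ℤ))) ⟨continuousAt_const, hz _⟩,
        hx (fun _ => q ^ (-(n : ℤ))) ⟨continuousAt_const, hz _⟩⟩)
    simpa only [ellOmegaDen, List.map_cons, List.map_nil] using this
  have c5n (k : ℕ) := ContinuousAt.ellPochs hq2 k hp hp1 [fun t => a t ^ 2 / (e t * f t), b, c, d,
      fun t => a t / e t, fun t => a t / f t, fun _ => q ^ (1 - (n : ℤ)),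
        fun _ => q ^ (-(n : ℤ))] (by
    simp only [List.forall_mem_cons, List.not_mem_nil, false_imp_iff, implies_true, and_true]
    exact ⟨⟨hω, hω0⟩, ⟨hb, hb0⟩, ⟨hc, hc0⟩, ⟨hd, hd0⟩, ⟨ha.div he he0, hae0⟩, ⟨ha.div hf hf0, haf0⟩,
      ⟨continuousAt_const, hz _⟩, ⟨continuousAt_const, hz _⟩⟩)
  simp only [List.map_cons, List.map_nil] at c1 c1' c1n c2 c2n c3 c3n c3n' c5n
  refine ⟨?_, ?_, ?_⟩
  · filter_upwards [c0.eventually_ne h.base, (c1 n).eventually_ne h.poch,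
      (c2 n).eventually_ne h.poch_sq, c3.eventually_ne h.prefactor, c4.eventually_ne h.omega_base,
      (c5 (n / 2)).eventually_ne h.omega] with t h1 h2 h3 h4 h5 h6
    exact ⟨h1, h2, h3, h4, h5, h6⟩
  · refine tendsto_finsetSum _ fun k hk => ?_
    have hk : k ≤ n := Nat.lt_succ_iff.1 (Finset.mem_range.1 hk)
    exact (((ContinuousAt.ellE (ha.mul_const _) hp (mul_ne_zero ha0 (hn _)) hp1).div c0 h.base).mul
      ((c1n k).div (c1 k) (ellPochs_ne_zero_of_le h.poch hk))).mul
        ((c2n k).div (c2 k) (ellPochs_ne_zero_of_le h.poch_sq hk)) |>.mul_const _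
  · refine ((c3n.mul c3n').div ((c1' n).mul c3) (mul_ne_zero h.poch_pair h.prefactor)).mul
      (tendsto_finsetSum _ fun k hk => ?_)
    have hk : k ≤ n / 2 := Nat.lt_succ_iff.1 (Finset.mem_range.1 hk)
    exact ((ContinuousAt.ellE (hω.mul_const _) hp (mul_ne_zero hω0 (pow_ne_zero _ hq2)) hp1).div c4
      h.omega_base).mul (((c5n k).mul_const _).div (c5 k) (ellPochs_ne_zero_of_le h.omega hk))

lemma countable_setOf_mul_pow_mem {S : Set ℂ} (hS : S.Countable) {w : ℂ} (hw : w ≠ 0) {m : ℕ}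
    (hm : 0 < m) : {t : ℂ | w * t ^ m ∈ S}.Countable := by
  refine (hS.biUnion fun z _ =>
    ((Polynomial.nthRoots m (z / w)).toFinset.finite_toSet.countable)).mono fun t ht => ?_
  refine Set.mem_biUnion ht ?_
  rw [Finset.mem_coe, Multiset.mem_toFinset, Polynomial.mem_nthRoots hm, mul_div_cancel_left₀ _ hw]

lemma countable_ellLattice (p q : ℂ) : (ellLattice p q).Countable := Set.countable_range _

/-- A relation q^i = p^j with i ≠ 0 forces j ≠ 0 because |q| < 1, so p is a root of some integral
power of q. There are countably many such p. -/
lemma countable_setOf_nongeneric {q : ℂ} (hq : ‖q‖ < 1) :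
    {p : ℂ | ¬(p ≠ 0 ∧ ∀ i j : ℤ, q ^ i = p ^ j → i = 0)}.Countable := by
  have hc : (Set.range fun i : ℤ => q ^ i).Countable := Set.countable_range _
  refine ((Set.countable_singleton (0 : ℂ)).union (Set.countable_iUnion fun m : ℕ =>
    countable_setOf_mul_pow_mem hc one_ne_zero m.succ_pos)).mono fun p hp => ?_
  by_contra hcon
  simp only [Set.mem_union, Set.mem_singleton_iff, Set.mem_iUnion, Set.mem_ofPred_eq, not_or,
    not_exists, one_mul] at hcon
  refine hp ⟨hcon.1, fun i j hij => ?_⟩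
  obtain rfl | hj := eq_or_ne j 0
  · by_contra hi
    rw [zpow_zero] at hij
    have := congrArg norm hij
    rw [norm_zpow, norm_one, zpow_eq_one_iff_right₀ (norm_nonneg _) hq.ne] at this
    exact hi this
  · obtain ⟨m, hm⟩ := Nat.exists_eq_succ_of_ne_zero (Int.natAbs_ne_zero.2 hj)
    refine absurd ?_ (hcon.2 m)
    obtain h | h := Int.natAbs_eq j
    · exact ⟨i, by simp only; rw [hij, h, zpow_natCast, hm]⟩
    · exact ⟨-i, by simp only; rw [zpow_neg, hij, h, zpow_neg, inv_inv, zpow_natCast, hm]⟩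

lemma frequently_nhds_of_countable {P : ℂ → Prop} (h : {t | ¬P t}.Countable) (s : ℂ) :
    ∃ᶠ t in 𝓝 s, P t := by
  have := h.dense_compl ℂ s
  rw [mem_closure_iff_frequently] at this
  simpa using this

end Specialization

section Specialization

open Filter Topology

lemma transLhs_eq_of_generic_nome {p q : ℂ} (hp0 : p ≠ 0) (hp : ‖p‖ < 1) (hq0 : q ≠ 0)
    (hpq : ∀ i j : ℤ, q ^ i = p ^ j → i = 0) {n : ℕ} {a b c d e f : ℂ} (ha0 : a ≠ 0)
    (hbcd : b * c * d = a ^ 2 * q) (hef : e * f = a * q ^ (n + 1))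
    (h : TransNondegenerate q n p a b c d e f) :
    transLhs q n p a b c d e f = transPrefactor q n p a b c *
      ∑ k ∈ Finset.range (n / 2 + 1), transOmegaTerm q n p a b c d e f k := by
  have hbcd0 : b * c * d ≠ 0 := hbcd ▸ mul_ne_zero (pow_ne_zero _ ha0) hq0
  have hef0 : e * f ≠ 0 := hef ▸ mul_ne_zero ha0 (pow_ne_zero _ hq0)
  obtain ⟨⟨hb0, hc0⟩, hd0⟩ := by simpa only [mul_ne_zero_iff] using hbcd0
  obtain ⟨he0, hf0⟩ := mul_ne_zero_iff.1 hef0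
  -- The exponents of t preserve both balancing conditions (2+2+2 = 2·3 and 1+2 = 3), while a and
  -- all ratios a/b, …, a/f vary with t. Each therefore meets the countable lattice only for
  -- countably many t.
  obtain ⟨-, h1, h2⟩ := eventually_and_continuousAt_trans (s := 1) (p := fun _ => p)
    (a := fun t => a * t ^ 3) (b := fun t => b * t ^ 2) (c := fun t => c * t ^ 2)
    (d := fun t => d * t ^ 2) (e := fun t => e * t) (f := fun t => f * t ^ 2) hq0
    (by fun_prop) hp (by fun_prop) (by fun_prop) (by fun_prop) (by fun_prop) (by fun_prop)
    (by fun_prop) (by simpa) (by simpa) (by simpa) (by simpa) (by simpa) (by simpa)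
    (by simpa using h)
  have hΛ := countable_ellLattice p q
  have hfreq : ∃ᶠ t : ℂ in 𝓝 1, ¬(t = 0 ∨ a * t ^ 3 ∈ ellLattice p q ∨
      a / b * t ^ 1 ∈ ellLattice p q ∨ a / c * t ^ 1 ∈ ellLattice p q ∨
      a / d * t ^ 1 ∈ ellLattice p q ∨ a / e * t ^ 2 ∈ ellLattice p q ∨
      a / f * t ^ 1 ∈ ellLattice p q) := by
    refine frequently_nhds_of_countable ?_ 1
    simp only [not_not]
    exact (Set.countable_singleton (0 : ℂ)).union
      ((countable_setOf_mul_pow_mem hΛ ha0 (by norm_num)).union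
      ((countable_setOf_mul_pow_mem hΛ (div_ne_zero ha0 hb0) one_pos).union
      ((countable_setOf_mul_pow_mem hΛ (div_ne_zero ha0 hc0) one_pos).union
      ((countable_setOf_mul_pow_mem hΛ (div_ne_zero ha0 hd0) one_pos).union
      ((countable_setOf_mul_pow_mem hΛ (div_ne_zero ha0 he0) two_pos).union
      (countable_setOf_mul_pow_mem hΛ (div_ne_zero ha0 hf0) one_pos))))))
  have key := tendsto_nhds_unique_of_frequently_eq h1.tendsto h2.tendsto (hfreq.mono fun t ht => by
    simp only [not_or] at ht
    obtain ⟨ht0, hA, hB, hC, hD, hE, hF⟩ := ht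
    refine transLhs_eq_of_generic hp0 hp hq0 hpq (mul_ne_zero ha0 (pow_ne_zero 3 ht0))
      (by linear_combination t ^ 6 * hbcd) (by linear_combination t ^ 3 * hef) hA ?_ ?_ ?_ ?_ ?_
    · rwa [show a * t ^ 3 / (b * t ^ 2) = a / b * t ^ 1 by field_simp]
    · rwa [show a * t ^ 3 / (c * t ^ 2) = a / c * t ^ 1 by field_simp]
    · rwa [show a * t ^ 3 / (d * t ^ 2) = a / d * t ^ 1 by field_simp]
    · rwa [show a * t ^ 3 / (e * t) = a / e * t ^ 2 by field_simp]
    · rwa [show a * t ^ 3 / (f * t ^ 2) = a / f * t ^ 1 by field_simp])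
  simpa using key

/-- Only the nome is varied here: generic nomes are dense and both sides are continuous at p, which
also covers p = 0, where no sigma function was constructed. -/
theorem transLhs_eq {p q : ℂ} (hp : ‖p‖ < 1) (hq0 : q ≠ 0) (hq : ‖q‖ < 1) {n : ℕ}
    {a b c d e f : ℂ} (ha0 : a ≠ 0) (hbcd : b * c * d = a ^ 2 * q)
    (hef : e * f = a * q ^ (n + 1)) (h : TransNondegenerate q n p a b c d e f) :
    transLhs q n p a b c d e f = transPrefactor q n p a b c *
      ∑ k ∈ Finset.range (n / 2 + 1), transOmegaTerm q n p a b c d e f k := by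
  have hbcd0 : b * c * d ≠ 0 := hbcd ▸ mul_ne_zero (pow_ne_zero _ ha0) hq0
  have hef0 : e * f ≠ 0 := hef ▸ mul_ne_zero ha0 (pow_ne_zero _ hq0)
  obtain ⟨⟨hb0, hc0⟩, hd0⟩ := by simpa only [mul_ne_zero_iff] using hbcd0
  obtain ⟨he0, hf0⟩ := mul_ne_zero_iff.1 hef0
  obtain ⟨h0, h1, h2⟩ := eventually_and_continuousAt_trans (s := p) (p := fun t => t)
    (a := fun _ => a) (b := fun _ => b) (c := fun _ => c) (d := fun _ => d) (e := fun _ => e)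
    (f := fun _ => f) hq0 continuousAt_id hp continuousAt_const continuousAt_const
    continuousAt_const continuousAt_const continuousAt_const continuousAt_const
    ha0 hb0 hc0 hd0 he0 hf0 h
  have hlt : ∀ᶠ t : ℂ in 𝓝 p, ‖t‖ < 1 := continuous_norm.continuousAt.eventually_lt_const hp
  exact tendsto_nhds_unique_of_frequently_eq h1.tendsto h2.tendsto
    (((frequently_nhds_of_countable (countable_setOf_nongeneric hq) p).and_eventually
      (h0.and hlt)).mono fun t ht =>
        transLhs_eq_of_generic_nome ht.1.1 ht.2.2 hq0 ht.1.2 ha0 hbcd hef ht.2.1)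

end Specialization
theorem mainTheorem5 (p q : ℂ) (hp : ‖p‖ < 1) (hq0 : q ≠ 0) (hq : ‖q‖ < 1) (n : ℕ)
    (a b c d e f : ℂ) (ha : a ≠ 0)
    (hbcd : b * c * d = a ^ 2 * q) (hef : e * f = a * q ^ (n + 1))
    -- none of the denominators of the terms `0 ≤ k ≤ n` on the left vanishes
    (hL₀ : ellE a p ≠ 0)
    (hL₁ : ellPochs [a * q / b, a * q / c, a * q / d] q p n ≠ 0)
    (hL₂ : ellPochs [a * q ^ 2 / e, a * q ^ 2 / f, a * q ^ (n + 2)] (q ^ 2) p n ≠ 0)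
    -- nor does the remaining denominator of the product on the right
    (hR₀ : ellPochs [a * q ^ (1 - (n : ℤ)), a * q ^ (1 - (n : ℤ)) / (b * c)] (q ^ 2) p n ≠ 0)
    -- nor do the denominators of the terms `0 ≤ k ≤ ⌊n/2⌋` of the terminating series on the right
    (hR₁ : ellE (a ^ 2 / (e * f)) p ≠ 0)
    (hR₂ : ellOmegaDen (a ^ 2 / (e * f))
      [b, c, d, a / e, a / f, q ^ (1 - (n : ℤ)), q ^ (-(n : ℤ))] (q ^ 2) p (n / 2) ≠ 0) :
    ∑ k ∈ Finset.range (n + 1),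
        ellE (a * q ^ (3 * k)) p / ellE a p *
          (ellPochs [b, c, d] (q ^ 2) p k /
            ellPochs [a * q / b, a * q / c, a * q / d] q p k) *
          (ellPochs [e, f, q ^ (-(n : ℤ))] q p k /
            ellPochs [a * q ^ 2 / e, a * q ^ 2 / f, a * q ^ (n + 2)] (q ^ 2) p k) *
          q ^ k =
      (ellPochs [a * q, a * q / (b * c)] q p n *
          ellPochs [a * q ^ (1 - (n : ℤ)) / b, a * q ^ (1 - (n : ℤ)) / c] (q ^ 2) p n) /
        (ellPochs [a * q / b, a * q / c] q p n *
          ellPochs [a * q ^ (1 - (n : ℤ)), a * q ^ (1 - (n : ℤ)) / (b * c)] (q ^ 2) p n) *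
        ellOmega (a ^ 2 / (e * f))
          [b, c, d, a / e, a / f, q ^ (1 - (n : ℤ)), q ^ (-(n : ℤ))] (q ^ 2) p := by
  rw [ellOmega_eq_sum hp hq0 a b c d e f n (n / 2) le_rfl]
  exact transLhs_eq hp hq0 hq ha hbcd hef ⟨hL₀, hL₁, hL₂, hR₀, hR₁, hR₂⟩
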